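/- **Setting.** Let $X$ be a smooth $n$-manifold (Hausdorff, paracompact, without boundary). A closed subset $D\subset X$ is a *normal crossing divisor* if around each $p\in D$ there is a smooth chart centred at $p$ in which $D=\{x_1\cdots x_k=0\}$, for some $1\le k\le n$; then $k$ is the *codimension* of $p$ in $(X,D)$, and points of $X\setminus D$ have codimension $0$. The *strata* of $(X,D)$ are the connected components of the loci of points of fixed codimension; $\mathcal S(X,D)$ is the set of strata. The *real-oriented blow-up* $\alpha\colon\mathcal{B}l^{\mathbb R}(X,D)\to X$ is the space over $X$, unique up to unique homeomorphism over $X$, which in normal crossing charts is the obvious map $(\mathbb R_{\le0}\sqcup\mathbb R_{\ge0})^k\times\mathbb R^{n-k}\to\mathbb R^n$; it carries the local smooth structure for which $\alpha$ is an immersion. Let $D\subset D'$ be normal crossing divisors and $\mathcal S=\mathcal S(X,D')$. For $S\in\mathcal S$ and $p\in X$ let $$E(p,S)=\varprojlim_{U\ni p}\pi_0(U\cap S),\qquad Q(p)=\varprojlim_{U\ni p}\pi_0(U\setminus D)$$ ($U$ open) be the sets of ends of $S$ in $p$ and of orthants near $p$. Let $E(T,S)$ and $Q(T)$ be the sets of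 locally constant families of elements of $E(p,S)$, respectively $Q(p)$, $p\in T$; if the stratum $T$ is simply connected, evaluation at any $p\in T$ identifies them with $E(p,S)$ and $Q(p)$. The *orthant map* $\mu_{T,S}\colon E(T,S)\times Q(S)\to Q(T)$ is defined by the requirement that, for $p\in T$ and an open $U\ni p$, the component of $U\setminus D$ given by $\mu_{T,S}(e,q)$ at $p$ is the component given by $q$ at the points of the component of $U\cap S$ given by $e$ at $p$. The *endpoint modification* $\widehat S=\{(p,e): p\in X,\ e\in E(p,S)\}$ has the topology generated by the sets of all $(p,e)$ with $p\in U$ such that $e$ specifies a given component of $U\cap S$ ($U\subset X$ open); it contains $S$, and $\partial\widehat S$ is the part of $\widehat S$ over $X\setminus S$. **(1)** Suppose that all strata in $\mathcal S$ are simply connected. Then, as sets, $\partial\widehat S=\bigsqcup_{T\subset\overline S,\ T\ne S}T\times E(T,S)$ for every $S\in\mathcal S$, where $T$ runs through the strata. Let $G$ be the quotient space obtained from $$\widehat X=\bigsqcup_{S\in\mathcal S}\widehat S\times Q(S)$$ by gluing via the maps $$T\times E(T,S)\times Q(S)\to T\times Q(T)\subset\widehat T\times Q(T),\qquad (p,e,q)\mapsto(p,\mu_{T,S}(e,q)),\qquad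 T\neq S.$$ Then $G$, with its natural map to $X$, is the real-oriented blow-up of $X$ along $D$; it is Whitney-stratified by the sets $T\times\{q\}$ ($T\in\mathcal S$, $q\in Q(T)$). For any model $\alpha\colon\widetilde X\to X$ of this blow-up there is a unique homeomorphism $G\to\widetilde X$ over $X$. It maps the sets $T\times\{q\}$ to the connected components of $\alpha^{-1}(T)$, and it maps $(p,q)$ to the point of $\alpha^{-1}(p)$ which, for every open $U\ni p$, lies in the closure of the preimage of the component of $U\setminus D$ specified by $q$ at $p$. **(2)** Let $\pi\colon X\to(-1,1)$ be a smooth semi-stable degeneration: a proper smooth function, submersive over $(-1,1)\setminus\{0\}$, and of the form $x_1\cdots x_k$ ($1\le k\le n$) in a suitable smooth chart centred at each point of $X_0=\pi^{-1}(0)$. Put $D=X_0$, let $D'\supset X_0$ be a normal crossing divisor, and suppose that all strata in $\mathcal S=\mathcal S(X,D')$ contained in $X_0$ are simply connected. Let $Q^+(p)\subset Q(p)$ be the image of $\varprojlim_{U\ni p}\pi_0(U\cap\pi^{-1}((0,1)))$, and let $Q^+(S)\subset Q(S)$ be the set of families with values in $Q^+(p)$, $p\in S$. Let $\widetilde\pi\colon\widetilde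 X\to(-1,0]\sqcup[0,1)$ be the unique continuous lift of $\pi$ to the real-oriented blow-ups of $X$ along $X_0$ and of $(-1,1)$ along $0$, and let $\widetilde X_0^+=\widetilde\pi^{-1}(0^+)$ be the positive special fibre, where $0^+=0\in[0,1)$. Then $\mu_{T,S}(e,q)\in Q^+(T)$ for all $S,T\in\mathcal S$, $e\in E(T,S)$ and $q\in Q^+(S)$. The formula for $\partial\widehat S$ in (1) holds for all strata $S\subset X_0$. The space $G_0^+$ obtained from $$\widehat X_0^+=\bigsqcup_{S\in\mathcal S,\ S\subset X_0}\widehat S\times Q^+(S)$$ by gluing via the same maps restricted to positive orthants is Whitney-stratified by the sets $T\times\{q\}$ ($T\in\mathcal S$, $T\subset X_0$, $q\in Q^+(T)$). There is a unique homeomorphism $G_0^+\to\widetilde X_0^+$ over $X$; it maps the sets $T\times\{q\}$ to the connected components of $\alpha^{-1}(T)\cap\widetilde X_0^+$, and it maps $(p,q)$ to the point over $p$ in the orthant $q$, in the sense of (1). -/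

import Mathlib

open Set Filter Topology TopologicalSpace
open scoped Manifold ContDiff

namespace RealBlowUp

noncomputable section

/-! ## Normal crossing divisors, their strata, semi-stable degenerations -/

section NormalCrossing

variable {n : ℕ} {X : Type*} [TopologicalSpace X] [ChartedSpace (EuclideanSpace ℝ (Fin n)) X]

/-- `φ` is a normal crossing chart of type `(k, n)` for `D` at `p`: a smooth chart centred in `p`
identifying `D` with `{x₁ ⋯ x_k = 0}`. The value `k = 0` is allowed and means that `D` does not meet
the domain of the chart. -/
structure IsNCChart (D : Set X) (k : ℕ) (p : X)
    (φ : OpenPartialHomeomorph X (EuclideanSpace ℝ (Fin n))) : Prop where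
  smooth : φ ∈ IsManifold.maximalAtlas (𝓡 n) ∞ X
  mem_source : p ∈ φ.source
  centred : φ p = 0
  le : k ≤ n
  mem_iff : ∀ x ∈ φ.source, x ∈ D ↔ ∃ i : Fin n, i.val < k ∧ φ x i = 0

variable (n)

/-- `D` is a (closed) normal crossing divisor of the `n`-dimensional manifold `X`. -/
def IsNormalCrossingDivisor (D : Set X) : Prop :=
  IsClosed D ∧ ∀ p ∈ D, ∃ k : ℕ, 1 ≤ k ∧
    ∃ φ : OpenPartialHomeomorph X (EuclideanSpace ℝ (Fin n)), IsNCChart D k p φ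

/-- The locus of the points of codimension exactly `k` in `(X, D)`. -/
def codimLocus (D : Set X) (k : ℕ) : Set X :=
  {p | ∃ φ : OpenPartialHomeomorph X (EuclideanSpace ℝ (Fin n)), IsNCChart D k p φ}

/-- A stratum of `(X, D)` is a connected component of the locus of points of some codimension. -/
def IsStratum (D : Set X) (S : Set X) : Prop :=
  ∃ k : ℕ, ∃ p ∈ codimLocus n D k, S = connectedComponentIn (codimLocus n D k) p

/-- The stratification `𝒮(X, D)`, as the type of its strata. -/
def Stratum (D : Set X) : Type _ := {S : Set X // IsStratum n D S}

/-- The zero fibre of a function to the interval `(-1, 1)`. -/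
def zeroFibre (π : X → Ioo (-1 : ℝ) 1) : Set X := {x | (π x : ℝ) = 0}

/-- A smooth semi-stable degeneration `π : X → (-1, 1)`: a proper smooth function, submersive over
the complement of `0`, of the form `x₁ ⋯ x_k` in suitable charts centred at the points of the
fibre over `0`. -/
structure IsSemiStable (π : X → Ioo (-1 : ℝ) 1) : Prop where
  smooth : ContMDiff (𝓡 n) 𝓘(ℝ, ℝ) ∞ (fun x => (π x : ℝ))
  proper : IsProperMap π
  submersive : ∀ x, (π x : ℝ) ≠ 0 →
    Function.Surjective (mfderiv (𝓡 n) 𝓘(ℝ, ℝ) (fun x => (π x : ℝ)) x)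
  normalCrossing : ∀ p, (π p : ℝ) = 0 →
    ∃ k : ℕ, 1 ≤ k ∧ k ≤ n ∧ ∃ φ : OpenPartialHomeomorph X (EuclideanSpace ℝ (Fin n)),
      φ ∈ IsManifold.maximalAtlas (𝓡 n) ∞ X ∧ p ∈ φ.source ∧ φ p = 0 ∧
      ∀ x ∈ φ.source, (π x : ℝ) = ∏ i : Fin n with i.val < k, φ x i

end NormalCrossing

/-! ## Real-oriented blow-ups -/

/-- The disjoint union `ℝ_{≤ 0} ⊔ ℝ_{≥ 0}`. -/
abbrev SplitLine : Type := Iic (0 : ℝ) ⊕ Ici (0 : ℝ)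

/-- The obvious map `ℝ_{≤ 0} ⊔ ℝ_{≥ 0} → ℝ`. -/
def SplitLine.toReal : SplitLine → ℝ := Sum.elim Subtype.val Subtype.val

/-- The local model `(ℝ_{≤ 0} ⊔ ℝ_{≥ 0})^k × ℝ^{n-k}`. -/
abbrev LocalModel (n k : ℕ) : Type :=
  ({i : Fin n // i.val < k} → SplitLine) × ({i : Fin n // ¬ i.val < k} → ℝ)

/-- The blow-down map `(ℝ_{≤ 0} ⊔ ℝ_{≥ 0})^k × ℝ^{n-k} → ℝⁿ` of the local model. -/
def LocalModel.blowDown {n k : ℕ} (y : LocalModel n k) : EuclideanSpace ℝ (Fin n) :=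
  WithLp.toLp 2 fun i => if h : i.val < k then (y.1 ⟨i, h⟩).toReal else y.2 ⟨i, h⟩

/-- `α : Y → X` is the real-oriented blow-up of the `n`-manifold `X` along `D`: over a
neighbourhood of each point, in a normal crossing chart of type `(k, n)`, it is the map
`(ℝ_{≤ 0} ⊔ ℝ_{≥ 0})^k × ℝ^{n-k} → ℝⁿ`. This determines `(Y, α)` up to a unique homeomorphism
over `X`. -/
def IsRealOrientedBlowUp (n : ℕ) {X Y : Type*} [TopologicalSpace X] [TopologicalSpace Y]
    [ChartedSpace (EuclideanSpace ℝ (Fin n)) X] (D : Set X) (α : Y → X) : Prop :=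
  Continuous α ∧ ∀ p : X, ∃ (k : ℕ) (φ : OpenPartialHomeomorph X (EuclideanSpace ℝ (Fin n))),
    IsNCChart D k p φ ∧
    ∃ Ψ : {y : Y // α y ∈ φ.source} ≃ₜ {z : LocalModel n k // z.blowDown ∈ φ.target},
      ∀ y, (Ψ y).1.blowDown = φ (α y.1)

/-- The real-oriented blow-up `(-1, 0] ⊔ [0, 1)` of `(-1, 1)` along `{0}`. -/
abbrev SplitInterval : Type := Ioc (-1 : ℝ) 0 ⊕ Ico (0 : ℝ) 1

/-- The blow-down map `(-1, 0] ⊔ [0, 1) → ℝ`, with image `(-1, 1)`. -/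
def SplitInterval.toReal : SplitInterval → ℝ := Sum.elim Subtype.val Subtype.val

/-- The positive copy `0⁺` of zero in `(-1, 0] ⊔ [0, 1)`. -/
def SplitInterval.zeroPlus : SplitInterval := Sum.inr ⟨0, le_refl 0, zero_lt_one⟩

/-- `π'` is a continuous lift of `π : X → (-1, 1)` to the real-oriented blow-ups. -/
def IsLift {X Y : Type*} [TopologicalSpace Y] (π : X → Ioo (-1 : ℝ) 1) (α : Y → X)
    (π' : Y → SplitInterval) : Prop :=
  Continuous π' ∧ ∀ y, (π' y).toReal = π (α y)

/-! ## Ends, orthants, endpoint modifications -/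

section Ends

variable {X : Type*} [TopologicalSpace X]

/-- The inverse limit `lim π₀(U ∩ A)` over the open neighbourhoods `U` of `p`: a compatible choice
of a connected component of `U ∩ A` for every `U`.
For a stratum `A = S` these are the ends of `S` in `p`, and for `A = X ∖ D` the orthants near `p`. -/
@[ext]
structure EndsAt (A : Set X) (p : X) where
  comp : (U : Opens X) → p ∈ U → Set X
  isComp : ∀ (U : Opens X) (hU : p ∈ U), ∃ x ∈ (U : Set X) ∩ A, comp U hU = connectedComponentIn ((U : Set X) ∩ A) x
  mono : ∀ (U V : Opens X) (hU : p ∈ U) (hV : p ∈ V), U ≤ V → comp U hU ⊆ comp V hV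

namespace EndsAt

variable {A : Set X} {p : X}

theorem comp_subset (e : EndsAt A p) (U : Opens X) (hU : p ∈ U) :
    e.comp U hU ⊆ (U : Set X) ∩ A := by
  obtain ⟨x, _, h⟩ := e.isComp U hU
  rw [h]
  exact connectedComponentIn_subset _ _

theorem comp_nonempty (e : EndsAt A p) (U : Opens X) (hU : p ∈ U) : (e.comp U hU).Nonempty := by
  obtain ⟨x, hx, h⟩ := e.isComp U hU
  rw [h]
  exact ⟨x, mem_connectedComponentIn hx⟩

theorem comp_isPreconnected (e : EndsAt A p) (U : Opens X) (hU : p ∈ U) :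
    IsPreconnected (e.comp U hU) := by
  obtain ⟨x, _, h⟩ := e.isComp U hU
  rw [h]
  exact isPreconnected_connectedComponentIn

/-- The end of `A` in a point `p` of `A` itself, given by the components that contain `p`. -/
def self (hp : p ∈ A) : EndsAt A p where
  comp U _ := connectedComponentIn ((U : Set X) ∩ A) p
  isComp _ hU := ⟨p, ⟨hU, hp⟩, rfl⟩
  mono _ _ _ _ h := connectedComponentIn_mono p (inter_subset_inter_left A h)

end EndsAt

/-- Locally constant families of elements of `EndsAt A p`, where `p` runs through `T`. For a simply
connected stratum `T` this is the set of all `EndsAt A p`, `p ∈ T`, after their identification along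
paths in `T`. For `A = S` it is the set `E(T, S)` of ends of the stratum `S` in `T`. -/
structure FlatEnds (A T : Set X) where
  val : (p : T) → EndsAt A p.1
  locConst : ∀ (p : T) (U : Opens X) (hp : p.1 ∈ U), ∃ V : Opens X, p.1 ∈ V ∧
    ∀ (p' : T) (_ : p'.1 ∈ V) (h' : p'.1 ∈ U), (val p').comp U h' = (val p).comp U hp

/-- The orthant set `Q(S)` of `S` with respect to the divisor `D`. -/
abbrev OrthantSet (D S : Set X) : Type _ := FlatEnds Dᶜ S

instance (A T : Set X) : TopologicalSpace (FlatEnds A T) := ⊥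

instance (A T : Set X) : DiscreteTopology (FlatEnds A T) := ⟨rfl⟩

/-- A locally constant family of ends has the same component of `U ∩ A` at all points of a
connected subset of `U ∩ S`. -/
theorem FlatEnds.comp_eq {A S : Set X} (q : FlatEnds A S) (U : Opens X) {C : Set X}
    (hC : IsPreconnected C) (hCU : C ⊆ (U : Set X) ∩ S) {s s' : X} (hs : s ∈ C) (hs' : s' ∈ C) :
    (q.val ⟨s, (hCU hs).2⟩).comp U (hCU hs).1 = (q.val ⟨s', (hCU hs').2⟩).comp U (hCU hs').1 := by
  have : PreconnectedSpace C := Subtype.preconnectedSpace hC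
  let f : C → Set X := fun c => (q.val ⟨c.1, (hCU c.2).2⟩).comp U (hCU c.2).1
  have hf : IsLocallyConstant f := by
    rw [IsLocallyConstant.iff_exists_open]
    intro c
    obtain ⟨V, hV, h⟩ := q.locConst ⟨c.1, (hCU c.2).2⟩ U (hCU c.2).1
    exact ⟨Subtype.val ⁻¹' (V : Set X), V.isOpen.preimage continuous_subtype_val, hV,
      fun c' hc' => h ⟨c'.1, (hCU c'.2).2⟩ hc' (hCU c'.2).1⟩
  exact hf.apply_eq_of_isPreconnected isPreconnected_univ (mem_univ ⟨s, hs⟩) (mem_univ ⟨s', hs'⟩)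

/-- The orthant map at a point: if `e` is an end of `S` in `p` and `q` an orthant of `S`, then
`μ(e, q)` is the orthant near `p` whose component of `U ∖ D` is the one which `q` has at the points of
the face `e(U)` of `U ∩ S` (so `μ(·, q)` includes the orthants adjacent to that face into the
orthants near `p`). -/
def orthantMapAt {A S : Set X} {p : X} (e : EndsAt S p) (q : FlatEnds A S) : EndsAt A p where
  comp U hU := (q.val ⟨(e.comp_nonempty U hU).some,
    (e.comp_subset U hU (e.comp_nonempty U hU).some_mem).2⟩).comp U
      (e.comp_subset U hU (e.comp_nonempty U hU).some_mem).1
  isComp U hU := (q.val _).isComp U _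
  mono U V hU hV h := by
    have hs := (e.comp_nonempty U hU).some_mem
    have hV' := e.mono U V hU hV h hs
    have key := q.comp_eq V (e.comp_isPreconnected V hV) (e.comp_subset V hV) hV'
      (e.comp_nonempty V hV).some_mem
    rw [← key]
    exact (q.val _).mono U V _ _ h

theorem orthantMapAt_comp {A S : Set X} {p : X} (e : EndsAt S p) (q : FlatEnds A S)
    (U : Opens X) (hU : p ∈ U) {s : X} (hs : s ∈ e.comp U hU) :
    (orthantMapAt e q).comp U hU =
      (q.val ⟨s, (e.comp_subset U hU hs).2⟩).comp U (e.comp_subset U hU hs).1 :=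
  q.comp_eq U (e.comp_isPreconnected U hU) (e.comp_subset U hU)
    (e.comp_nonempty U hU).some_mem hs

/-- The orthant map `μ_{T,S} : E(T, S) × Q(S) → Q(T)` (here `A` is the complement of `D`). -/
def orthantMap {A S T : Set X} (e : FlatEnds S T) (q : FlatEnds A S) : FlatEnds A T where
  val p := orthantMapAt (e.val p) q
  locConst p U hp := by
    obtain ⟨V, hV, h⟩ := e.locConst p U hp
    refine ⟨V, hV, fun p' h1 h2 => ?_⟩
    obtain ⟨s, hs⟩ := (e.val p).comp_nonempty U hp
    rw [orthantMapAt_comp (e.val p) q U hp hs,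
      orthantMapAt_comp (e.val p') q U h2 (s := s) (by rw [h p' h1 h2]; exact hs)]

/-- The endpoint modification `Ŝ` of `S`: the fibre over `p` is the set of ends of `S` in `p`. -/
structure EndpointModification (S : Set X) where
  pt : X
  toEnd : EndsAt S pt

/-- The topology of `Ŝ`: a neighbourhood of `(p, e)` is given by an open `U ∋ p` and consists of all
`(p', e')` with `p' ∈ U` such that `e'` specifies the same component of `U ∩ S` as `e`. -/
instance (S : Set X) : TopologicalSpace (EndpointModification S) :=
  generateFrom {N | ∃ (U : Opens X) (C : Set X),
    N = {x : EndpointModification S | ∃ h : x.pt ∈ U, x.toEnd.comp U h = C}}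

/-- The orthants near `p`, with respect to `D = π⁻¹(0)`, that lie in the image of the canonical map
from `lim π₀(U ∩ π⁻¹((0, 1)))`. -/
def IsPositiveAt (π : X → Ioo (-1 : ℝ) 1) {p : X} (q : EndsAt (zeroFibre π)ᶜ p) : Prop :=
  ∃ r : EndsAt {x | 0 < (π x : ℝ)} p, ∀ (U : Opens X) (hU : p ∈ U), r.comp U hU ⊆ q.comp U hU

/-- The set `Q⁺(S) ⊆ Q(S)` of positive orthants. -/
def PositiveOrthants (π : X → Ioo (-1 : ℝ) 1) (S : Set X) : Set (OrthantSet (zeroFibre π) S) :=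
  {q | ∀ p : S, IsPositiveAt π (q.val p)}

end Ends

/-! ## The gluing -/

section Gluing

variable {n : ℕ} {X : Type*} [TopologicalSpace X] [ChartedSpace (EuclideanSpace ℝ (Fin n)) X]
  {D D' : Set X}

variable (n) in
/-- The map `⊔_{T ≠ S} T × E(T, S) → Ŝ`, `(p, e) ↦ e` regarded as an end in `p`, for strata of
`(X, D')`. (There are no ends of `S` in `T` unless `T` lies in the closure of `S`.) -/
def boundaryMap (S : Stratum n D')
    (x : Σ T : {T : Stratum n D' // T ≠ S}, T.1.1 × FlatEnds S.1 T.1.1) :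
    EndpointModification S.1 := ⟨x.2.1.1, x.2.2.val x.2.1⟩

/-- The disjoint union `⊔_S Ŝ × Q'(S)` over the strata `S` of `(X, D')`, where `Q'(S) ⊆ Q(S)` is a
prescribed set of orthants with respect to `D`. -/
abbrev PreGluing (Q' : (S : Stratum n D') → Set (OrthantSet D S.1)) : Type _ :=
  Σ S : Stratum n D', EndpointModification S.1 × Q' S

/-- The gluing maps `(p, e, q) ↦ (p, μ_{T,S}(e, q))` from the part `T × E(T, S) × Q'(S)` of
`∂Ŝ × Q'(S)` to `T × Q'(T) ⊆ T̂ × Q'(T)`, for all `T ≠ S`. -/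
inductive GlueRel (Q' : (S : Stratum n D') → Set (OrthantSet D S.1)) :
    PreGluing Q' → PreGluing Q' → Prop
  | glue (S T : Stratum n D') (hTS : T ≠ S) (p : T.1) (e : FlatEnds S.1 T.1) (q : Q' S) (q' : Q' T)
      (h : q'.1 = orthantMap e q.1) :
      GlueRel Q' ⟨S, ⟨p.1, e.val p⟩, q⟩ ⟨T, ⟨p.1, EndsAt.self p.2⟩, q'⟩

/-- The space obtained from `⊔_S Ŝ × Q'(S)` by gluing via the orthant maps, with the quotient
topology. -/
abbrev Gluing (Q' : (S : Stratum n D') → Set (OrthantSet D S.1)) : Type _ := Quot (GlueRel Q')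

/-- The map from the glued space to `X` induced by the maps `Ŝ → X`. -/
def Gluing.toBase {Q' : (S : Stratum n D') → Set (OrthantSet D S.1)} : Gluing Q' → X :=
  Quot.lift (fun x => x.2.1.pt) (by rintro _ _ ⟨⟩; rfl)

/-- The point `(p, q)` of `T × Q'(T)`, in the glued space. -/
def Gluing.point (Q' : (S : Stratum n D') → Set (OrthantSet D S.1)) (T : Stratum n D') (p : T.1)
    (q : Q' T) : Gluing Q' :=
  Quot.mk _ ⟨T, ⟨p.1, EndsAt.self p.2⟩, q⟩

/-- The stratum `T × {q}` of the glued space. -/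
def Gluing.piece (Q' : (S : Stratum n D') → Set (OrthantSet D S.1))
    (i : Σ T : Stratum n D', Q' T) : Set (Gluing Q') :=
  range fun p : i.1.1 => Gluing.point Q' i.1 p i.2

/-- All orthants: the choice `Q'(S) = Q(S)`. -/
def allSheets (n : ℕ) [ChartedSpace (EuclideanSpace ℝ (Fin n)) X] (D D' : Set X)
    (S : Stratum n D') : Set (OrthantSet D S.1) := univ

/-- The choice `Q'(S) = Q⁺(S)` for `S ⊆ X₀` and `Q'(S) = ∅` otherwise, so that the disjoint union
runs over the strata in `X₀ = π⁻¹(0)`. -/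
def positiveSheets (n : ℕ) [ChartedSpace (EuclideanSpace ℝ (Fin n)) X] (π : X → Ioo (-1 : ℝ) 1)
    (D' : Set X) (S : Stratum n D') : Set (OrthantSet (zeroFibre π) S.1) :=
  {q | S.1 ⊆ zeroFibre π ∧ q ∈ PositiveOrthants π S.1}

end Gluing

/-! ## Whitney stratifications -/

section Whitney

variable {n : ℕ}

/-- `Z` is an embedded smooth submanifold of `ℝⁿ` (not necessarily closed). -/
def IsSmoothSubmanifold (Z : Set (EuclideanSpace ℝ (Fin n))) : Prop :=
  ∀ z ∈ Z, ∃ ψ : OpenPartialHomeomorph (EuclideanSpace ℝ (Fin n)) (EuclideanSpace ℝ (Fin n)),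
    z ∈ ψ.source ∧ ContDiffOn ℝ ∞ ψ ψ.source ∧ ContDiffOn ℝ ∞ ψ.symm ψ.target ∧
    ∃ L : Submodule ℝ (EuclideanSpace ℝ (Fin n)), ∀ x ∈ ψ.source, x ∈ Z ↔ ψ x ∈ L

/-- Convergence of linear subspaces of `ℝⁿ` in the Grassmannian, that is, of the orthogonal
projections onto them. -/
def SubspaceTendsto (L : ℕ → Submodule ℝ (EuclideanSpace ℝ (Fin n)))
    (M : Submodule ℝ (EuclideanSpace ℝ (Fin n))) : Prop :=
  Tendsto (fun m => (L m).starProjection) atTop (𝓝 M.starProjection)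

/-- Whitney's condition (b) for the pair of submanifolds `(Z, Z')` of `ℝⁿ`: if `xₘ ∈ Z` and
`x'ₘ ∈ Z'` converge to `z ∈ Z`, the secant lines through `xₘ` and `x'ₘ` converge to `ℓ` and the
tangent spaces of `Z'` in `x'ₘ` converge to `τ`, then `ℓ ⊆ τ`. -/
def WhitneyCondition (Z Z' : Set (EuclideanSpace ℝ (Fin n))) : Prop :=
  ∀ z ∈ Z, ∀ (x x' : ℕ → EuclideanSpace ℝ (Fin n))
    (l τ : Submodule ℝ (EuclideanSpace ℝ (Fin n))),
    (∀ m, x m ∈ Z) → (∀ m, x' m ∈ Z') → (∀ m, x m ≠ x' m) →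
    Tendsto x atTop (𝓝 z) → Tendsto x' atTop (𝓝 z) →
    SubspaceTendsto (fun m => Submodule.span ℝ {x' m - x m}) l →
    SubspaceTendsto (fun m => Submodule.span ℝ (tangentConeAt ℝ Z' (x' m))) τ →
    l ≤ τ

/-- The family `P` is a Whitney stratification of `Y`, for the local smooth structure that the map
`f` induces on `Y`: locally on `Y`, the map `f` is an embedding onto a closed subset of a chart domain
of the manifold `X`, and in the chart the pieces are smooth submanifolds satisfying Whitney's
condition (b). Moreover the pieces are disjoint, connected, locally closed, and locally finite, and
satisfy the frontier condition. -/
structure IsWhitneyStratified {X Y ι : Type*} [TopologicalSpace X] [TopologicalSpace Y]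
    [ChartedSpace (EuclideanSpace ℝ (Fin n)) X] (f : Y → X) (P : ι → Set Y) : Prop where
  t2 : T2Space Y
  cover : ⋃ i, P i = univ
  disjoint : Pairwise fun i j => Disjoint (P i) (P j)
  connected : ∀ i, IsConnected (P i)
  locallyClosed : ∀ i, IsLocallyClosed (P i)
  locallyFinite : LocallyFinite P
  frontier : ∀ i j, (P i ∩ closure (P j)).Nonempty → P i ⊆ closure (P j)
  localForm : ∀ y : Y, ∃ W : Set Y, IsOpen W ∧ y ∈ W ∧
    ∃ φ ∈ IsManifold.maximalAtlas (𝓡 n) ∞ X, MapsTo f W φ.source ∧ IsEmbedding (W.domRestrict f) ∧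
      closure ((fun w => φ (f w)) '' W) ∩ φ.target ⊆ (fun w => φ (f w)) '' W ∧
      (∀ i, IsSmoothSubmanifold ((fun w => φ (f w)) '' (W ∩ P i))) ∧
      ∀ i j, i ≠ j → WhitneyCondition ((fun w => φ (f w)) '' (W ∩ P i))
        ((fun w => φ (f w)) '' (W ∩ P j))

end Whitney

/-! ## Identifications with the glued space -/

/-- A homeomorphism `Φ` from the glued space to a space `Y` over the blow-up `α : B → X` (via
`j : Y → B`, for instance the inclusion of a subspace) is an isomorphism of stratified spaces: it is compatible
with the maps to `X`; it maps `(p, q)`, `p ∈ T`, `q ∈ Q'(T)`, to the point over `p` which lies in the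
orthant `q`; and it maps the strata `T × {q}` to connected components of the preimage of `T`. -/
structure IsStratifiedIso {n : ℕ} {X B Y : Type*} [TopologicalSpace X] [TopologicalSpace B]
    [TopologicalSpace Y] [ChartedSpace (EuclideanSpace ℝ (Fin n)) X] {D D' : Set X}
    (Q' : (S : Stratum n D') → Set (OrthantSet D S.1)) (α : B → X) (j : Y → B)
    (Φ : Gluing Q' ≃ₜ Y) : Prop where
  base : ∀ g, α (j (Φ g)) = g.toBase
  orthant : ∀ (T : Stratum n D') (p : T.1) (q : Q' T) (U : Opens X) (hU : p.1 ∈ U),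
    j (Φ (Gluing.point Q' T p q)) ∈ closure (α ⁻¹' (q.1.val p).comp U hU)
  strata : ∀ i, ∀ y ∈ Φ '' Gluing.piece Q' i,
    connectedComponentIn ((fun y => α (j y)) ⁻¹' i.1.1) y = Φ '' Gluing.piece Q' i

end

end RealBlowUp

open RealBlowUp

namespace RealBlowUp
noncomputable section

/-! ## Topology of ends -/

section EndsTopology

variable {X : Type*} [TopologicalSpace X] {A : Set X} {p p' : X}

/-! The endpoint modification of the complement `Dᶜ` is itself the real-oriented blow-up: a point
over `p` is an orthant near `p`, and in a normal crossing chart these are the closed orthants of the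
local model. All other spaces are compared with this one.

In a chart with image a cube, `Dᶜ` and all strata are unions of cells, a cell being given by the
signs of some coordinates. Cells are convex, and none of the cells that make up such a set is a face
of another, so they are its connected components in the chart. Hence an end is already determined by
one component in the chart (`IsTame.end_ext`), and the topology of an endpoint modification is
locally that of the base times a discrete set (`EndpointModification.nhds_eq_of_isTame`). For this,
`D` and `D'` need a common chart (`exists_common_chart`), which rests on `exists_coord_eq_zero_iff`.
The codimension is well defined because a point with `k` vanishing coordinates has `2 ^ k` orthants.

Along a stratum `T` the ends, or orthants, form a covering space. If `T` is simply connected, each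
of them extends to a unique locally constant family on `T` (`FlatEnds.exists_val_eq`,
`FlatEnds.eq_of_val_eq`). This gives the formula for the boundary, and it shows that each point of
the glued space has a normal form `(p, q)` with `p ∈ T`.

The maps `(p, e, q) ↦ (p, μ(e, q))` are compatible with the gluing and induce `Gluing.toEndpoint`.
By the normal form it is injective. It is closed because the map before gluing is proper: only
finitely many cells occur in a chart. So it is a closed embedding, onto everything if all orthants
are used, and onto the positive points over the zero fibre if only positive orthants are used. The
Whitney conditions hold since in a chart the pieces are unions of cells.

Uniqueness of the homeomorphisms is a density argument. The blow-up is injective over the dense set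
`Dᶜ`; on the positive special fibre, `Dᶜ` is replaced by the points that are the only positive point
in their fibre (`IsSemiStable.mem_closure_unique`). -/

theorem connectedComponentIn_eq_of_mem_of_mem {F : Set X} {x y z : X}
    (hx : z ∈ connectedComponentIn F x) (hy : z ∈ connectedComponentIn F y) :
    connectedComponentIn F x = connectedComponentIn F y :=
  (connectedComponentIn_eq hx).trans (connectedComponentIn_eq hy).symm

namespace EndsAt

theorem comp_eq_connectedComponentIn (e : EndsAt A p) {U : Opens X} {hU : p ∈ U} {x : X}
    (hx : x ∈ e.comp U hU) : e.comp U hU = connectedComponentIn ((U : Set X) ∩ A) x := by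
  obtain ⟨y, _, h⟩ := e.isComp U hU
  rw [h] at hx ⊢
  exact connectedComponentIn_eq hx

theorem subset_comp (e : EndsAt A p) {U : Opens X} {hU : p ∈ U} {K : Set X}
    (hK : IsPreconnected K) (hKU : K ⊆ (U : Set X) ∩ A) (hne : (K ∩ e.comp U hU).Nonempty) :
    K ⊆ e.comp U hU := by
  obtain ⟨x, hx, hx'⟩ := hne
  rw [e.comp_eq_connectedComponentIn hx']
  exact hK.subset_connectedComponentIn hx hKU

theorem comp_eq_of_inter_nonempty (e : EndsAt A p) (e' : EndsAt A p') {U : Opens X} {hU : p ∈ U}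
    {hU' : p' ∈ U} (hne : (e.comp U hU ∩ e'.comp U hU').Nonempty) :
    e.comp U hU = e'.comp U hU' := by
  obtain ⟨x, hx, hx'⟩ := hne
  rw [e.comp_eq_connectedComponentIn hx, e'.comp_eq_connectedComponentIn hx']

theorem mem_closure_comp (e : EndsAt A p) (C : Opens X) (hp : p ∈ C) :
    p ∈ closure (e.comp C hp) := by
  rw [mem_closure_iff]
  intro U hU hpU
  obtain ⟨x, hx⟩ := e.comp_nonempty (⟨U, hU⟩ ⊓ C) ⟨hpU, hp⟩
  exact ⟨x, (e.comp_subset _ _ hx).1.1, e.mono _ _ _ hp inf_le_right hx⟩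

theorem mem_closure (e : EndsAt A p) : p ∈ closure A :=
  closure_mono (fun _ hx => (e.comp_subset ⊤ trivial hx).2) (e.mem_closure_comp ⊤ trivial)

end EndsAt

/-- An open set `C` is tame for `A` if each component of `C ∩ A` is locally connected at all points
of its closure in `C`. -/
structure IsTame (A : Set X) (C : Opens X) : Prop where
  locConn : ∀ x ∈ (C : Set X) ∩ A, ∀ p ∈ C, p ∈ closure (connectedComponentIn ((C : Set X) ∩ A) x) →
    ∀ U : Opens X, p ∈ U → ∃ V : Opens X, p ∈ V ∧ V ≤ U ∧ V ≤ C ∧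
      IsPreconnected ((V : Set X) ∩ connectedComponentIn ((C : Set X) ∩ A) x)

namespace IsTame

variable {C : Opens X}

/-- If `K` is the component in `C`, tameness provides `V` with `V ∩ K` connected. Each end near `p`
that specifies `K` has points in `V ∩ K`, so its component of `U ∩ A` is the one containing `V ∩ K`.
The uniformity in `p'` is what describes the topology of the endpoint modification. -/
theorem exists_comp_eq (hC : IsTame A C) (e : EndsAt A p) (hp : p ∈ C) (U : Opens X)
    (hU : p ∈ U) : ∃ V : Opens X, p ∈ V ∧ V ≤ U ∧ V ≤ C ∧
      ∀ (p' : X) (_ : p' ∈ V) (hU' : p' ∈ U) (hC' : p' ∈ C) (e' : EndsAt A p'),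
        e'.comp C hC' = e.comp C hp → e'.comp U hU' = e.comp U hU := by
  obtain ⟨x, hx, hN⟩ := e.isComp C hp
  obtain ⟨V, hpV, hVU, hVC, hV⟩ := hC.locConn x hx p hp (hN ▸ e.mem_closure_comp C hp) U hU
  rw [← hN] at hV
  have hKU : (V : Set X) ∩ e.comp C hp ⊆ (U : Set X) ∩ A :=
    fun y hy => ⟨hVU hy.1, (e.comp_subset C hp hy.2).2⟩
  have key : ∀ (p' : X) (_ : p' ∈ V) (hU' : p' ∈ U) (hC' : p' ∈ C) (e' : EndsAt A p'),
      e'.comp C hC' = e.comp C hp → (V : Set X) ∩ e.comp C hp ⊆ e'.comp U hU' := by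
    intro p' hpV' hU' hC' e' he
    obtain ⟨y, hy⟩ := e'.comp_nonempty V hpV'
    exact e'.subset_comp hV hKU ⟨y, ⟨(e'.comp_subset V hpV' hy).1,
      he ▸ e'.mono V C hpV' hC' hVC hy⟩, e'.mono V U hpV' hU' hVU hy⟩
  refine ⟨V, hpV, hVU, hVC, fun p' hpV' hU' hC' e' he => ?_⟩
  obtain ⟨y, hy⟩ := e.comp_nonempty V hpV
  have hy' : y ∈ (V : Set X) ∩ e.comp C hp :=
    ⟨(e.comp_subset V hpV hy).1, e.mono V C hpV hp hVC hy⟩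
  exact e'.comp_eq_of_inter_nonempty e ⟨y, key p' hpV' hU' hC' e' he hy', key p hpV hU hp e rfl hy'⟩

theorem end_ext (hC : IsTame A C) (hp : p ∈ C) {e e' : EndsAt A p}
    (h : e.comp C hp = e'.comp C hp) : e = e' := by
  ext U hU x
  obtain ⟨V, hpV, -, -, hV⟩ := hC.exists_comp_eq e' hp U hU
  rw [hV p hpV hU hp e h]

/-- The connected traces `V ∩ N`, for small `V`, single out one component of `U ∩ A` for each `U`.
The choices are compatible because any two traces meet, as `p` is adherent to `N`. -/
theorem exists_end (hC : IsTame A C) (hp : p ∈ C) {x : X} (hx : x ∈ (C : Set X) ∩ A)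
    (hpx : p ∈ closure (connectedComponentIn ((C : Set X) ∩ A) x)) :
    ∃ e : EndsAt A p, e.comp C hp = connectedComponentIn ((C : Set X) ∩ A) x := by
  set N := connectedComponentIn ((C : Set X) ∩ A) x with hN
  have hNA : N ⊆ (C : Set X) ∩ A := connectedComponentIn_subset _ _
  choose V hpV hVU hVC hV using hC.locConn x hx p hp hpx
  have hne : ∀ W : Opens X, p ∈ W → ((W : Set X) ∩ N).Nonempty :=
    fun W hW => mem_closure_iff.1 hpx W W.isOpen hW
  have hKU : ∀ (U : Opens X) (hU : p ∈ U), (V U hU : Set X) ∩ N ⊆ (U : Set X) ∩ A :=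
    fun U hU y hy => ⟨hVU U hU hy.1, (hNA hy.2).2⟩
  have hsub : ∀ (U : Opens X) (hU : p ∈ U), (V U hU : Set X) ∩ N ⊆
      connectedComponentIn ((U : Set X) ∩ A) (hne _ (hpV U hU)).some := fun U hU =>
    (hV U hU).subset_connectedComponentIn (hne _ (hpV U hU)).some_mem (hKU U hU)
  have hmono : ∀ (U W : Opens X) (hU : p ∈ U) (hW : p ∈ W), U ≤ W →
      connectedComponentIn ((U : Set X) ∩ A) (hne _ (hpV U hU)).some ⊆
      connectedComponentIn ((W : Set X) ∩ A) (hne _ (hpV W hW)).some := by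
    intro U W hU hW h
    obtain ⟨y, hy, hyN⟩ := hne (V U hU ⊓ V W hW) (And.intro (hpV U hU) (hpV W hW))
    rw [connectedComponentIn_eq (hsub U hU ⟨hy.1, hyN⟩), connectedComponentIn_eq
      (hsub W hW ⟨hy.2, hyN⟩)]
    exact connectedComponentIn_mono y (inter_subset_inter_left A h)
  refine ⟨⟨fun U hU => connectedComponentIn ((U : Set X) ∩ A) (hne _ (hpV U hU)).some,
    fun U hU => ⟨_, hKU U hU (hne _ (hpV U hU)).some_mem, rfl⟩, hmono⟩, ?_⟩
  exact (connectedComponentIn_eq (hne (V C hp) (hpV C hp)).some_mem.2).symm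

/-- A connected set stays connected when an adherent point is added. So the component specified by
`e` already contains `p ∈ A`. -/
theorem eq_self (hC : IsTame A C) (hpC : p ∈ C) (hpA : p ∈ A) (e : EndsAt A p) :
    e = EndsAt.self hpA := by
  refine hC.end_ext hpC ?_
  have hpe : p ∈ e.comp C hpC := by
    obtain ⟨x, hx, h⟩ := e.isComp C hpC
    have hcl := e.mem_closure_comp C hpC
    rw [h] at hcl ⊢
    have hpre : IsPreconnected (insert p (connectedComponentIn ((C : Set X) ∩ A) x)) :=
      isPreconnected_connectedComponentIn.subset_closure (subset_insert _ _)
        (insert_subset hcl subset_closure)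
    exact hpre.subset_connectedComponentIn (mem_insert_of_mem _ (mem_connectedComponentIn hx))
      (insert_subset (show p ∈ (C : Set X) ∩ A from ⟨hpC, hpA⟩) (connectedComponentIn_subset _ _)) (mem_insert _ _)
  exact e.comp_eq_connectedComponentIn hpe

end IsTame

namespace EndpointModification

/-- The basic open sets of the endpoint modification: the ends specifying the component `K` of
`U ∩ A`. -/
def sheet (A : Set X) (U : Opens X) (K : Set X) : Set (EndpointModification A) :=
  {x | ∃ h : x.pt ∈ U, x.toEnd.comp U h = K}

theorem isOpen_sheet (U : Opens X) (K : Set X) : IsOpen (sheet A U K) :=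
  isOpen_generateFrom_of_mem ⟨U, K, rfl⟩

theorem mem_sheet_self (x : EndpointModification A) {U : Opens X} (hU : x.pt ∈ U) :
    x ∈ sheet A U (x.toEnd.comp U hU) := ⟨hU, rfl⟩

theorem sheet_inf_subset (x : EndpointModification A) {U V : Opens X} (hU : x.pt ∈ U)
    (hV : x.pt ∈ V) (hVU : V ≤ U) :
    sheet A V (x.toEnd.comp V hV) ⊆ sheet A U (x.toEnd.comp U hU) := by
  rintro y ⟨hy, hyK⟩
  refine ⟨hVU hy, ?_⟩
  obtain ⟨z, hz⟩ := x.toEnd.comp_nonempty V hV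
  exact y.toEnd.comp_eq_of_inter_nonempty x.toEnd
    ⟨z, y.toEnd.mono V U hy _ hVU (hyK ▸ hz), x.toEnd.mono V U hV _ hVU hz⟩

theorem hasBasis_nhds (x : EndpointModification A) :
    (𝓝 x).HasBasis (fun U : Opens X => x.pt ∈ U) (fun U => {y | ∃ hx : x.pt ∈ U,
      y ∈ sheet A U (x.toEnd.comp U hx)}) := by
  have key : ∀ O : Set (EndpointModification A), IsOpen O → x ∈ O → ∃ U : Opens X,
      ∃ hU : x.pt ∈ U, sheet A U (x.toEnd.comp U hU) ⊆ O := by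
    intro O hO
    induction hO with
    | basic s hs =>
      obtain ⟨U, K, rfl⟩ := hs
      rintro ⟨hU, hK⟩
      exact ⟨U, hU, hK ▸ Subset.rfl⟩
    | univ => exact fun _ => ⟨⊤, trivial, subset_univ _⟩
    | inter s t _ _ hs ht =>
      rintro ⟨hxs, hxt⟩
      obtain ⟨U, hU, hUs⟩ := hs hxs
      obtain ⟨V, hV, hVt⟩ := ht hxt
      exact ⟨U ⊓ V, ⟨hU, hV⟩, subset_inter ((sheet_inf_subset x hU (V := U ⊓ V) ⟨hU, hV⟩ inf_le_left).trans hUs)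
        ((sheet_inf_subset x hV (V := U ⊓ V) ⟨hU, hV⟩ inf_le_right).trans hVt)⟩
    | sUnion S _ ih =>
      rintro ⟨s, hs, hxs⟩
      obtain ⟨U, hU, hUs⟩ := ih s hs hxs
      exact ⟨U, hU, hUs.trans (subset_sUnion_of_mem hs)⟩
  refine ⟨fun t => ⟨fun ht => ?_, ?_⟩⟩
  · obtain ⟨O, hOt, hO, hxO⟩ := mem_nhds_iff.1 ht
    obtain ⟨U, hU, hUO⟩ := key O hO hxO
    exact ⟨U, hU, fun y ⟨_, hy⟩ => hOt (hUO hy)⟩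
  · rintro ⟨U, hU, hUt⟩
    exact mem_of_superset ((isOpen_sheet U _).mem_nhds (mem_sheet_self x hU))
      fun y hy => hUt ⟨hU, hy⟩

theorem continuous_pt : Continuous (pt : EndpointModification A → X) := by
  refine continuous_def.2 fun s hs => ?_
  refine isOpen_iff_mem_nhds.2 fun x hx => (hasBasis_nhds x).mem_iff.2 ⟨⟨s, hs⟩, hx, ?_⟩
  rintro y ⟨_, hy, _⟩
  exact hy

instance [T2Space X] : T2Space (EndpointModification A) := by
  refine ⟨fun x y hxy => ?_⟩
  by_cases h : x.pt = y.pt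
  · obtain ⟨p, e⟩ := x
    obtain ⟨p', e'⟩ := y
    obtain rfl : p = p' := h
    have : ∃ (U : Opens X) (hU : p ∈ U), e.comp U hU ≠ e'.comp U hU := by
      by_contra! hall
      exact hxy (congrArg _ (EndsAt.ext (funext fun U => funext fun hU => hall U hU)))
    obtain ⟨U, hU, hne⟩ := this
    refine ⟨_, _, isOpen_sheet U (e.comp U hU), isOpen_sheet U (e'.comp U hU), ⟨hU, rfl⟩,
      ⟨hU, rfl⟩, disjoint_left.2 ?_⟩
    rintro z ⟨_, hz⟩ ⟨_, hz'⟩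
    exact hne (hz.symm.trans hz')
  · exact separated_by_continuous continuous_pt h

/-- Over a tame set, closeness in the endpoint modification means closeness in the base together
with equality of the components in `C`; components in smaller open sets then agree by
`IsTame.exists_comp_eq`. -/
theorem nhds_eq_of_isTame {C : Opens X} (hC : IsTame A C) (x : EndpointModification A)
    (hx : x.pt ∈ C) : 𝓝 x = comap pt (𝓝 x.pt) ⊓ 𝓟 (sheet A C (x.toEnd.comp C hx)) := by
  refine le_antisymm (le_inf continuous_pt.continuousAt.le_comap
    (le_principal_iff.2 ((isOpen_sheet C _).mem_nhds (mem_sheet_self x hx)))) fun t ht => ?_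
  obtain ⟨U, hU, hUt⟩ := (hasBasis_nhds x).mem_iff.1 ht
  obtain ⟨V, hpV, hVU, hVC, hV⟩ := hC.exists_comp_eq x.toEnd hx U hU
  refine mem_inf_of_inter (preimage_mem_comap (V.isOpen.mem_nhds hpV))
    (mem_principal_self _) ?_
  rintro y ⟨hyV, hyC, hyK⟩
  exact hUt ⟨hU, hVU hyV, hV y.pt hyV _ hyC y.toEnd hyK⟩

/-- The map of endpoint modifications induced by an orthant. -/
def push {S : Set X} (q : FlatEnds A S) (x : EndpointModification S) : EndpointModification A :=
  ⟨x.pt, orthantMapAt x.toEnd q⟩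

theorem continuous_push {S : Set X} (q : FlatEnds A S) : Continuous (push q) := by
  refine continuous_iff_continuousAt.2 fun x => ?_
  refine (hasBasis_nhds _).tendsto_right_iff.2 fun U (hU : x.pt ∈ U) => ?_
  filter_upwards [(isOpen_sheet U _).mem_nhds (mem_sheet_self x hU)]
  rintro y ⟨hy, hyK⟩
  refine ⟨hU, hy, ?_⟩
  obtain ⟨s, hs⟩ := x.toEnd.comp_nonempty U hU
  exact (orthantMapAt_comp y.toEnd q U hy (s := s) (hyK ▸ hs)).trans
    (orthantMapAt_comp x.toEnd q U hU hs).symm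

/-- Together with `comp_eq_of_mem_closure` this characterises an end by the closures in which its
point lies. The characterisation is topological over the base, so it carries over to any model of
the blow-up. -/
theorem mem_closure_preimage_comp (x : EndpointModification A) (U : Opens X) (hU : x.pt ∈ U) :
    x ∈ closure (pt ⁻¹' (x.toEnd.comp U hU)) := by
  refine (mem_closure_iff_nhds_basis (hasBasis_nhds x)).2 fun V (hV : x.pt ∈ V) => ?_
  obtain ⟨z, hz⟩ := x.toEnd.comp_nonempty (U ⊓ V) ⟨hU, hV⟩
  have hzV := x.toEnd.mono _ V _ hV inf_le_right hz
  have hzA := (x.toEnd.comp_subset _ _ hz).2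
  exact ⟨⟨z, EndsAt.self hzA⟩, x.toEnd.mono _ U _ hU inf_le_left hz, hV,
    (x.toEnd.comp_subset _ _ hzV).1, (x.toEnd.comp_eq_connectedComponentIn hzV).symm⟩

theorem comp_eq_of_mem_closure (hA : ∀ p, ∃ C : Opens X, p ∈ C ∧ IsTame A C)
    (x : EndpointModification A) {U : Opens X} (hU : x.pt ∈ U) {a : X}
    (hx : x ∈ closure (pt ⁻¹' (connectedComponentIn ((U : Set X) ∩ A) a))) :
    x.toEnd.comp U hU = connectedComponentIn ((U : Set X) ∩ A) a := by
  obtain ⟨y, ⟨hyU, hyK⟩, hya⟩ := mem_closure_iff.1 hx _ (isOpen_sheet U _) (mem_sheet_self x hU)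
  obtain ⟨C, hyC, hC⟩ := hA y.pt
  have hyA := connectedComponentIn_subset _ _ hya
  rw [← hyK, connectedComponentIn_eq hya, hC.eq_self hyC hyA.2 y.toEnd]
  rfl

theorem dense_preimage_pt : Dense (pt ⁻¹' A : Set (EndpointModification A)) := fun x =>
  closure_mono (preimage_mono fun _ hz => (x.toEnd.comp_subset ⊤ trivial hz).2)
    (x.mem_closure_preimage_comp ⊤ trivial)

theorem ext_of_pt_mem (hA : ∀ p, ∃ C : Opens X, p ∈ C ∧ IsTame A C)
    {x y : EndpointModification A} (h : x.pt = y.pt) (hx : x.pt ∈ A) : x = y := by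
  obtain ⟨p, e⟩ := x
  obtain ⟨p', e'⟩ := y
  obtain rfl : p = p' := h
  obtain ⟨C, hpC, hC⟩ := hA p
  rw [hC.eq_self hpC hx e, hC.eq_self hpC hx e']

end EndpointModification
end EndsTopology
-- Locally constant families of ends and covering spaces
section FlatFamilies

variable {X : Type*} [TopologicalSpace X] {A T : Set X}

namespace FlatEnds

theorem ext_val {q q' : FlatEnds A T} (h : ∀ p, q.val p = q'.val p) : q = q' := by
  obtain ⟨f, hf⟩ := q
  obtain ⟨g, hg⟩ := q'
  obtain rfl : f = g := funext h
  rfl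

/-- Coincidence is an open and closed condition: near `p` both families have constant components in
a tame set, and these components determine the ends. -/
theorem eq_of_val_eq (hT : IsPreconnected T) (hA : ∀ p ∈ T, ∃ C : Opens X, p ∈ C ∧ IsTame A C)
    {q q' : FlatEnds A T} {p₀ : T} (h : q.val p₀ = q'.val p₀) : q = q' := by
  have : PreconnectedSpace T := Subtype.preconnectedSpace hT
  have hloc : IsLocallyConstant fun p : T => q.val p = q'.val p := by
    rw [IsLocallyConstant.iff_exists_open]
    intro p
    obtain ⟨C, hpC, hC⟩ := hA p.1 p.2
    obtain ⟨V, hV, hqV⟩ := q.locConst p C hpC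
    obtain ⟨V', hV', hqV'⟩ := q'.locConst p C hpC
    refine ⟨Subtype.val ⁻¹' ((V ⊓ V' ⊓ C : Opens X) : Set X),
      (V ⊓ V' ⊓ C).isOpen.preimage continuous_subtype_val, ⟨⟨hV, hV'⟩, hpC⟩, ?_⟩
    rintro p' ⟨⟨h1, h2⟩, h3⟩
    refine propext ⟨fun h' => hC.end_ext hpC ?_, fun h' => hC.end_ext h3 ?_⟩
    · rw [← hqV p' h1 h3, ← hqV' p' h2 h3, h']
    · rw [hqV p' h1 h3, hqV' p' h2 h3, h']
  refine ext_val fun p => ?_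
  exact (hloc.apply_eq_of_isPreconnected isPreconnected_univ (mem_univ p) (mem_univ p₀)).mpr h

/-- A family of ends is locally constant if the corresponding section is continuous. -/
def ofContinuous (f : (p : T) → EndsAt A p.1)
    (hf : Continuous fun p : T => (⟨p.1, f p⟩ : EndpointModification A)) : FlatEnds A T where
  val := f
  locConst p U hp := by
    have h := (hf.isOpen_preimage _ (EndpointModification.isOpen_sheet U ((f p).comp U hp)))
    obtain ⟨V, hV, hVe⟩ := isOpen_induced_iff.1 h
    refine ⟨⟨V, hV⟩, ?_, fun p' h1 h2 => ?_⟩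
    · have : p ∈ Subtype.val ⁻¹' V := hVe ▸ ⟨hp, rfl⟩
      exact this
    · have : p' ∈ Subtype.val ⁻¹' V := h1
      rw [hVe] at this
      exact this.2

end FlatEnds

/-- A tame open set all of whose components of `C ∩ A` are adherent to all points of `T ∩ C`. -/
structure IsProductNhd (A T : Set X) (C : Opens X) : Prop where
  isTame : IsTame A C
  subset_closure : ∀ x ∈ (C : Set X) ∩ A,
    T ∩ (C : Set X) ⊆ closure (connectedComponentIn ((C : Set X) ∩ A) x)

/-- Over `T ∩ C` an end amounts to a component of `C ∩ A`: tameness makes it unique, and adherence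
to every point of `T ∩ C` makes it exist. This trivialises the space of ends with a discrete fibre.
-/
theorem IsProductNhd.isEvenlyCovered {C : Opens X} (hC : IsProductNhd A T C) (t : T)
    (ht : t.1 ∈ C) : let : TopologicalSpace (connectedComponentIn ((C : Set X) ∩ A) ''
      ((C : Set X) ∩ A)) := ⊥
    IsEvenlyCovered (fun x : {x : EndpointModification A // x.pt ∈ T} => (⟨x.1.pt, x.2⟩ : T)) t
      (connectedComponentIn ((C : Set X) ∩ A) '' ((C : Set X) ∩ A)) := by
  let : TopologicalSpace (connectedComponentIn ((C : Set X) ∩ A) '' ((C : Set X) ∩ A)) := ⊥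
  have : DiscreteTopology (connectedComponentIn ((C : Set X) ∩ A) '' ((C : Set X) ∩ A)) := ⟨rfl⟩
  have hpt : Continuous fun x : {x : EndpointModification A // x.pt ∈ T} => (⟨x.1.pt, x.2⟩ : T) :=
    (EndpointModification.continuous_pt.comp continuous_subtype_val).subtype_mk _
  have hU : IsOpen (Subtype.val ⁻¹' (C : Set X) : Set T) := C.isOpen.preimage continuous_subtype_val
  have hex : ∀ (u : (Subtype.val ⁻¹' (C : Set X) : Set T))
      (N : connectedComponentIn ((C : Set X) ∩ A) '' ((C : Set X) ∩ A)),
      ∃ e : EndsAt A u.1.1, e.comp C u.2 = N.1 := by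
    rintro u ⟨_, x, hx, rfl⟩
    exact hC.isTame.exists_end u.2 hx (hC.subset_closure x hx ⟨u.1.2, u.2⟩)
  choose E hE using hex
  refine ⟨inferInstance, Subtype.val ⁻¹' (C : Set X), ht, hU, hU.preimage hpt,
    ⟨⟨fun x => (⟨⟨x.1.1.pt, x.1.2⟩, x.2⟩, ⟨x.1.1.toEnd.comp C x.2, ?_⟩),
      fun y => ⟨⟨⟨y.1.1.1, E y.1 y.2⟩, y.1.1.2⟩, y.1.2⟩, ?_, ?_⟩, ?_, ?_⟩, fun _ => rfl⟩
  · obtain ⟨z, hz, h⟩ := x.1.1.toEnd.isComp C x.2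
    exact ⟨z, hz, h.symm⟩
  · rintro ⟨⟨⟨p, e⟩, hp⟩, hpC⟩
    refine Subtype.ext (Subtype.ext (congrArg (EndpointModification.mk p) ?_))
    exact hC.isTame.end_ext hpC (hE _ _)
  · rintro ⟨u, N⟩
    exact Prod.ext rfl (Subtype.ext (hE u N))
  · refine Continuous.prodMk ?_ ?_
    · exact (hpt.comp continuous_subtype_val).subtype_mk _
    · refine IsLocallyConstant.continuous ((IsLocallyConstant.iff_exists_open _).2 fun x => ?_)
      refine ⟨_, (EndpointModification.isOpen_sheet C (x.1.1.toEnd.comp C x.2)).preimage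
        (continuous_subtype_val.comp continuous_subtype_val), ⟨x.2, rfl⟩, ?_⟩
      rintro y ⟨_, hy⟩
      exact Subtype.ext hy
  · refine Continuous.subtype_mk (Continuous.subtype_mk ?_ _) _
    refine continuous_iff_continuousAt.2 fun y => ?_
    have hy : (E y.1 y.2).comp C y.1.2 = y.2.1 := hE _ _
    rw [ContinuousAt, EndpointModification.nhds_eq_of_isTame hC.isTame _
      (show (EndpointModification.mk y.1.1.1 (E y.1 y.2)).pt ∈ C from y.1.2)]
    refine tendsto_inf.2 ⟨tendsto_comap_iff.2 ?_, tendsto_principal.2 ?_⟩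
    · exact (continuous_subtype_val.comp (continuous_subtype_val.comp continuous_fst)).continuousAt
    · have : ∀ᶠ z : (Subtype.val ⁻¹' (C : Set X) : Set T) ×
          (connectedComponentIn ((C : Set X) ∩ A) '' ((C : Set X) ∩ A)) in 𝓝 y, z.2 = y.2 :=
        continuous_snd.continuousAt.eventually (eventually_of_mem
          (isOpen_discrete {y.2} |>.mem_nhds rfl) fun _ h => h)
      filter_upwards [this] with z hz
      exact ⟨z.1.2, by rw [hE, hE, hz]⟩

/-- Over a simply connected subset, ends extend from a point to a locally constant family. -/
theorem FlatEnds.exists_val_eq [SimplyConnectedSpace T] [LocallyPathConnectedSpace T]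
    (hA : ∀ p ∈ T, ∃ C : Opens X, p ∈ C ∧ IsProductNhd A T C) (p₀ : T) (e : EndsAt A p₀.1) :
    ∃ q : FlatEnds A T, q.val p₀ = e := by
  have cov : IsCoveringMap
      (fun x : {x : EndpointModification A // x.pt ∈ T} => (⟨x.1.pt, x.2⟩ : T)) := by
    intro t
    obtain ⟨C, htC, hC⟩ := hA t.1 t.2
    let : TopologicalSpace (connectedComponentIn ((C : Set X) ∩ A) '' ((C : Set X) ∩ A)) := ⊥
    exact (hC.isEvenlyCovered t htC).to_isEvenlyCovered_preimage
  -- Lifting the identity of `T` to the covering gives a continuous section through `e`, that is, a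
  -- locally constant family.
  obtain ⟨F, ⟨hF0, hF⟩, -⟩ := cov.existsUnique_continuousMap_lifts (.id T) p₀ ⟨⟨p₀.1, e⟩, p₀.2⟩ rfl
  have hval : ∀ p : T, ∃ e : EndsAt A p.1, (F p).1 = ⟨p.1, e⟩ := by
    intro p
    have h : (F p).1.pt = p.1 := congrArg Subtype.val (congrFun hF p)
    generalize (F p).1 = x at h
    obtain ⟨p', e'⟩ := x
    obtain rfl : p' = p.1 := h
    exact ⟨e', rfl⟩
  choose f hf using hval
  refine ⟨FlatEnds.ofContinuous f ?_, ?_⟩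
  · simp_rw [← hf]
    exact continuous_subtype_val.comp F.continuous
  · have := (hf p₀).symm.trans (congrArg Subtype.val hF0)
    exact eq_of_heq (EndpointModification.mk.inj this).2

end FlatFamilies
/-! ## Cells in cubes -/

section Cells

variable {n : ℕ}

/-- The open cube with centre `c` and half side length `r`. -/
def box (c : EuclideanSpace ℝ (Fin n)) (r : ℝ) : Set (EuclideanSpace ℝ (Fin n)) :=
  {x | ∀ i, |x i - c i| < r}

/-- The vector of signs of the coordinates with index in `J`. -/
def sgn (J : Finset (Fin n)) (x : EuclideanSpace ℝ (Fin n)) : Fin n → SignType :=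
  fun i => if i ∈ J then SignType.sign (x i) else 0

/-- `σ` is obtained from `τ` by replacing some signs by zero: the cell of `σ` is a face of the
cell of `τ`. -/
def IsFace (σ τ : Fin n → SignType) : Prop := ∀ i, σ i ≠ 0 → τ i = σ i

theorem IsFace.refl (σ : Fin n → SignType) : IsFace σ σ := fun _ _ => rfl

theorem isOpen_box (c : EuclideanSpace ℝ (Fin n)) (r : ℝ) : IsOpen (box c r) := by
  have : box c r = ⋂ i, {x | |x i - c i| < r} := by ext; simp [box]
  rw [this]
  refine isOpen_iInter_of_finite fun i => isOpen_lt ?_ continuous_const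
  fun_prop

theorem mem_box_self (c : EuclideanSpace ℝ (Fin n)) {r : ℝ} (hr : 0 < r) : c ∈ box c r :=
  fun i => by simpa using hr

theorem exists_box_subset {c : EuclideanSpace ℝ (Fin n)} {V : Set (EuclideanSpace ℝ (Fin n))}
    (hV : V ∈ 𝓝 c) : ∃ r > 0, box c r ⊆ V := by
  have h : V ∈ comap (WithLp.ofLp (p := 2)) (𝓝 (WithLp.ofLp c)) := by
    have := (PiLp.homeomorph 2 (fun _ : Fin n => ℝ)).isInducing.nhds_eq_comap c
    exact this ▸ hV
  obtain ⟨s, hs, hsV⟩ := mem_comap.1 h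
  obtain ⟨r, hr, hrs⟩ := Metric.mem_nhds_iff.1 hs
  refine ⟨r, hr, fun x hx => hsV (hrs ?_)⟩
  rw [Metric.mem_ball, dist_pi_lt_iff hr]
  intro i
  rw [Real.dist_eq]
  exact hx i

theorem convex_box (c : EuclideanSpace ℝ (Fin n)) (r : ℝ) : Convex ℝ (box c r) := by
  intro x hx y hy a b ha hb hab i
  have h : (a • x + b • y) i - c i = a * (x i - c i) + b * (y i - c i) := by
    simp only [PiLp.add_apply, PiLp.smul_apply, smul_eq_mul]
    linear_combination (c i) * hab
  rw [h]
  have hxi := abs_lt.1 (hx i)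
  have hyi := abs_lt.1 (hy i)
  rw [abs_lt]
  constructor
  · rcases eq_or_lt_of_le ha with rfl | ha'
    · simp only [zero_add] at hab; subst hab; simpa using hyi.1
    · nlinarith
  · rcases eq_or_lt_of_le ha with rfl | ha'
    · simp only [zero_add] at hab; subst hab; simpa using hyi.2
    · nlinarith

theorem sign_convexComb {a b s t : ℝ} {σ : SignType} (ha : 0 ≤ a) (hb : 0 ≤ b) (hab : a + b = 1)
    (hs : SignType.sign s = σ) (ht : SignType.sign t = σ) : SignType.sign (a * s + b * t) = σ := by
  rcases eq_or_lt_of_le ha with rfl | ha'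
  · simp only [zero_add] at hab; subst hab; simpa using ht
  obtain rfl | rfl | rfl := σ.trichotomy
  · rw [sign_eq_neg_one_iff] at *
    nlinarith
  · rw [sign_eq_zero_iff] at *
    simp [hs, ht]
  · rw [sign_eq_one_iff] at *
    nlinarith

theorem sgn_eq_iff {J : Finset (Fin n)} {x : EuclideanSpace ℝ (Fin n)} {σ : Fin n → SignType} :
    sgn J x = σ ↔ (∀ i ∈ J, SignType.sign (x i) = σ i) ∧ ∀ i ∉ J, σ i = 0 := by
  rw [funext_iff]
  constructor
  · intro h
    refine ⟨fun i hi => ?_, fun i hi => ?_⟩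
    · rw [← h i, sgn, if_pos hi]
    · rw [← h i, sgn, if_neg hi]
  · rintro ⟨h1, h2⟩ i
    by_cases hi : i ∈ J
    · rw [sgn, if_pos hi, h1 i hi]
    · rw [sgn, if_neg hi, h2 i hi]

theorem convex_sgn (J : Finset (Fin n)) (σ : Fin n → SignType) : Convex ℝ {x | sgn J x = σ} := by
  intro x hx y hy a b ha hb hab
  have hx' := sgn_eq_iff.1 hx
  have hy' := sgn_eq_iff.1 hy
  exact sgn_eq_iff.2 ⟨fun i hi => sign_convexComb ha hb hab (hx'.1 i hi) (hy'.1 i hi), hx'.2⟩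

theorem sgn_of_notMem {J : Finset (Fin n)} {x : EuclideanSpace ℝ (Fin n)} {i : Fin n}
    (hi : i ∉ J) : sgn J x i = 0 := if_neg hi

theorem sgn_of_mem {J : Finset (Fin n)} {x : EuclideanSpace ℝ (Fin n)} {i : Fin n}
    (hi : i ∈ J) : sgn J x i = SignType.sign (x i) := if_pos hi

/-- Nonzero signs persist under small perturbations; only zeros can change. -/
theorem eventually_isFace_sgn (J : Finset (Fin n)) (x : EuclideanSpace ℝ (Fin n)) :
    ∀ᶠ y in 𝓝 x, IsFace (sgn J x) (sgn J y) := by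
  refine eventually_all.2 fun i => ?_
  by_cases hi : i ∈ J
  · have hc : ContinuousAt (fun y : EuclideanSpace ℝ (Fin n) => y i) x := by fun_prop
    simp only [sgn_of_mem hi]
    rcases lt_trichotomy (x i) 0 with h | h | h
    · filter_upwards [hc.eventually_lt_const h] with y hy _
      rw [sign_neg h, sign_neg hy]
    · simp [h]
    · filter_upwards [hc.eventually_const_lt h] with y hy _
      rw [sign_pos h, sign_pos hy]
  · simp [sgn_of_notMem hi]

/-- A vector with the prescribed signs. -/
def signVec (σ : Fin n → SignType) : EuclideanSpace ℝ (Fin n) := WithLp.toLp 2 fun i => (σ i : ℝ)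

theorem sgn_add_smul_signVec {J : Finset (Fin n)} {x : EuclideanSpace ℝ (Fin n)}
    {σ : Fin n → SignType} (hσ : ∀ i ∉ J, σ i = 0) (hx : IsFace (sgn J x) σ) {t : ℝ} (ht : 0 < t) :
    sgn J (x + t • signVec σ) = σ := by
  refine sgn_eq_iff.2 ⟨fun i hi => ?_, hσ⟩
  have hxi := hx i
  rw [sgn_of_mem hi] at hxi
  have he : (x + t • signVec σ) i = x i + t * (σ i : ℝ) := rfl
  rw [he]
  rcases lt_trichotomy (x i) 0 with h | h | h
  · rw [sign_neg h] at hxi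
    rw [hxi (by decide)]
    exact sign_neg (by simp; linarith)
  · rw [h, zero_add]
    cases σ i
    · simp
    · change SignType.sign (t * ((-1 : SignType) : ℝ)) = -1
      exact sign_neg (by simpa using ht)
    · change SignType.sign (t * ((1 : SignType) : ℝ)) = 1
      exact sign_pos (by simpa using ht)
  · rw [sign_pos h] at hxi
    rw [hxi (by decide)]
    exact sign_pos (by simp; linarith)

theorem tendsto_add_smul_signVec (x : EuclideanSpace ℝ (Fin n)) (σ : Fin n → SignType) :
    Tendsto (fun t : ℝ => x + t • signVec σ) (𝓝[>] 0) (𝓝 x) := by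
  have : ContinuousAt (fun t : ℝ => x + t • signVec σ) 0 := by fun_prop
  have h := this.tendsto
  simp only [zero_smul, add_zero] at h
  exact h.mono_left nhdsWithin_le_nhds

end Cells

/-! ### Cellular sets in charts and their ends -/

section CubeCharts

variable {n : ℕ} {X : Type*} [TopologicalSpace X]
  {φ : OpenPartialHomeomorph X (EuclideanSpace ℝ (Fin n))} {J : Finset (Fin n)}
  {𝒮 : Set (Fin n → SignType)} {A : Set X}

/-- The domain of a chart as an open set. -/
def dom (φ : OpenPartialHomeomorph X (EuclideanSpace ℝ (Fin n))) : Opens X :=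
  ⟨φ.source, φ.open_source⟩

/-- The points of the chart domain whose coordinates with index in `J` have signs `σ`. -/
def cell (φ : OpenPartialHomeomorph X (EuclideanSpace ℝ (Fin n))) (J : Finset (Fin n))
    (σ : Fin n → SignType) : Set X := {x | x ∈ φ.source ∧ sgn J (φ x) = σ}

/-- In the chart `φ`, the set `A` is the union of the cells with sign vectors in `𝒮`, none of which
is a face of another one. -/
structure IsCellular (φ : OpenPartialHomeomorph X (EuclideanSpace ℝ (Fin n))) (J : Finset (Fin n))
    (𝒮 : Set (Fin n → SignType)) (A : Set X) : Prop where
  convex : Convex ℝ φ.target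
  mem_iff : ∀ x ∈ φ.source, x ∈ A ↔ sgn J (φ x) ∈ 𝒮
  support : ∀ σ ∈ 𝒮, ∀ i ∉ J, σ i = 0
  antichain : ∀ σ ∈ 𝒮, ∀ τ ∈ 𝒮, IsFace σ τ → σ = τ

theorem isPreconnected_preimage_of_convex {K : Set (EuclideanSpace ℝ (Fin n))}
    (hK : Convex ℝ (φ.target ∩ K)) : IsPreconnected {x | x ∈ φ.source ∧ φ x ∈ K} := by
  have : {x | x ∈ φ.source ∧ φ x ∈ K} = φ.symm '' (φ.target ∩ K) := by
    ext x
    constructor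
    · rintro ⟨hx, hxK⟩
      exact ⟨φ x, ⟨φ.map_source hx, hxK⟩, φ.left_inv hx⟩
    · rintro ⟨y, ⟨hy, hyK⟩, rfl⟩
      exact ⟨φ.map_target hy, by rwa [φ.right_inv hy]⟩
  rw [this]
  exact hK.isPreconnected.image _ (φ.continuousOn_symm.mono inter_subset_left)

theorem isPreconnected_cell (hφ : Convex ℝ φ.target) (σ : Fin n → SignType) :
    IsPreconnected (cell φ J σ) :=
  isPreconnected_preimage_of_convex (hφ.inter (convex_sgn J σ))

theorem eventually_isFace (J : Finset (Fin n)) {x : X} (hx : x ∈ φ.source) :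
    ∀ᶠ y in 𝓝 x, y ∈ φ.source ∧ IsFace (sgn J (φ x)) (sgn J (φ y)) :=
  (eventually_of_mem (φ.open_source.mem_nhds hx) fun _ h => h).and
    ((φ.continuousAt hx).eventually (eventually_isFace_sgn J (φ x)))

theorem eventually_ray_mem {x : X} (hx : x ∈ φ.source) {U : Set X} (hU : U ∈ 𝓝 x)
    (σ : Fin n → SignType) : ∀ᶠ t : ℝ in 𝓝[>] 0, φ x + t • signVec σ ∈ φ.target ∧
      φ.symm (φ x + t • signVec σ) ∈ U := by
  have h1 := (tendsto_add_smul_signVec (φ x) σ).eventually (φ.open_target.mem_nhds (φ.map_source hx))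
  have h2 : Tendsto φ.symm (𝓝 (φ x)) (𝓝 x) := by
    simpa [ContinuousAt, φ.left_inv hx] using φ.symm.continuousAt (x := φ x) (φ.map_source hx)
  exact h1.and ((h2.comp (tendsto_add_smul_signVec (φ x) σ)).eventually hU)

/-- Nearby points keep the nonzero signs of `x`, which gives one direction. Conversely, moving from
`x` along the ray in direction `signVec σ` leads into the cell of `σ`. -/
theorem mem_closure_cell_iff {x : X} (hx : x ∈ φ.source) {σ : Fin n → SignType}
    (hσ : ∀ i ∉ J, σ i = 0) : x ∈ closure (cell φ J σ) ↔ IsFace (sgn J (φ x)) σ := by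
  constructor
  · intro h
    obtain ⟨y, hy, hyc⟩ := mem_closure_iff_nhds.1 h _ (eventually_isFace J hx)
    exact hyc.2 ▸ hy.2
  · intro h
    refine mem_closure_iff_nhds.2 fun U hU => ?_
    obtain ⟨t, ⟨ht, htU⟩, ht0⟩ :=
      ((eventually_ray_mem hx hU σ).and self_mem_nhdsWithin).exists
    refine ⟨_, htU, φ.map_target ht, ?_⟩
    rw [φ.right_inv ht]
    exact sgn_add_smul_signVec hσ h ht0

namespace IsCellular

/-- Cells are convex, hence connected. Within `A` the sign vector is locally constant, since it
could only change to one having it as a face, which the antichain condition excludes. -/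
theorem connectedComponentIn_eq (h : IsCellular φ J 𝒮 A) {x : X} (hx : x ∈ φ.source)
    (hxA : x ∈ A) :
    connectedComponentIn ((dom φ : Set X) ∩ A) x = cell φ J (sgn J (φ x)) := by
  apply Subset.antisymm
  · set K := connectedComponentIn ((dom φ : Set X) ∩ A) x with hK
    have hKs : K ⊆ φ.source ∩ A := connectedComponentIn_subset _ _
    have : PreconnectedSpace K := Subtype.preconnectedSpace isPreconnected_connectedComponentIn
    have hloc : IsLocallyConstant fun y : K => sgn J (φ y.1) := by
      rw [IsLocallyConstant.iff_eventually_eq]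
      intro y
      filter_upwards [continuous_subtype_val.continuousAt.eventually
        (eventually_isFace J (hKs y.2).1)] with z hz
      exact (h.antichain _ ((h.mem_iff y (hKs y.2).1).1 (hKs y.2).2) _
        ((h.mem_iff z (hKs z.2).1).1 (hKs z.2).2) hz.2).symm
    intro y hy
    exact ⟨(hKs hy).1, hloc.apply_eq_of_isPreconnected isPreconnected_univ (mem_univ ⟨y, hy⟩)
      (mem_univ ⟨x, mem_connectedComponentIn ⟨hx, hxA⟩⟩)⟩
  · refine (isPreconnected_cell h.convex _).subset_connectedComponentIn ⟨hx, rfl⟩ ?_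
    rintro y ⟨hy, hyσ⟩
    exact ⟨hy, (h.mem_iff y hy).2 (hyσ ▸ (h.mem_iff x hx).1 hxA)⟩

/-- The components are cells, and a small cube around `p` meets a cell in a convex set. -/
theorem isTame (h : IsCellular φ J 𝒮 A) : IsTame A (dom φ) where
  locConn := by
    rintro x ⟨hx, hxA⟩ p hp hpx U hpU
    rw [h.connectedComponentIn_eq hx hxA]
    have hn : φ.symm ⁻¹' (U : Set X) ∩ φ.target ∈ 𝓝 (φ p) := by
      refine inter_mem ?_ (φ.open_target.mem_nhds (φ.map_source hp))
      refine (φ.symm.continuousAt (x := φ p) (φ.map_source hp)).preimage_mem_nhds ?_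
      rw [φ.left_inv hp]
      exact U.isOpen.mem_nhds hpU
    obtain ⟨r, hr, hrU⟩ := exists_box_subset hn
    refine ⟨⟨φ.source ∩ φ ⁻¹' box (φ p) r, φ.isOpen_inter_preimage (isOpen_box _ _)⟩,
      ⟨hp, mem_box_self _ hr⟩, ?_, fun y hy => hy.1, ?_⟩
    · rintro y ⟨hy, hyr⟩
      have := (hrU hyr).1
      rwa [mem_preimage, φ.left_inv hy] at this
    · have heq : (φ.source ∩ φ ⁻¹' box (φ p) r) ∩ cell φ J (sgn J (φ x)) =
          {y | y ∈ φ.source ∧ φ y ∈ box (φ p) r ∩ {z | sgn J z = sgn J (φ x)}} := by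
        ext y
        simp only [cell, mem_inter_iff, mem_preimage, mem_ofPred_eq]
        tauto
      change IsPreconnected ((φ.source ∩ φ ⁻¹' box (φ p) r) ∩ cell φ J (sgn J (φ x)))
      rw [heq]
      exact isPreconnected_preimage_of_convex
        (h.convex.inter ((convex_box _ _).inter (convex_sgn _ _)))

theorem exists_comp_eq_cell (h : IsCellular φ J 𝒮 A) {p : X} (hp : p ∈ dom φ) (e : EndsAt A p) :
    ∃ σ ∈ 𝒮, IsFace (sgn J (φ p)) σ ∧ e.comp (dom φ) hp = cell φ J σ := by
  obtain ⟨x, ⟨hx, hxA⟩, he⟩ := e.isComp (dom φ) hp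
  have hσ := (h.mem_iff x hx).1 hxA
  rw [h.connectedComponentIn_eq hx hxA] at he
  refine ⟨_, hσ, ?_, he⟩
  rw [← mem_closure_cell_iff hp (h.support _ hσ), ← he]
  exact e.mem_closure_comp _ hp

theorem exists_end (h : IsCellular φ J 𝒮 A) {p : X} (hp : p ∈ dom φ) {σ : Fin n → SignType}
    (hσ : σ ∈ 𝒮) (hpσ : IsFace (sgn J (φ p)) σ) :
    ∃ e : EndsAt A p, e.comp (dom φ) hp = cell φ J σ := by
  have hcl := (mem_closure_cell_iff hp (h.support _ hσ)).2 hpσ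
  obtain ⟨x, hx, rfl⟩ := closure_nonempty_iff.1 ⟨p, hcl⟩
  have hxA := (h.mem_iff x hx).2 hσ
  rw [← h.connectedComponentIn_eq hx hxA] at hcl ⊢
  exact h.isTame.exists_end hp ⟨hx, hxA⟩ hcl

theorem cell_injOn (h : IsCellular φ J 𝒮 A) {p : X} (hp : p ∈ φ.source) {σ τ : Fin n → SignType}
    (hσ : σ ∈ 𝒮) (hpσ : IsFace (sgn J (φ p)) σ) (hστ : cell φ J σ = cell φ J τ) : σ = τ := by
  have hcl := (mem_closure_cell_iff hp (h.support _ hσ)).2 hpσ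
  obtain ⟨x, hx⟩ := closure_nonempty_iff.1 ⟨p, hcl⟩
  exact hx.2.symm.trans (hστ ▸ hx).2

end IsCellular
end CubeCharts
/-! ## Compatibility of normal crossing divisors -/

section Compatibility

variable {n : ℕ}

/-- The components of `f` are made nonzero one after the other. A short move along `v i` stays in
the hyperplane, makes the component `i` nonzero because its derivative does not vanish, and keeps
the earlier ones nonzero. -/
theorem exists_coord_ne_zero {f : EuclideanSpace ℝ (Fin n) → EuclideanSpace ℝ (Fin n)}
    {N : Set (EuclideanSpace ℝ (Fin n))}
    {f' : EuclideanSpace ℝ (Fin n) → EuclideanSpace ℝ (Fin n) →L[ℝ] EuclideanSpace ℝ (Fin n)}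
    (hf : ∀ y ∈ N, HasFDerivAt f (f' y) y) {a : Fin n} {v : Fin n → EuclideanSpace ℝ (Fin n)}
    (I : Finset (Fin n)) (hv : ∀ i ∈ I, v i a = 0) (hfv : ∀ y ∈ N, ∀ i ∈ I, f' y (v i) i ≠ 0)
    {W : Set (EuclideanSpace ℝ (Fin n))} (hW : IsOpen W) (hWN : W ⊆ N)
    {y : EuclideanSpace ℝ (Fin n)} (hy : y ∈ W) (hya : y a = 0) :
    ∃ z ∈ W, z a = 0 ∧ ∀ i ∈ I, f z i ≠ 0 := by
  induction I using Finset.induction_on with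
  | empty => exact ⟨y, hy, hya, by simp⟩
  | insert i I _ ih =>
    obtain ⟨z, hz, hza, hzI⟩ := ih (fun j hj => hv j (Finset.mem_insert_of_mem hj))
      (fun y hy j hj => hfv y hy j (Finset.mem_insert_of_mem hj))
    have hcont : ∀ j, ContinuousAt (fun w => f w j) z := fun j =>
      (PiLp.continuous_apply 2 _ j).continuousAt.comp (hf z (hWN hz)).continuousAt
    have hO : ∀ᶠ w in 𝓝 z, w ∈ W ∧ ∀ j ∈ I, f w j ≠ 0 :=
      (eventually_of_mem (hW.mem_nhds hz) fun _ h => h).and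
        ((Finset.eventually_all I).2 fun j hj => (hcont j).eventually_ne (hzI j hj))
    have hline : Tendsto (fun t : ℝ => z + t • v i) (𝓝 0) (𝓝 z) := by
      have : ContinuousAt (fun t : ℝ => z + t • v i) 0 := by fun_prop
      simpa [ContinuousAt] using this
    by_cases h0 : f z i = 0
    · have hder : HasDerivAt (fun t : ℝ => f (z + t • v i) i) (f' z (v i) i) 0 := by
        have h1 : HasDerivAt (fun t : ℝ => z + t • v i) (v i) 0 := by
          simpa using ((hasDerivAt_id (0 : ℝ)).smul_const (v i)).const_add z
        have h2 : HasFDerivAt f (f' z) (z + (0 : ℝ) • v i) := by simpa using hf z (hWN hz)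
        have h3 := h2.comp_hasDerivAt (0 : ℝ) h1
        exact (EuclideanSpace.proj (𝕜 := ℝ) i).hasFDerivAt.comp_hasDerivAt (0 : ℝ) h3
      have hne := hder.eventually_ne (c := 0) (hfv z (hWN hz) i (Finset.mem_insert_self _ _))
      obtain ⟨t, ht, htW, htI⟩ :=
        (hne.and ((hline.mono_left nhdsWithin_le_nhds).eventually hO)).exists
      refine ⟨_, htW, ?_, fun j hj => ?_⟩
      · simp [hza, hv i (Finset.mem_insert_self _ _)]
      · obtain rfl | hj := Finset.mem_insert.1 hj
        · exact ht
        · exact htI j hj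
    · exact ⟨z, hz, hza, fun j hj => by
        obtain rfl | hj := Finset.mem_insert.1 hj
        · exact h0
        · exact hzI j hj⟩

/-- If a local diffeomorphism maps a coordinate hyperplane into a union of coordinate hyperplanes,
then it locally identifies it with one of these. -/
theorem exists_coord_eq_zero_iff {f : EuclideanSpace ℝ (Fin n) → EuclideanSpace ℝ (Fin n)}
    {U : Set (EuclideanSpace ℝ (Fin n))} (hU : IsOpen U) (h0 : 0 ∈ U) (hf : ContDiffOn ℝ 1 f U)
    (hsurj : Function.Surjective (fderiv ℝ f 0)) (I : Finset (Fin n)) (a : Fin n)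
    (hI : ∀ y ∈ U, y a = 0 → ∃ i ∈ I, f y i = 0) :
    ∃ i ∈ I, ∀ᶠ y in 𝓝 0, y a = 0 ↔ f y i = 0 := by
  classical
  have hfd : ∀ y ∈ U, HasFDerivAt f (fderiv ℝ f y) y := fun y hy =>
    ((hf.differentiableOn one_ne_zero).differentiableAt (hU.mem_nhds hy)).hasFDerivAt
  have hfc : ContinuousOn (fderiv ℝ f) U := hf.continuousOn_fderiv_of_isOpen hU le_rfl
  have hopen : ∀ (v : EuclideanSpace ℝ (Fin n)) (i : Fin n),
      IsOpen (U ∩ {y | fderiv ℝ f y v i ≠ 0}) := fun v i => by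
    have : ContinuousOn (fun y => fderiv ℝ f y v i) U :=
      (PiLp.continuous_apply 2 _ i).comp_continuousOn (hfc.clm_apply continuousOn_const)
    exact this.isOpen_inter_preimage hU isOpen_ne
  -- The components whose differential at the origin is nonzero on the hyperplane. They can be made
  -- nonzero by small moves inside the hyperplane, so they alone cannot account for the hypothesis
  -- `hI`.
  let I₁ := I.filter fun i => ∃ v : EuclideanSpace ℝ (Fin n), v a = 0 ∧ fderiv ℝ f 0 v i ≠ 0
  have hv : ∀ i, ∃ v : EuclideanSpace ℝ (Fin n), i ∈ I₁ → v a = 0 ∧ fderiv ℝ f 0 v i ≠ 0 := by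
    intro i
    by_cases hi : i ∈ I₁
    · obtain ⟨v, hv⟩ := (Finset.mem_filter.1 hi).2
      exact ⟨v, fun _ => hv⟩
    · exact ⟨0, fun h => (hi h).elim⟩
  choose v hv using hv
  let N := U ∩ ⋂ i ∈ I₁, U ∩ {y | fderiv ℝ f y (v i) i ≠ 0}
  have hN : IsOpen N := hU.inter (isOpen_biInter_finset fun i _ => hopen _ _)
  have hNU : N ⊆ U := inter_subset_left
  have hN0 : (0 : EuclideanSpace ℝ (Fin n)) ∈ N :=
    ⟨h0, mem_iInter₂.2 fun i hi => ⟨h0, (hv i hi).2⟩⟩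
  have hne : ∀ y ∈ N, ∀ i ∈ I₁, fderiv ℝ f y (v i) i ≠ 0 := fun y hy i hi =>
    ((mem_iInter₂.1 hy.2) i hi).2
  have key := fun (W : Set (EuclideanSpace ℝ (Fin n))) (hW : IsOpen W) (hWN : W ⊆ N)
    (y : EuclideanSpace ℝ (Fin n)) (hy : y ∈ W) (hya : y a = 0) =>
    exists_coord_ne_zero (fun y hy => hfd y (hNU hy)) I₁ (fun i hi => (hv i hi).1) hne hW hWN
      hy hya
  obtain ⟨i₀, hi₀, hi₀'⟩ : ∃ i₀ ∈ I, ∀ w : EuclideanSpace ℝ (Fin n), w a = 0 →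
      fderiv ℝ f 0 w i₀ = 0 := by
    by_contra! hcon
    obtain ⟨z, hz, hza, hzI⟩ := key N hN Subset.rfl 0 hN0 rfl
    obtain ⟨i, hi, hfi⟩ := hI z (hNU hz) hza
    exact hzI i (Finset.mem_filter.2 ⟨hi, hcon i hi⟩) hfi
  let ea : EuclideanSpace ℝ (Fin n) := EuclideanSpace.single a 1
  have hdec : ∀ (i : Fin n), (∀ w : EuclideanSpace ℝ (Fin n), w a = 0 → fderiv ℝ f 0 w i = 0) →
      ∀ w, fderiv ℝ f 0 w i = w a * fderiv ℝ f 0 ea i := by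
    intro i hi w
    have h := hi (w - w a • ea) (by simp [ea])
    simpa [sub_eq_zero] using h
  have hea : fderiv ℝ f 0 ea i₀ ≠ 0 := by
    obtain ⟨w, hw⟩ := hsurj (EuclideanSpace.single i₀ 1)
    have h := hdec i₀ hi₀' w
    rw [hw] at h
    intro h'
    simp [h'] at h
  -- Two components with differential vanishing on the hyperplane would have proportional
  -- differentials, against surjectivity.
  have hI₁ : ∀ i ∈ I, i ≠ i₀ → i ∈ I₁ := by
    intro i hi hii
    by_contra hcon
    have hi' : ∀ w : EuclideanSpace ℝ (Fin n), w a = 0 → fderiv ℝ f 0 w i = 0 := by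
      intro w hw
      by_contra hw'
      exact hcon (Finset.mem_filter.2 ⟨hi, w, hw, hw'⟩)
    obtain ⟨w, hw⟩ := hsurj (EuclideanSpace.single i 1)
    have h1 := hdec i hi' w
    have h2 := hdec i₀ hi₀' w
    rw [hw] at h1 h2
    simp only [PiLp.single_apply, if_neg (Ne.symm hii), if_true] at h1 h2
    rcases mul_eq_zero.1 h2.symm with h | h
    · rw [h] at h1; simp at h1
    · exact hea h
  -- If the component `i₀` were nonzero at a point of the hyperplane, it would be so nearby, and all
  -- the others could be made nonzero there as well.
  have hzero : ∀ y ∈ N, y a = 0 → f y i₀ = 0 := by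
    intro y hy hya
    by_contra hcon
    have hcf : ContinuousOn (fun y => f y i₀) N :=
      (PiLp.continuous_apply 2 _ i₀).comp_continuousOn (hf.continuousOn.mono hNU)
    obtain ⟨z, hz, hza, hzI⟩ := key (N ∩ {y | f y i₀ ≠ 0})
      (hcf.isOpen_inter_preimage hN isOpen_ne) inter_subset_left y ⟨hy, hcon⟩ hya
    obtain ⟨i, hi, hfi⟩ := hI z (hNU hz.1) hza
    by_cases hii : i = i₀
    · exact hz.2 (hii ▸ hfi)
    · exact hzI i (hI₁ i hi hii) hfi
  refine ⟨i₀, hi₀, ?_⟩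
  obtain ⟨r, hr, hrN⟩ := exists_box_subset
    ((hN.inter (hopen ea i₀)).mem_nhds ⟨hN0, h0, hea⟩)
  filter_upwards [(isOpen_box 0 r).mem_nhds (mem_box_self _ hr)] with y hy
  refine ⟨hzero y (hrN hy).1, fun hfy => ?_⟩
  by_contra hya
  -- The converse is Rolle's theorem on the segment from the projection `y₀` of `y` to the
  -- hyperplane up to `y`: the component `i₀` vanishes at both ends, while its derivative in
  -- direction `ea` does not vanish in the cube.
  let y₀ := y - y a • ea
  have hbox : ∀ t ∈ Icc (0 : ℝ) 1, y₀ + (t * y a) • ea ∈ box 0 r := by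
    intro t ht i
    have h1 : (y₀ + (t * y a) • ea) i = if i = a then t * y i else y i := by
      simp only [y₀, ea, PiLp.add_apply, PiLp.sub_apply, PiLp.smul_apply,
        PiLp.single_apply, smul_eq_mul]
      split_ifs with h
      · subst h; ring
      · ring
    have h2 := hy i
    simp only [PiLp.zero_apply, sub_zero] at h2 ⊢
    rw [h1]
    split_ifs
    · rw [abs_mul, abs_of_nonneg ht.1]
      exact (mul_le_of_le_one_left (abs_nonneg _) ht.2).trans_lt h2
    · exact h2
  have hder : ∀ t ∈ Icc (0 : ℝ) 1, HasDerivAt (fun t : ℝ => f (y₀ + (t * y a) • ea) i₀)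
      (y a * fderiv ℝ f (y₀ + (t * y a) • ea) ea i₀) t := by
    intro t ht
    have h1 : HasDerivAt (fun t : ℝ => y₀ + (t * y a) • ea) (y a • ea) t := by
      have := (((hasDerivAt_id t).mul_const (y a)).smul_const ea).const_add y₀
      simpa using this
    have h3 := (hfd _ (hNU (hrN (hbox t ht)).1)).comp_hasDerivAt t h1
    have h4 := (EuclideanSpace.proj (𝕜 := ℝ) i₀).hasFDerivAt.comp_hasDerivAt t h3
    refine h4.congr_deriv ?_
    simp
  obtain ⟨t, ht, hslope⟩ := exists_hasDerivAt_eq_slope _ _ (zero_lt_one' ℝ)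
    (fun t ht => (hder t ht).continuousAt.continuousWithinAt)
    (fun t ht => hder t (Ioo_subset_Icc_self ht))
  have hy1 : y₀ + ((1 : ℝ) * y a) • ea = y := by simp [y₀]
  have hy0 : f (y₀ + ((0 : ℝ) * y a) • ea) i₀ = 0 := by
    refine hzero _ (hrN (hbox 0 (by simp))).1 ?_
    simp [y₀, ea]
  rw [hy0, hy1, hfy] at hslope
  have hmem := (hrN (hbox t (Ioo_subset_Icc_self ht))).2.2
  refine hmem ?_
  simpa [hya] using hslope

end Compatibility
/-- In the chart `φ`, the set `D` is the union of the coordinate hyperplanes with index in `J`. -/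
def IsZeroSet {n : ℕ} {X : Type*} [TopologicalSpace X]
    (φ : OpenPartialHomeomorph X (EuclideanSpace ℝ (Fin n))) (J : Finset (Fin n))
    (D : Set X) : Prop := ∀ x ∈ φ.source, x ∈ D ↔ ∃ i ∈ J, φ x i = 0

/-- The indices of the first `k` coordinates. -/
def firstIdx (n k : ℕ) : Finset (Fin n) := Finset.univ.filter fun i => i.val < k

theorem mem_firstIdx {n k : ℕ} {i : Fin n} : i ∈ firstIdx n k ↔ i.val < k := by simp [firstIdx]

/-! ### Cube charts and common charts for two divisors -/

section NormalCrossingCharts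

variable {n : ℕ} {X : Type*} [TopologicalSpace X] [ChartedSpace (EuclideanSpace ℝ (Fin n)) X]

/-- This is `exists_coord_eq_zero_iff` for the transition map, whose differential is surjective by
the chain rule applied to the inverse transition map. -/
theorem exists_eventually_coord_eq_zero_iff [IsManifold (𝓡 n) ∞ X] {p : X}
    {φ ψ : OpenPartialHomeomorph X (EuclideanSpace ℝ (Fin n))}
    (hφ : φ ∈ IsManifold.maximalAtlas (𝓡 n) ∞ X) (hψ : ψ ∈ IsManifold.maximalAtlas (𝓡 n) ∞ X)
    (hpφ : p ∈ φ.source) (hpψ : p ∈ ψ.source) (hφ0 : φ p = 0) (hψ0 : ψ p = 0)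
    (I : Finset (Fin n)) (a : Fin n) (hI : ∀ᶠ x in 𝓝 p, ψ x a = 0 → ∃ i ∈ I, φ x i = 0) :
    ∃ i ∈ I, ∀ᶠ x in 𝓝 p, ψ x a = 0 ↔ φ x i = 0 := by
  have hsm : ∀ {φ ψ : OpenPartialHomeomorph X (EuclideanSpace ℝ (Fin n))},
      φ ∈ IsManifold.maximalAtlas (𝓡 n) ∞ X → ψ ∈ IsManifold.maximalAtlas (𝓡 n) ∞ X →
      ContDiffOn ℝ ∞ (φ ∘ ψ.symm) (ψ.target ∩ ψ.symm ⁻¹' φ.source) := by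
    intro φ ψ hφ hψ
    rw [← contMDiffOn_iff_contDiffOn]
    exact (contMDiffOn_of_mem_maximalAtlas hφ).comp
      ((contMDiffOn_symm_of_mem_maximalAtlas hψ).mono inter_subset_left) inter_subset_right
  have hopen : ∀ (ψ : OpenPartialHomeomorph X (EuclideanSpace ℝ (Fin n))) {V : Set X},
      IsOpen V → IsOpen (ψ.target ∩ ψ.symm ⁻¹' V) := fun ψ V hV =>
    ψ.isOpen_inter_preimage_symm hV
  have hmem : ∀ {ψ : OpenPartialHomeomorph X (EuclideanSpace ℝ (Fin n))} {V : Set X},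
      p ∈ ψ.source → ψ p = 0 → p ∈ V → (0 : EuclideanSpace ℝ (Fin n)) ∈
        ψ.target ∩ ψ.symm ⁻¹' V := by
    intro ψ V hp h0 hV
    refine ⟨h0 ▸ ψ.map_source hp, ?_⟩
    rw [mem_preimage, ← h0, ψ.left_inv hp]
    exact hV
  obtain ⟨V, hVI, hV, hpV⟩ := eventually_nhds_iff.1 hI
  have hd : ∀ {φ ψ : OpenPartialHomeomorph X (EuclideanSpace ℝ (Fin n))},
      φ ∈ IsManifold.maximalAtlas (𝓡 n) ∞ X → ψ ∈ IsManifold.maximalAtlas (𝓡 n) ∞ X →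
      p ∈ φ.source → p ∈ ψ.source → ψ p = 0 →
      HasFDerivAt (φ ∘ ψ.symm) (fderiv ℝ (φ ∘ ψ.symm) 0) 0 := by
    intro φ ψ hφ hψ hpφ hpψ hψ0
    exact (((hsm hφ hψ).differentiableOn (by simp)).differentiableAt
      ((hopen ψ φ.open_source).mem_nhds (hmem hpψ hψ0 hpφ))).hasFDerivAt
  have hsurj : Function.Surjective (fderiv ℝ (φ ∘ ψ.symm) 0) := by
    have h1 := hd hφ hψ hpφ hpψ hψ0
    have h2 := hd hψ hφ hpψ hpφ hφ0
    have h0 : (ψ ∘ φ.symm) 0 = 0 := by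
      have : φ.symm 0 = p := by rw [← hφ0, φ.left_inv hpφ]
      rw [Function.comp_apply, this, hψ0]
    have h1' : HasFDerivAt (φ ∘ ψ.symm) (fderiv ℝ (φ ∘ ψ.symm) 0) ((ψ ∘ φ.symm) 0) := by rwa [h0]
    have h3 := h1'.comp (0 : EuclideanSpace ℝ (Fin n)) h2
    have hid : (φ ∘ ψ.symm) ∘ (ψ ∘ φ.symm) =ᶠ[𝓝 0] id := by
      filter_upwards [(hopen φ ψ.open_source).mem_nhds (hmem hpφ hφ0 hpψ)] with y hy
      simp only [Function.comp_apply, id]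
      rw [ψ.left_inv hy.2, φ.right_inv hy.1]
    have h4 := h3.unique ((hasFDerivAt_id _).congr_of_eventuallyEq hid)
    intro w
    exact ⟨_, DFunLike.congr_fun h4 w⟩
  obtain ⟨i, hi, hev⟩ := exists_coord_eq_zero_iff (f := φ ∘ ψ.symm)
    (hopen ψ (φ.open_source.inter hV)) (hmem hpψ hψ0 ⟨hpφ, hpV⟩)
    (((hsm hφ hψ).of_le (by norm_cast)).mono
      (inter_subset_inter_right _ (preimage_mono inter_subset_left))) hsurj I a (by
      rintro y ⟨hy, hyV⟩ hya
      have := hVI _ hyV.2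
      rw [ψ.right_inv hy] at this
      exact this hya)
  refine ⟨i, hi, ?_⟩
  have hc := ψ.continuousAt hpψ
  rw [ContinuousAt, hψ0] at hc
  filter_upwards [hc.eventually hev, ψ.open_source.mem_nhds hpψ] with x hx hxs
  simpa [ψ.left_inv hxs] using hx

/-- A smooth chart centred in `p` whose image is a cube. -/
structure IsCubeChart (p : X) (φ : OpenPartialHomeomorph X (EuclideanSpace ℝ (Fin n))) : Prop where
  smooth : φ ∈ IsManifold.maximalAtlas (𝓡 n) ∞ X
  mem_source : p ∈ φ.source
  centred : φ p = 0
  target : ∃ r > 0, φ.target = box 0 r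

theorem IsCubeChart.convex {p : X} {φ : OpenPartialHomeomorph X (EuclideanSpace ℝ (Fin n))}
    (hφ : IsCubeChart p φ) : Convex ℝ φ.target := by
  obtain ⟨r, -, h⟩ := hφ.target
  exact h ▸ convex_box 0 r

theorem IsNCChart.isZeroSet {D : Set X} {k : ℕ} {p : X}
    {φ : OpenPartialHomeomorph X (EuclideanSpace ℝ (Fin n))} (h : IsNCChart D k p φ) :
    IsZeroSet φ (firstIdx n k) D := fun x hx => by
  simp only [mem_firstIdx]
  exact h.mem_iff x hx

/-- Every chart contains a cube chart. -/
theorem exists_isCubeChart_subset {φ : OpenPartialHomeomorph X (EuclideanSpace ℝ (Fin n))}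
    (hφ : φ ∈ IsManifold.maximalAtlas (𝓡 n) ∞ X) {p : X} (hp : p ∈ φ.source) (h0 : φ p = 0)
    {V : Set X} (hV : V ∈ 𝓝 p) : ∃ ψ : OpenPartialHomeomorph X (EuclideanSpace ℝ (Fin n)),
      IsCubeChart p ψ ∧ ψ.source ⊆ φ.source ∩ V ∧ ∀ x, ψ x = φ x := by
  have hn : φ.target ∩ φ.symm ⁻¹' V ∈ 𝓝 (0 : EuclideanSpace ℝ (Fin n)) := by
    have h0t : (0 : EuclideanSpace ℝ (Fin n)) ∈ φ.target := h0 ▸ φ.map_source hp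
    refine inter_mem (φ.open_target.mem_nhds h0t) ?_
    refine (φ.symm.continuousAt (x := 0) h0t).preimage_mem_nhds ?_
    rwa [← h0, φ.left_inv hp]
  obtain ⟨r, hr, hrV⟩ := exists_box_subset hn
  have hopen : IsOpen (φ.source ∩ φ ⁻¹' box 0 r) := φ.isOpen_inter_preimage (isOpen_box _ _)
  refine ⟨φ.restr (φ.source ∩ φ ⁻¹' box 0 r), ⟨restr_mem_maximalAtlas _ hφ hopen, ?_, h0,
    r, hr, ?_⟩, ?_, fun x => rfl⟩
  · rw [φ.restr_source' _ hopen]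
    exact ⟨hp, hp, by rw [mem_preimage, h0]; exact mem_box_self _ hr⟩
  · ext y
    rw [φ.restr_target, hopen.interior_eq]
    constructor
    · rintro ⟨hy, -, hy'⟩
      rwa [mem_preimage, φ.right_inv hy] at hy'
    · intro hy
      have hyt := (hrV hy).1
      exact ⟨hyt, φ.map_target hyt, by rwa [mem_preimage, φ.right_inv hyt]⟩
  · rw [φ.restr_source' _ hopen]
    rintro x ⟨hx, -, hxr⟩
    have := (hrV hxr).2
    rw [mem_preimage, φ.left_inv hx] at this
    exact ⟨hx, this⟩

theorem IsNCChart.restrict {D : Set X} {k : ℕ} {p : X}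
    {φ ψ : OpenPartialHomeomorph X (EuclideanSpace ℝ (Fin n))} (h : IsNCChart D k p φ)
    (hψ : IsCubeChart p ψ) (hs : ψ.source ⊆ φ.source) (he : ∀ x, ψ x = φ x) :
    IsNCChart D k p ψ where
  smooth := hψ.smooth
  mem_source := hψ.mem_source
  centred := hψ.centred
  le := h.le
  mem_iff x hx := by rw [he]; exact h.mem_iff x (hs hx)

theorem addRight_mem_contDiffGroupoid (c : EuclideanSpace ℝ (Fin n)) :
    (Homeomorph.addRight c).toOpenPartialHomeomorph ∈ contDiffGroupoid ∞ (𝓡 n) := by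
  have key : ∀ c : EuclideanSpace ℝ (Fin n), ContDiff ℝ ∞ fun y => y + c := fun c => by fun_prop
  refine mem_groupoid_of_pregroupoid.2 ⟨(key c).contDiffOn, ?_⟩
  exact (key (-c)).contDiffOn

theorem trans_mem_maximalAtlas {e : OpenPartialHomeomorph X (EuclideanSpace ℝ (Fin n))}
    (he : e ∈ IsManifold.maximalAtlas (𝓡 n) ∞ X)
    {f : OpenPartialHomeomorph (EuclideanSpace ℝ (Fin n)) (EuclideanSpace ℝ (Fin n))}
    (hf : f ∈ contDiffGroupoid ∞ (𝓡 n)) : e.trans f ∈ IsManifold.maximalAtlas (𝓡 n) ∞ X := by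
  intro e' he'
  obtain ⟨h1, h2⟩ := he e' he'
  constructor
  · rw [OpenPartialHomeomorph.trans_symm_eq_symm_trans_symm, OpenPartialHomeomorph.trans_assoc]
    exact (contDiffGroupoid ∞ (𝓡 n)).trans ((contDiffGroupoid ∞ (𝓡 n)).symm hf) h1
  · rw [← OpenPartialHomeomorph.trans_assoc]
    exact (contDiffGroupoid ∞ (𝓡 n)).trans h2 hf

variable [IsManifold (𝓡 n) ∞ X]

/-- Around each point there is a normal crossing chart. -/
theorem IsNormalCrossingDivisor.exists_isNCChart {D : Set X} (hD : IsNormalCrossingDivisor n D)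
    (p : X) : ∃ (k : ℕ) (φ : OpenPartialHomeomorph X (EuclideanSpace ℝ (Fin n))),
      IsNCChart D k p φ := by
  by_cases hp : p ∈ D
  · obtain ⟨k, -, φ, hφ⟩ := hD.2 p hp
    exact ⟨k, φ, hφ⟩
  · let e := chartAt (EuclideanSpace ℝ (Fin n)) p
    let φ := (e.trans (Homeomorph.addRight (-(e p))).toOpenPartialHomeomorph)
    have hs : φ.source = e.source := by simp [φ]
    have hφ : φ ∈ IsManifold.maximalAtlas (𝓡 n) ∞ X := by
      exact trans_mem_maximalAtlas (IsManifold.chart_mem_maximalAtlas p) (addRight_mem_contDiffGroupoid _)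
    have hpφ : p ∈ φ.source := hs ▸ mem_chart_source _ p
    have h0 : φ p = 0 := by simp [φ]
    -- Off the closed set `D`, a chart small enough to avoid `D` is of type `k = 0`.
    obtain ⟨ψ, hψ, hψs, hψe⟩ := exists_isCubeChart_subset hφ hpφ h0 (hD.1.isOpen_compl.mem_nhds hp)
    refine ⟨0, ψ, hψ.smooth, hψ.mem_source, hψ.centred, Nat.zero_le _, fun x hx => ?_⟩
    simp only [not_lt_zero, false_and, exists_false, iff_false]
    exact (hψs hx).2

/-- Normal crossing divisors `D ⊆ D'` are locally unions of coordinate hyperplanes in a common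
chart. -/
theorem exists_common_chart {D D' : Set X} (hD : IsNormalCrossingDivisor n D)
    (hD' : IsNormalCrossingDivisor n D') (hDD' : D ⊆ D') (p : X) :
    ∃ (k : ℕ) (J : Finset (Fin n)) (φ : OpenPartialHomeomorph X (EuclideanSpace ℝ (Fin n))),
      IsCubeChart p φ ∧ IsNCChart D' k p φ ∧ J ⊆ firstIdx n k ∧ IsZeroSet φ J D := by
  classical
  obtain ⟨k, φ, hφ⟩ := hD'.exists_isNCChart p
  obtain ⟨j, ψ, hψ⟩ := hD.exists_isNCChart p
  -- Each hyperplane of `D` in the chart `ψ` is contained in `D'`, a union of hyperplanes in the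
  -- chart `φ`, and so coincides locally with one of these. For the other indices the value `i = a`
  -- is irrelevant.
  have hex : ∀ a : Fin n, ∃ i : Fin n, a.val < j → i ∈ firstIdx n k ∧
      ∀ᶠ x in 𝓝 p, ψ x a = 0 ↔ φ x i = 0 := by
    intro a
    by_cases ha : a.val < j
    · obtain ⟨i, hi, h⟩ := exists_eventually_coord_eq_zero_iff hφ.smooth hψ.smooth hφ.mem_source
        hψ.mem_source hφ.centred hψ.centred (firstIdx n k) a (by
          filter_upwards [φ.open_source.mem_nhds hφ.mem_source,
            ψ.open_source.mem_nhds hψ.mem_source] with x hx hx' hxa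
          exact (hφ.isZeroSet x hx).1 (hDD' ((hψ.mem_iff x hx').2 ⟨a, ha, hxa⟩)))
      exact ⟨i, fun _ => ⟨hi, h⟩⟩
    · exact ⟨a, fun h => (ha h).elim⟩
  choose i hi using hex
  have hV : ∀ᶠ x in 𝓝 p, x ∈ ψ.source ∧ ∀ a ∈ firstIdx n j, (ψ x a = 0 ↔ φ x (i a) = 0) :=
    (eventually_of_mem (ψ.open_source.mem_nhds hψ.mem_source) fun _ h => h).and
      ((Finset.eventually_all _).2 fun a ha => (hi a (mem_firstIdx.1 ha)).2)
  obtain ⟨φ', hφ', hs, he⟩ := exists_isCubeChart_subset hφ.smooth hφ.mem_source hφ.centred hV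
  refine ⟨k, (firstIdx n j).image i, φ', hφ',
    hφ.restrict hφ' (hs.trans inter_subset_left) he, ?_, fun x hx => ?_⟩
  · intro b hb
    obtain ⟨a, ha, rfl⟩ := Finset.mem_image.1 hb
    exact (hi a (mem_firstIdx.1 ha)).1
  · obtain ⟨hxψ, hxa⟩ := (hs hx).2
    rw [hψ.isZeroSet x hxψ, he]
    constructor
    · rintro ⟨a, ha, h⟩
      exact ⟨i a, Finset.mem_image_of_mem _ ha, (hxa a ha).1 h⟩
    · rintro ⟨b, hb, h⟩
      obtain ⟨a, ha, rfl⟩ := Finset.mem_image.1 hb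
      exact ⟨a, ha, (hxa a ha).2 h⟩

end NormalCrossingCharts
/-! ## Strata in normal crossing charts -/

section Orthants

variable {n : ℕ} {X : Type*} [TopologicalSpace X]
  {φ : OpenPartialHomeomorph X (EuclideanSpace ℝ (Fin n))} {J : Finset (Fin n)} {D : Set X}

/-- The sign vectors of the orthants with respect to the coordinates with index in `J`. -/
def orthants (J : Finset (Fin n)) : Set (Fin n → SignType) := {σ | ∀ i, σ i ≠ 0 ↔ i ∈ J}

theorem sgn_mem_orthants_iff {y : EuclideanSpace ℝ (Fin n)} :
    sgn J y ∈ orthants J ↔ ∀ i ∈ J, y i ≠ 0 := by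
  constructor
  · intro h i hi
    have := (h i).2 hi
    rwa [sgn_of_mem hi, Ne, sign_eq_zero_iff] at this
  · intro h i
    by_cases hi : i ∈ J
    · simp [sgn_of_mem hi, hi, h i hi]
    · simp [sgn_of_notMem hi, hi]

theorem IsZeroSet.isCellular_compl (h : IsZeroSet φ J D) (hφ : Convex ℝ φ.target) :
    IsCellular φ J (orthants J) Dᶜ where
  convex := hφ
  mem_iff x hx := by
    rw [mem_compl_iff, h x hx, sgn_mem_orthants_iff]
    push Not
    rfl
  support σ hσ i hi := by
    by_contra h'
    exact hi ((hσ i).1 h')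
  antichain σ hσ τ hτ hστ := by
    funext i
    by_cases hi : i ∈ J
    · exact (hστ i ((hσ i).2 hi)).symm
    · have h1 : σ i = 0 := by
        by_contra h'
        exact hi ((hσ i).1 h')
      have h2 : τ i = 0 := by
        by_contra h'
        exact hi ((hτ i).1 h')
      rw [h1, h2]

/-- The number of ends of a cellular set in a point. -/
theorem IsCellular.card_ends {𝒮 : Set (Fin n → SignType)} {A : Set X}
    (h : IsCellular φ J 𝒮 A) {p : X} (hp : p ∈ φ.source) :
    Nat.card (EndsAt A p) = Nat.card {σ // σ ∈ 𝒮 ∧ IsFace (sgn J (φ p)) σ} := by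
  choose σ hσ hpσ he using fun e : EndsAt A p => h.exists_comp_eq_cell hp e
  refine Nat.card_congr (Equiv.ofBijective (fun e => ⟨σ e, hσ e, hpσ e⟩) ⟨fun e e' hee => ?_, ?_⟩)
  · refine h.isTame.end_ext (C := dom φ) hp ?_
    rw [he e, he e', Subtype.mk.inj hee]
  · rintro ⟨τ, hτ, hpτ⟩
    obtain ⟨e, heτ⟩ := h.exists_end hp hτ hpτ
    refine ⟨e, Subtype.ext ?_⟩
    exact (h.cell_injOn hp hτ hpτ (heτ.symm.trans (he e))).symm

/-- An orthant adjacent to `y` inherits the sign of each nonzero coordinate and has two choices for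
each vanishing one. -/
theorem card_orthants (J : Finset (Fin n)) (y : EuclideanSpace ℝ (Fin n)) :
    Nat.card {σ // σ ∈ orthants J ∧ IsFace (sgn J y) σ} = 2 ^ (J.filter fun i => y i = 0).card := by
  classical
  -- The admissible signs of each coordinate; outside `J` this leaves only the sign `0`.
  let F : Fin n → Finset SignType := fun i =>
    if i ∈ J.filter (fun i => y i = 0) then {1, -1} else {sgn J y i}
  have hF : ∀ σ, (σ ∈ orthants J ∧ IsFace (sgn J y) σ) ↔ σ ∈ Fintype.piFinset F := by
    intro σ
    rw [Fintype.mem_piFinset]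
    constructor
    · rintro ⟨h1, h2⟩ i
      by_cases hi : i ∈ J
      · by_cases hy : y i = 0
        · have hne := (h1 i).2 hi
          simp only [F, Finset.mem_filter, hi, hy, and_self, if_true, Finset.mem_insert,
            Finset.mem_singleton]
          obtain h | h | h := (σ i).trichotomy
          · exact Or.inr h
          · exact (hne h).elim
          · exact Or.inl h
        · simp only [F, Finset.mem_filter, hi, hy, and_false, if_false, Finset.mem_singleton]
          exact h2 i (by rw [sgn_of_mem hi, Ne, sign_eq_zero_iff]; exact hy)
      · simp only [F, Finset.mem_filter, hi, false_and, if_false, Finset.mem_singleton]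
        rw [sgn_of_notMem hi]
        by_contra h
        exact hi ((h1 i).1 h)
    · intro h
      refine ⟨fun i => ?_, fun i hi => ?_⟩
      · have hi' := h i
        by_cases hi : i ∈ J
        · by_cases hy : y i = 0
          · simp only [F, Finset.mem_filter, hi, hy, and_self, if_true, Finset.mem_insert,
              Finset.mem_singleton] at hi'
            rcases hi' with h | h <;> simp [h, hi]
          · simp only [F, Finset.mem_filter, hi, hy, and_false, if_false,
              Finset.mem_singleton] at hi'
            rw [hi', sgn_of_mem hi]
            simp [hi, hy]
        · simp only [F, Finset.mem_filter, hi, false_and, if_false, Finset.mem_singleton] at hi'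
          rw [hi', sgn_of_notMem hi]
          simp [hi]
      · have hi' := h i
        have hiJ : i ∈ J := by
          by_contra hiJ
          exact hi (sgn_of_notMem hiJ)
        rw [sgn_of_mem hiJ, Ne, sign_eq_zero_iff] at hi
        simpa only [F, Finset.mem_filter, hiJ, hi, and_false, if_false,
          Finset.mem_singleton] using hi'
  rw [Nat.card_congr (Equiv.subtypeEquivRight hF), Nat.card_eq_fintype_card, Fintype.card_coe,
    Fintype.card_piFinset]
  have : ∀ i, (F i).card = if i ∈ J.filter (fun i => y i = 0) then 2 else 1 := by
    intro i
    simp only [F]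
    split_ifs
    · rfl
    · simp
  simp only [this]
  rw [Finset.prod_ite_mem, Finset.univ_inter, Finset.prod_const]

/-- The sign vectors of the points of a set. -/
def signs (φ : OpenPartialHomeomorph X (EuclideanSpace ℝ (Fin n))) (J : Finset (Fin n))
    (S : Set X) : Set (Fin n → SignType) := {σ | ∃ x ∈ φ.source, x ∈ S ∧ sgn J (φ x) = σ}

theorem filter_zero_eq_of_isFace {y z : EuclideanSpace ℝ (Fin n)}
    (h : IsFace (sgn J y) (sgn J z)) :
    (J.filter fun i => z i = 0) ⊆ J.filter fun i => y i = 0 := by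
  intro i hi
  obtain ⟨hiJ, hz⟩ := Finset.mem_filter.1 hi
  refine Finset.mem_filter.2 ⟨hiJ, ?_⟩
  by_contra hy
  have := h i (by rw [sgn_of_mem hiJ, Ne, sign_eq_zero_iff]; exact hy)
  rw [sgn_of_mem hiJ, sgn_of_mem hiJ, hz, sign_zero] at this
  exact hy (sign_eq_zero_iff.1 this.symm)

/-- Passing from a face to a cell can only reduce the set of vanishing coordinates, so equal numbers
force equal sets. This is why strata consist of cells none of which is a face of another. -/
theorem sgn_eq_of_isFace_of_card {y z : EuclideanSpace ℝ (Fin n)}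
    (h : IsFace (sgn J y) (sgn J z))
    (hc : (J.filter fun i => y i = 0).card ≤ (J.filter fun i => z i = 0).card) :
    sgn J y = sgn J z := by
  have he := Finset.eq_of_subset_of_card_le (filter_zero_eq_of_isFace h) hc
  funext i
  by_cases hy : sgn J y i = 0
  · by_cases hi : i ∈ J
    · rw [sgn_of_mem hi, sign_eq_zero_iff] at hy
      have : i ∈ J.filter fun i => z i = 0 := he ▸ Finset.mem_filter.2 ⟨hi, hy⟩
      rw [sgn_of_mem hi, sgn_of_mem hi, hy, (Finset.mem_filter.1 this).2]
    · rw [sgn_of_notMem hi, sgn_of_notMem hi]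
  · exact (h i hy).symm

theorem sgn_zero (J : Finset (Fin n)) : sgn J 0 = 0 := by
  funext i
  simp [sgn]

theorem sgn_eq_zero_of_subset {J' : Finset (Fin n)} {y : EuclideanSpace ℝ (Fin n)} (hJ : J' ⊆ J)
    (h : sgn J y = 0) : sgn J' y = 0 := by
  funext i
  by_cases hi : i ∈ J'
  · rw [sgn_of_mem hi, ← sgn_of_mem (hJ hi), h]
  · exact sgn_of_notMem hi

end Orthants

/-! ### Codimension and local structure of strata -/

section Strata

variable {n : ℕ} {X : Type*} [TopologicalSpace X] [ChartedSpace (EuclideanSpace ℝ (Fin n)) X]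
  {φ : OpenPartialHomeomorph X (EuclideanSpace ℝ (Fin n))} {J : Finset (Fin n)} {D : Set X}

/-- The number of orthants determines the codimension, which therefore is the number of vanishing
coordinates in any chart. -/
theorem card_zeros_of_mem_codimLocus (hφ : Convex ℝ φ.target) (h : IsZeroSet φ J D) {x : X}
    (hx : x ∈ φ.source) {m : ℕ} (hm : x ∈ codimLocus n D m) :
    (J.filter fun i => φ x i = 0).card = m := by
  obtain ⟨ψ, hψ⟩ := hm
  obtain ⟨χ, hχ, hs, he⟩ := exists_isCubeChart_subset hψ.smooth hψ.mem_source hψ.centred univ_mem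
  have hχ' := hψ.restrict hχ (hs.trans inter_subset_left) he
  have h1 := (h.isCellular_compl hφ).card_ends hx
  have h2 := (hχ'.isZeroSet.isCellular_compl hχ.convex).card_ends hχ.mem_source
  -- The set of ends of `Dᶜ` in `x` does not depend on a chart; counting it in both charts gives
  -- equal powers of `2`.
  rw [h1, card_orthants, card_orthants] at h2
  rw [Nat.pow_right_injective le_rfl h2, hχ.centred]
  have : (Finset.filter (fun i => (0 : EuclideanSpace ℝ (Fin n)) i = 0) (firstIdx n m)) =
    firstIdx n m := Finset.filter_true_of_mem fun _ _ => rfl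
  rw [this, firstIdx, Fin.card_filter_val_lt, min_eq_right hψ.le]

theorem Stratum.isConnected (S : Stratum n D) : IsConnected S.1 := by
  obtain ⟨S, k, p, hp, rfl⟩ := S
  exact isConnected_connectedComponentIn_iff.2 hp

variable [IsManifold (𝓡 n) ∞ X]

theorem mem_codimLocus_iff (hD : IsNormalCrossingDivisor n D) (hφ : Convex ℝ φ.target)
    (h : IsZeroSet φ J D) {x : X} (hx : x ∈ φ.source) {m : ℕ} :
    x ∈ codimLocus n D m ↔ (J.filter fun i => φ x i = 0).card = m := by
  refine ⟨card_zeros_of_mem_codimLocus hφ h hx, ?_⟩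
  rintro rfl
  obtain ⟨k, ψ, hψ⟩ := hD.exists_isNCChart x
  rw [card_zeros_of_mem_codimLocus hφ h hx ⟨ψ, hψ⟩]
  exact ⟨ψ, hψ⟩

theorem codimLocus_unique (hD : IsNormalCrossingDivisor n D) {x : X} {m m' : ℕ}
    (h : x ∈ codimLocus n D m) (h' : x ∈ codimLocus n D m') : m = m' := by
  obtain ⟨k, J, φ, hφ, hk, -⟩ := exists_common_chart hD hD Subset.rfl x
  rw [← card_zeros_of_mem_codimLocus hφ.convex hk.isZeroSet hφ.mem_source h,
    ← card_zeros_of_mem_codimLocus hφ.convex hk.isZeroSet hφ.mem_source h']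

theorem exists_stratum (hD : IsNormalCrossingDivisor n D) (x : X) :
    ∃ T : Stratum n D, x ∈ T.1 := by
  obtain ⟨k, φ, hφ⟩ := hD.exists_isNCChart x
  have hx : x ∈ codimLocus n D k := ⟨φ, hφ⟩
  exact ⟨⟨_, k, x, hx, rfl⟩, mem_connectedComponentIn hx⟩

theorem Stratum.eq_of_mem (hD : IsNormalCrossingDivisor n D) {S T : Stratum n D} {x : X}
    (hS : x ∈ S.1) (hT : x ∈ T.1) : S = T := by
  obtain ⟨S, k, p, hp, rfl⟩ := S
  obtain ⟨T, l, q, hq, rfl⟩ := T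
  obtain rfl := codimLocus_unique hD (connectedComponentIn_subset _ _ hS)
    (connectedComponentIn_subset _ _ hT)
  exact Subtype.ext (connectedComponentIn_eq_of_mem_of_mem hS hT)

/-- A cell is connected, and the codimension is constant on it because it is the number of vanishing
coordinates. -/
theorem Stratum.cell_subset (hD : IsNormalCrossingDivisor n D) (hφ : Convex ℝ φ.target)
    (h : IsZeroSet φ J D) (S : Stratum n D) {x : X} (hx : x ∈ φ.source) (hxS : x ∈ S.1) :
    cell φ J (sgn J (φ x)) ⊆ S.1 := by
  obtain ⟨S, m, p, hp, rfl⟩ := S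
  change cell φ J (sgn J (φ x)) ⊆ connectedComponentIn (codimLocus n D m) p
  rw [connectedComponentIn_eq hxS]
  refine (isPreconnected_cell hφ _).subset_connectedComponentIn ⟨hx, rfl⟩ ?_
  rintro y ⟨hy, hyx⟩
  have hxm := connectedComponentIn_subset _ _ hxS
  rw [mem_codimLocus_iff hD hφ h hx] at hxm
  rw [mem_codimLocus_iff hD hφ h hy, ← hxm]
  exact congrArg _ ((filter_zero_eq_of_isFace (hyx ▸ IsFace.refl _)).antisymm
    (filter_zero_eq_of_isFace (hyx ▸ IsFace.refl _)))

/-- Strata are cellular in normal crossing charts. -/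
theorem Stratum.isCellular (hD : IsNormalCrossingDivisor n D) (hφ : Convex ℝ φ.target)
    (h : IsZeroSet φ J D) (S : Stratum n D) : IsCellular φ J (signs φ J S.1) S.1 where
  convex := hφ
  mem_iff x hx := by
    refine ⟨fun hxS => ⟨x, hx, hxS, rfl⟩, ?_⟩
    rintro ⟨y, hy, hyS, hyx⟩
    exact S.cell_subset hD hφ h hy hyS ⟨hx, hyx.symm⟩
  support := by
    rintro _ ⟨x, -, -, rfl⟩ i hi
    exact sgn_of_notMem hi
  antichain := by
    rintro _ ⟨x, hx, hxS, rfl⟩ _ ⟨y, hy, hyS, rfl⟩ hf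
    obtain ⟨S, m, p, hp, rfl⟩ := S
    have hxm := connectedComponentIn_subset _ _ hxS
    have hym := connectedComponentIn_subset _ _ hyS
    rw [mem_codimLocus_iff hD hφ h hx] at hxm
    rw [mem_codimLocus_iff hD hφ h hy] at hym
    exact sgn_eq_of_isFace_of_card hf (hxm.trans hym.symm).le

/-- In a chart centred in a point of the stratum `T`, this stratum is the smallest cell. -/
theorem Stratum.mem_iff_sgn_eq_zero (hD : IsNormalCrossingDivisor n D) (hφ : Convex ℝ φ.target)
    (h : IsZeroSet φ J D) (T : Stratum n D) {p : X} (hp : p ∈ φ.source) (hp0 : φ p = 0)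
    (hpT : p ∈ T.1) {x : X} (hx : x ∈ φ.source) : x ∈ T.1 ↔ sgn J (φ x) = 0 := by
  have hc := T.isCellular hD hφ h
  have hps := (hc.mem_iff p hp).1 hpT
  rw [hp0, sgn_zero] at hps
  rw [hc.mem_iff x hx]
  refine ⟨fun hxs => (hc.antichain _ hps _ hxs fun i hi => (hi rfl).elim).symm, fun h0 => h0 ▸ hps⟩

/-- Cellular sets are locally products along the strata. -/
theorem Stratum.isProductNhd (hD : IsNormalCrossingDivisor n D) (h : IsZeroSet φ J D)
    (T : Stratum n D) {p : X} (hp : p ∈ φ.source) (hp0 : φ p = 0) (hpT : p ∈ T.1)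
    {J' : Finset (Fin n)} (hJ : J' ⊆ J) {𝒮 : Set (Fin n → SignType)} {A : Set X}
    (hA : IsCellular φ J' 𝒮 A) : IsProductNhd A T.1 (dom φ) where
  isTame := hA.isTame
  subset_closure := by
    rintro x ⟨hx, hxA⟩ y ⟨hyT, hy⟩
    have hy0 := sgn_eq_zero_of_subset hJ
      ((T.mem_iff_sgn_eq_zero hD hA.convex h hp hp0 hpT hy).1 hyT)
    rw [hA.connectedComponentIn_eq hx hxA,
      mem_closure_cell_iff hy (hA.support _ ((hA.mem_iff x hx).1 hxA)), hy0]
    exact fun i hi => (hi rfl).elim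

/-- Around a point of `T`, the stratum is a coordinate subspace in a centred cube chart, and small
cubes meet it in convex sets. Path lifting for the coverings of ends needs this. -/
theorem Stratum.locallyPathConnectedSpace (hD : IsNormalCrossingDivisor n D) (T : Stratum n D) :
    LocallyPathConnectedSpace T.1 := by
  refine ⟨fun t => ⟨fun s => ⟨fun hs => ?_, ?_⟩⟩⟩
  · obtain ⟨k, J, φ, hφ, hk, -⟩ := exists_common_chart hD hD Subset.rfl t.1
    obtain ⟨V, hV, hVs⟩ := mem_nhds_subtype _ _ _ |>.1 hs
    have hn : φ.target ∩ φ.symm ⁻¹' V ∈ 𝓝 (φ t.1) := by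
      refine inter_mem (φ.open_target.mem_nhds (φ.map_source hφ.mem_source)) ?_
      refine (φ.symm.continuousAt (φ.map_source hφ.mem_source)).preimage_mem_nhds ?_
      rwa [φ.left_inv hφ.mem_source]
    obtain ⟨r, hr, hrV⟩ := exists_box_subset hn
    have hT : ∀ {x}, x ∈ φ.source → (x ∈ T.1 ↔ sgn (firstIdx n k) (φ x) = 0) :=
      T.mem_iff_sgn_eq_zero hD hφ.convex hk.isZeroSet hφ.mem_source hφ.centred t.2
    refine ⟨Subtype.val ⁻¹' (φ.source ∩ φ ⁻¹' box (φ t.1) r), ⟨?_, ?_⟩, ?_⟩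
    · exact ((φ.isOpen_inter_preimage (isOpen_box _ _)).preimage continuous_subtype_val).mem_nhds
        ⟨hφ.mem_source, mem_box_self _ hr⟩
    · rw [IsInducing.subtypeVal.isPathConnected_iff, Subtype.image_preimage_coe]
      have himg : T.1 ∩ (φ.source ∩ φ ⁻¹' box (φ t.1) r) =
          φ.symm '' (box (φ t.1) r ∩ {y | sgn (firstIdx n k) y = 0}) := by
        ext x
        constructor
        · rintro ⟨hxT, hx, hxr⟩
          exact ⟨φ x, ⟨hxr, (hT hx).1 hxT⟩, φ.left_inv hx⟩
        · rintro ⟨y, ⟨hyr, hy0⟩, rfl⟩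
          have hyt := (hrV hyr).1
          have hys := φ.map_target hyt
          refine ⟨(hT hys).2 ?_, hys, ?_⟩
          · rwa [φ.right_inv hyt]
          · rwa [mem_preimage, φ.right_inv hyt]
      rw [himg]
      refine IsPathConnected.image' (Convex.isPathConnected
        ((convex_box _ _).inter (convex_sgn _ _)) ⟨φ t.1, mem_box_self _ hr,
          (hT hφ.mem_source).1 t.2⟩) (φ.continuousOn_symm.mono fun y hy => (hrV hy.1).1)
    · rintro x ⟨hx, hxr⟩
      refine hVs ?_
      have := (hrV hxr).2
      rwa [mem_preimage, φ.left_inv hx] at this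
  · rintro ⟨u, ⟨hu, -⟩, hus⟩
    exact mem_of_superset hu hus

/-- Every point has a neighbourhood that is tame for the complement of the divisor. -/
theorem exists_isTame_compl (hD : IsNormalCrossingDivisor n D) (p : X) :
    ∃ C : Opens X, p ∈ C ∧ IsTame Dᶜ C := by
  obtain ⟨k, J, φ, hφ, hk, -⟩ := exists_common_chart hD hD Subset.rfl p
  exact ⟨dom φ, hφ.mem_source, (hk.isZeroSet.isCellular_compl hφ.convex).isTame⟩

theorem exists_isTame_stratum (hD : IsNormalCrossingDivisor n D) (S : Stratum n D) (p : X) :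
    ∃ C : Opens X, p ∈ C ∧ IsTame S.1 C := by
  obtain ⟨k, J, φ, hφ, hk, -⟩ := exists_common_chart hD hD Subset.rfl p
  exact ⟨dom φ, hφ.mem_source, (S.isCellular hD hφ.convex hk.isZeroSet).isTame⟩

end Strata
/-! ## The glued space as a subspace of the endpoint modification of the complement -/

section GluingEmbedding

variable {n : ℕ} {X : Type*} [TopologicalSpace X] [ChartedSpace (EuclideanSpace ℝ (Fin n)) X]
  {D D' : Set X}

theorem orthantMapAt_self {A S : Set X} {p : X} (hp : p ∈ S) (q : FlatEnds A S) :
    orthantMapAt (EndsAt.self hp) q = q.val ⟨p, hp⟩ := by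
  ext U hU : 3
  exact orthantMapAt_comp _ q U hU (mem_connectedComponentIn
    (show p ∈ (U : Set X) ∩ S from ⟨hU, hp⟩))

/-- The map from the disjoint union of the endpoint modifications of the strata to the endpoint
modification of the complement of the divisor. -/
def PreGluing.toEndpoint {Q' : (S : Stratum n D') → Set (OrthantSet D S.1)}
    (z : PreGluing Q') : EndpointModification Dᶜ :=
  EndpointModification.push z.2.2.1 z.2.1

/-- The induced map on the glued space. -/
def Gluing.toEndpoint {Q' : (S : Stratum n D') → Set (OrthantSet D S.1)} :
    Gluing Q' → EndpointModification Dᶜ :=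
  -- A point `(p, e, q)` and its partner `(p, μ(e, q))` have the same image, since the orthant map
  -- of the end of a stratum in its own point is evaluation.
  Quot.lift PreGluing.toEndpoint (by
    rintro _ _ ⟨S, T, hTS, p, e, q, q', h⟩
    refine congrArg (EndpointModification.mk p.1) ?_
    change _ = orthantMapAt (EndsAt.self p.2) q'.1
    rw [orthantMapAt_self, h]
    rfl)

variable {Q' : (S : Stratum n D') → Set (OrthantSet D S.1)}

theorem Gluing.toEndpoint_point (T : Stratum n D') (p : T.1) (q : Q' T) :
    (Gluing.point Q' T p q).toEndpoint = ⟨p.1, q.1.val p⟩ :=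
  congrArg (EndpointModification.mk p.1) (orthantMapAt_self p.2 q.1)

theorem Gluing.pt_toEndpoint (g : Gluing Q') : g.toEndpoint.pt = g.toBase := by
  obtain ⟨z, rfl⟩ := Quot.exists_rep g
  rfl

theorem PreGluing.continuous_toEndpoint :
    Continuous (PreGluing.toEndpoint : PreGluing Q' → EndpointModification Dᶜ) := by
  refine continuous_sigma fun S => ?_
  exact continuous_prod_of_discrete_right.2 fun q => EndpointModification.continuous_push q.1

theorem Gluing.continuous_toEndpoint :
    Continuous (Gluing.toEndpoint : Gluing Q' → EndpointModification Dᶜ) :=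
  continuous_quot_lift _ PreGluing.continuous_toEndpoint

theorem Gluing.continuous_toBase : Continuous (Gluing.toBase : Gluing Q' → X) := by
  have : (Gluing.toBase : Gluing Q' → X) = EndpointModification.pt ∘ Gluing.toEndpoint :=
    funext fun g => g.pt_toEndpoint.symm
  exact this ▸ EndpointModification.continuous_pt.comp continuous_toEndpoint

/-- The choices of orthants for which the glued space embeds into the real-oriented blow-up: they
are stable under the orthant maps, and the strata involved are simply connected. -/
structure IsAdmissible (Q' : (S : Stratum n D') → Set (OrthantSet D S.1)) : Prop where
  orthantMap_mem : ∀ (S T : Stratum n D') (e : FlatEnds S.1 T.1), ∀ q ∈ Q' S, orthantMap e q ∈ Q' T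
  simplyConnected : ∀ S : Stratum n D', (Q' S).Nonempty → ∀ T : Stratum n D',
    (T.1 ∩ closure S.1).Nonempty → SimplyConnectedSpace T.1

variable [IsManifold (𝓡 n) ∞ X]

theorem Stratum.exists_end_val_eq (hD' : IsNormalCrossingDivisor n D') (S T : Stratum n D')
    [SimplyConnectedSpace T.1] (p : T.1) (e : EndsAt S.1 p.1) :
    ∃ e' : FlatEnds S.1 T.1, e'.val p = e := by
  have := T.locallyPathConnectedSpace hD'
  refine FlatEnds.exists_val_eq (fun p hp => ?_) p e
  obtain ⟨k, J, φ, hφ, hk, -⟩ := exists_common_chart hD' hD' Subset.rfl p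
  exact ⟨dom φ, hφ.mem_source, T.isProductNhd hD' hk.isZeroSet hφ.mem_source hφ.centred hp
    Subset.rfl (S.isCellular hD' hφ.convex hk.isZeroSet)⟩

theorem Stratum.exists_orthant_val_eq (hD : IsNormalCrossingDivisor n D)
    (hD' : IsNormalCrossingDivisor n D') (hDD' : D ⊆ D') (T : Stratum n D')
    [SimplyConnectedSpace T.1] (p : T.1) (e : EndsAt Dᶜ p.1) :
    ∃ q : OrthantSet D T.1, q.val p = e := by
  have := T.locallyPathConnectedSpace hD'
  refine FlatEnds.exists_val_eq (fun p hp => ?_) p e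
  obtain ⟨k, J, φ, hφ, hk, hJ, hφJ⟩ := exists_common_chart hD hD' hDD' p
  exact ⟨dom φ, hφ.mem_source, T.isProductNhd hD' hk.isZeroSet hφ.mem_source hφ.centred hp
    hJ (hφJ.isCellular_compl hφ.convex)⟩

theorem OrthantSet.eq_of_val_eq (hD : IsNormalCrossingDivisor n D) {T : Stratum n D'}
    {q q' : OrthantSet D T.1} {p : T.1} (h : q.val p = q'.val p) : q = q' :=
  FlatEnds.eq_of_val_eq T.isConnected.isPreconnected (fun p _ => exists_isTame_compl hD p) h

/-- The boundary of the endpoint modification of a stratum. -/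
theorem bijOn_boundaryMap (hD' : IsNormalCrossingDivisor n D') (S : Stratum n D')
    (hS : ∀ T : Stratum n D', (T.1 ∩ closure S.1).Nonempty → SimplyConnectedSpace T.1) :
    BijOn (boundaryMap n S) univ {x | x.pt ∉ S.1} := by
  refine ⟨?_, ?_, ?_⟩
  · rintro ⟨⟨T, hT⟩, p, e⟩ - hp
    exact hT (Stratum.eq_of_mem hD' p.2 hp)
  · rintro ⟨⟨T, hT⟩, p, e⟩ - ⟨⟨T', hT'⟩, p', e'⟩ - h
    obtain ⟨hp, he⟩ := EndpointModification.mk.inj h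
    obtain ⟨p, hpT⟩ := p
    obtain ⟨p', hpT'⟩ := p'
    obtain rfl : p = p' := hp
    obtain rfl : T = T' := Stratum.eq_of_mem hD' hpT hpT'
    obtain rfl : e = e' := FlatEnds.eq_of_val_eq T.isConnected.isPreconnected
      (fun p _ => exists_isTame_stratum hD' S p) (eq_of_heq he)
    rfl
  · rintro ⟨p, e⟩ hp
    obtain ⟨T, hpT⟩ := exists_stratum hD' p
    have := hS T ⟨p, hpT, e.mem_closure⟩
    obtain ⟨e', he'⟩ := Stratum.exists_end_val_eq hD' S T ⟨p, hpT⟩ e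
    refine ⟨⟨⟨T, ?_⟩, ⟨p, hpT⟩, e'⟩, trivial, congrArg (EndpointModification.mk p) he'⟩
    rintro rfl
    exact hp hpT

/-- The normal form of a point. A boundary point of `Ŝ` lies over another stratum `T`; simple
connectedness extends its end to a family on `T`, so one gluing relation moves it into `T`. -/
theorem Gluing.exists_eq_point (hD' : IsNormalCrossingDivisor n D') (hQ : IsAdmissible Q')
    (g : Gluing Q') : ∃ (T : Stratum n D') (p : T.1) (q : Q' T), g = Gluing.point Q' T p q := by
  obtain ⟨⟨S, ⟨p, e⟩, q⟩, rfl⟩ := Quot.exists_rep g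
  obtain ⟨T, hpT⟩ := exists_stratum hD' p
  by_cases hTS : T = S
  · subst hTS
    obtain ⟨C, hpC, hC⟩ := exists_isTame_stratum hD' T p
    obtain rfl := hC.eq_self hpC hpT e
    exact ⟨T, ⟨p, hpT⟩, q, rfl⟩
  · have := hQ.simplyConnected S ⟨q.1, q.2⟩ T ⟨p, hpT, e.mem_closure⟩
    obtain ⟨e', rfl⟩ := Stratum.exists_end_val_eq hD' S T ⟨p, hpT⟩ e
    exact ⟨T, ⟨p, hpT⟩, ⟨orthantMap e' q.1, hQ.orthantMap_mem S T e' q.1 q.2⟩,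
      Quot.sound (.glue S T hTS ⟨p, hpT⟩ e' q _ rfl)⟩

/-- In normal form the image is `(p, q(p))`. It determines `p`, hence the stratum, and then `q`,
because a locally constant family on a connected stratum is determined by one value. -/
theorem Gluing.toEndpoint_injective (hD : IsNormalCrossingDivisor n D)
    (hD' : IsNormalCrossingDivisor n D') (hQ : IsAdmissible Q') :
    Function.Injective (Gluing.toEndpoint : Gluing Q' → EndpointModification Dᶜ) := by
  intro g g' h
  obtain ⟨T, p, q, rfl⟩ := g.exists_eq_point hD' hQ
  obtain ⟨T', p', q', rfl⟩ := g'.exists_eq_point hD' hQ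
  rw [toEndpoint_point, toEndpoint_point] at h
  obtain ⟨hp, he⟩ := EndpointModification.mk.inj h
  obtain ⟨p, hpT⟩ := p
  obtain ⟨p', hpT'⟩ := p'
  obtain rfl : p = p' := hp
  obtain rfl : T = T' := Stratum.eq_of_mem hD' hpT hpT'
  obtain rfl : q = q' := Subtype.ext (OrthantSet.eq_of_val_eq hD (eq_of_heq he))
  rfl

theorem Gluing.range_toEndpoint (hD' : IsNormalCrossingDivisor n D') (hQ : IsAdmissible Q') :
    range (Gluing.toEndpoint : Gluing Q' → EndpointModification Dᶜ) =
      {b | ∃ (T : Stratum n D') (p : T.1) (q : Q' T), (⟨p.1, q.1.val p⟩ : EndpointModification Dᶜ)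
        = b} := by
  ext b
  constructor
  · rintro ⟨g, rfl⟩
    obtain ⟨T, p, q, rfl⟩ := g.exists_eq_point hD' hQ
    exact ⟨T, p, q, (toEndpoint_point T p q).symm⟩
  · rintro ⟨T, p, q, rfl⟩
    exact ⟨_, toEndpoint_point T p q⟩

/-- A chart around the base point of the limit has finitely many cells, so an ultrafilter with
convergent image concentrates on one cell and one orthant. These fix the stratum and the sheet, and
convergence in the base then gives convergence upstairs. -/
theorem PreGluing.isProperMap_toEndpoint [T2Space X] (hD : IsNormalCrossingDivisor n D)
    (hD' : IsNormalCrossingDivisor n D') (hDD' : D ⊆ D') :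
    IsProperMap (PreGluing.toEndpoint : PreGluing Q' → EndpointModification Dᶜ) := by
  refine isProperMap_iff_ultrafilter.2 ⟨continuous_toEndpoint, fun 𝒰 b hb => ?_⟩
  obtain ⟨k, J, φ, hφ, hk, hJ, hφJ⟩ := exists_common_chart hD hD' hDD' b.pt
  have hcD := hφJ.isCellular_compl hφ.convex
  have hbC : b.pt ∈ dom φ := hφ.mem_source
  let P : (Fin n → SignType) → Set (PreGluing Q') := fun σ => {z | ∃ h : z.2.1.pt ∈ dom φ,
    z.2.1.toEnd.comp (dom φ) h = cell φ (firstIdx n k) σ ∧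
    (toEndpoint z).toEnd.comp (dom φ) h = b.toEnd.comp (dom φ) hbC}
  have hP : (⋃ σ ∈ (univ : Set (Fin n → SignType)), P σ) ∈ 𝒰 := by
    filter_upwards [hb.eventually ((EndpointModification.isOpen_sheet (dom φ) _).mem_nhds
      (b.mem_sheet_self hbC))] with z hz
    obtain ⟨hzC, hzK⟩ := hz
    obtain ⟨σ, hσ, -, he⟩ := (z.1.isCellular hD' hφ.convex hk.isZeroSet).exists_comp_eq_cell
      hzC z.2.1.toEnd
    exact mem_iUnion₂.2 ⟨σ, trivial, hzC, he, hzK⟩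
  obtain ⟨σ, -, hσ⟩ := (Ultrafilter.finite_biUnion_mem_iff finite_univ).1 hP
  obtain ⟨⟨S, x₀, q⟩, hx₀, he₀, hK₀⟩ := 𝒰.nonempty_of_mem hσ
  have hcS := S.isCellular hD' hφ.convex hk.isZeroSet
  -- All of `P σ` lies in a single summand `Ŝ × {q}`: a point of the cell determines the stratum,
  -- and the orthant near that point determines `q`.
  have huniq : ∀ z ∈ P σ, ∃ x : EndpointModification S.1, z = ⟨S, x, q⟩ ∧
      ∃ h : x.pt ∈ dom φ, x.toEnd.comp (dom φ) h = cell φ (firstIdx n k) σ := by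
    rintro ⟨S', x, q'⟩ ⟨hx, he, hK⟩
    obtain ⟨y, hy⟩ := x.toEnd.comp_nonempty (dom φ) hx
    have hy₀ : y ∈ x₀.toEnd.comp (dom φ) hx₀ := he₀ ▸ he ▸ hy
    obtain rfl : S' = S := Stratum.eq_of_mem hD' (x.toEnd.comp_subset _ _ hy).2
      (x₀.toEnd.comp_subset _ _ hy₀).2
    obtain rfl : q' = q := by
      refine Subtype.ext (OrthantSet.eq_of_val_eq hD (p := ⟨y, (x.toEnd.comp_subset _ _ hy).2⟩)
        (hcD.isTame.end_ext (x.toEnd.comp_subset _ _ hy).1 ?_))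
      rw [← orthantMapAt_comp x.toEnd q'.1 (dom φ) hx hy,
        ← orthantMapAt_comp x₀.toEnd q.1 (dom φ) hx₀ hy₀]
      exact hK.trans hK₀.symm
    exact ⟨x, rfl, hx, he⟩
  have hpt : Tendsto (fun z : PreGluing Q' => z.2.1.pt) 𝒰 (𝓝 b.pt) :=
    (EndpointModification.continuous_pt.tendsto b).comp hb
  have hcl : b.pt ∈ closure (cell φ (firstIdx n k) σ) := by
    rw [← closure_closure]
    refine mem_closure_of_tendsto hpt ?_
    filter_upwards [hσ] with z hz
    obtain ⟨hz, he, -⟩ := hz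
    rw [← he]
    exact z.2.1.toEnd.mem_closure_comp _ _
  obtain ⟨y, hy, hyN⟩ := x₀.toEnd.isComp (dom φ) hx₀
  rw [← he₀, hyN] at hcl
  -- The limit is the end of `S` at `b.pt` given by the cell of `σ`, to which `b.pt` is adherent.
  obtain ⟨e, he⟩ := hcS.isTame.exists_end hbC hy hcl
  rw [← hyN, he₀] at he
  have hlim : (𝒰 : Filter (PreGluing Q')) ≤ 𝓝 ⟨S, ⟨b.pt, e⟩, q⟩ := by
    have hj : Continuous fun x : EndpointModification S.1 => (⟨S, x, q⟩ : PreGluing Q') :=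
      continuous_sigmaMk.comp (Continuous.prodMk_left q)
    refine le_trans ?_ (hj.tendsto ⟨b.pt, e⟩)
    intro V hV
    rw [mem_map, EndpointModification.nhds_eq_of_isTame hcS.isTame _
      (show (EndpointModification.mk b.pt e).pt ∈ dom φ from hbC), mem_inf_principal,
      mem_comap] at hV
    obtain ⟨W, hW, hWV⟩ := hV
    filter_upwards [hσ, hpt.eventually hW] with z hz hzW
    obtain ⟨x, rfl, hx, hxe⟩ := huniq z hz
    exact hWV hzW ⟨hx, hxe.trans he.symm⟩
  exact ⟨_, tendsto_nhds_unique ((continuous_toEndpoint.tendsto _).mono_left hlim) hb, hlim⟩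

/-- The glued space is a closed subspace of the endpoint modification of the complement. -/
theorem Gluing.isClosedEmbedding_toEndpoint [T2Space X] (hD : IsNormalCrossingDivisor n D)
    (hD' : IsNormalCrossingDivisor n D') (hDD' : D ⊆ D') (hQ : IsAdmissible Q') :
    IsClosedEmbedding (Gluing.toEndpoint : Gluing Q' → EndpointModification Dᶜ) := by
  refine .of_continuous_injective_isClosedMap continuous_toEndpoint
    (toEndpoint_injective hD hD' hQ) fun F hF => ?_
  have : Gluing.toEndpoint '' F = PreGluing.toEndpoint '' (Quot.mk _ ⁻¹' F) := by
    ext b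
    constructor
    · rintro ⟨g, hg, rfl⟩
      obtain ⟨z, rfl⟩ := Quot.exists_rep g
      exact ⟨z, hg, rfl⟩
    · rintro ⟨z, hz, rfl⟩
      exact ⟨_, hz, rfl⟩
  rw [this]
  exact (PreGluing.isProperMap_toEndpoint hD hD' hDD').isClosedMap _
    (hF.preimage continuous_quot_mk)

end GluingEmbedding
/-! ## The endpoint modification of the complement is the real-oriented blow-up -/

section OrthantCoords

variable {n : ℕ} {X : Type*} [TopologicalSpace X]
  {φ : OpenPartialHomeomorph X (EuclideanSpace ℝ (Fin n))} {J : Finset (Fin n)}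

/-- A space over the chart domain of `φ` is the disjoint union of the closed orthants with respect
to the coordinates with index in `J`. -/
def HasOrthantCoords (φ : OpenPartialHomeomorph X (EuclideanSpace ℝ (Fin n))) (J : Finset (Fin n))
    {Y : Type*} [TopologicalSpace Y] (a : Y → φ.source) : Prop :=
  ∃ s : Y → Fin n → SignType, IsEmbedding (fun y => (a y, s y)) ∧
    range (fun y => (a y, s y)) = {w | w.2 ∈ orthants J ∧ IsFace (sgn J (φ w.1)) w.2}

/-- Both spaces are embedded in `φ.source × (Fin n → SignType)` with the same image. -/
theorem HasOrthantCoords.exists_homeomorph {Y Z : Type*} [TopologicalSpace Y] [TopologicalSpace Z]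
    {a : Y → φ.source} {b : Z → φ.source} (ha : HasOrthantCoords φ J a)
    (hb : HasOrthantCoords φ J b) : ∃ h : Y ≃ₜ Z, ∀ y, b (h y) = a y := by
  obtain ⟨s, hs, hsr⟩ := ha
  obtain ⟨t, ht, htr⟩ := hb
  let h := (hs.toHomeomorph.trans (Homeomorph.setCongr (hsr.trans htr.symm))).trans
    ht.toHomeomorph.symm
  refine ⟨h, fun y => ?_⟩
  have h1 : ht.toHomeomorph (h y) = Homeomorph.setCongr (hsr.trans htr.symm) (hs.toHomeomorph y) :=
    Homeomorph.apply_symm_apply _ _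
  exact congrArg (fun w => w.1.1) h1

/-- An end corresponds to the sign vector of its cell, and the neighbourhood filter is that of the
base restricted to a constant sign vector. -/
theorem EndpointModification.hasOrthantCoords {A : Set X} (hA : IsCellular φ J (orthants J) A) :
    HasOrthantCoords φ J
      (fun y : {y : EndpointModification A // y.pt ∈ φ.source} => ⟨y.1.pt, y.2⟩) := by
  choose s hs hface hcomp using fun y : {y : EndpointModification A // y.pt ∈ φ.source} =>
    hA.exists_comp_eq_cell (p := y.1.pt) y.2 y.1.toEnd
  refine ⟨s, ⟨isInducing_iff_nhds.2 fun y => ?_, ?_⟩, ?_⟩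
  · have h1 : 𝓝 y = comap Subtype.val (𝓝 y.1) := nhds_induced _ _
    have h2 : 𝓝 (⟨y.1.pt, y.2⟩ : φ.source) = comap Subtype.val (𝓝 y.1.pt) := nhds_induced _ _
    rw [h1, nhds_eq_of_isTame hA.isTame y.1 y.2, comap_inf, comap_comap, comap_principal,
      nhds_prod_eq, nhds_discrete (Fin n → SignType), h2, comap_prod, comap_comap]
    congr 1
    change _ = comap s (pure (s y))
    rw [← principal_singleton, comap_principal]
    congr 1
    ext z
    constructor
    · rintro ⟨hz, hzK⟩
      exact hA.cell_injOn z.2 (hs z) (hface z) ((hcomp z).symm.trans (hzK.trans (hcomp y)))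
    · intro hz
      exact ⟨z.2, (hcomp z).trans ((congrArg _ hz).trans (hcomp y).symm)⟩
  · rintro ⟨⟨p, e⟩, hp⟩ ⟨⟨p', e'⟩, hp'⟩ h
    obtain ⟨h1, h2⟩ := Prod.mk.inj h
    obtain rfl : p = p' := congrArg Subtype.val h1
    obtain rfl : e = e' := hA.isTame.end_ext (C := dom φ) hp
      ((hcomp ⟨⟨p, e⟩, hp⟩).trans ((congrArg _ h2).trans (hcomp ⟨⟨p, e'⟩, hp⟩).symm))
    rfl
  · ext ⟨⟨p, hp⟩, σ⟩
    constructor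
    · rintro ⟨y, h⟩
      obtain ⟨h1, rfl⟩ := Prod.mk.inj h
      obtain rfl : y.1.pt = p := congrArg Subtype.val h1
      exact ⟨hs y, hface y⟩
    · rintro ⟨hσ, hpσ⟩
      obtain ⟨e, he⟩ := hA.exists_end (p := p) hp hσ hpσ
      refine ⟨⟨⟨p, e⟩, hp⟩, Prod.ext rfl ?_⟩
      exact (hA.cell_injOn hp hσ hpσ (he.symm.trans (hcomp ⟨⟨p, e⟩, hp⟩))).symm

end OrthantCoords

/-! ### Orthant coordinates on the local model -/

section LocalModels

variable {n k : ℕ}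

/-- The sign vector of the orthant of the local model that contains a given point. -/
def LocalModel.signs (z : LocalModel n k) : Fin n → SignType := fun i =>
  if h : i.val < k then Sum.elim (fun _ => -1) (fun _ => 1) (z.1 ⟨i, h⟩) else 0

/-- The point of the local model with given coordinates in a given orthant. -/
def LocalModel.mkOfSigns (w : EuclideanSpace ℝ (Fin n) × (Fin n → SignType)) : LocalModel n k :=
  -- Truncating with `min` and `max` makes the map continuous and defined everywhere; on the image
  -- of the local model it changes nothing, so the map is a left inverse there.
  (fun i => if w.2 i.1 = -1 then Sum.inl ⟨min (w.1 i.1) 0, mem_Iic.2 (min_le_right _ _)⟩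
    else Sum.inr ⟨max (w.1 i.1) 0, mem_Ici.2 (le_max_right _ _)⟩, fun i => w.1 i.1)

theorem LocalModel.continuous_blowDown :
    Continuous (LocalModel.blowDown : LocalModel n k → EuclideanSpace ℝ (Fin n)) := by
  have hs : Continuous SplitLine.toReal :=
    continuous_subtype_val.sumElim continuous_subtype_val
  refine (PiLp.continuous_toLp 2 _).comp (continuous_pi fun i => ?_)
  by_cases h : i.val < k
  · simp only [h, dif_pos]
    fun_prop
  · simp only [h, dif_neg, not_false_iff]
    fun_prop

theorem LocalModel.continuous_signs :
    Continuous (LocalModel.signs : LocalModel n k → Fin n → SignType) := by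
  refine continuous_pi fun i => ?_
  by_cases h : i.val < k
  · simp only [LocalModel.signs, h, dif_pos]
    exact (Continuous.sumElim continuous_const continuous_const).comp
      ((continuous_apply _).comp continuous_fst)
  · simp only [LocalModel.signs, h, dif_neg, not_false_iff]
    exact continuous_const

theorem LocalModel.continuous_mkOfSigns :
    Continuous (LocalModel.mkOfSigns : _ → LocalModel n k) := by
  refine continuous_prod_of_discrete_right.2 fun σ => ?_
  refine Continuous.prodMk (continuous_pi fun i => ?_) (continuous_pi fun i => ?_)
  · by_cases h : σ i.1 = -1
    · simp only [h, if_true]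
      refine continuous_inl.comp (Continuous.subtype_mk ?_ _)
      fun_prop
    · simp only [h, if_false]
      refine continuous_inr.comp (Continuous.subtype_mk ?_ _)
      fun_prop
  · fun_prop

theorem LocalModel.blowDown_of_lt (z : LocalModel n k) {i : Fin n} (h : i.val < k) :
    z.blowDown i = (z.1 ⟨i, h⟩).toReal := by
  simp [LocalModel.blowDown, h]

theorem LocalModel.blowDown_of_not_lt (z : LocalModel n k) {i : Fin n} (h : ¬ i.val < k) :
    z.blowDown i = z.2 ⟨i, h⟩ := by
  simp [LocalModel.blowDown, h]

theorem SplitLine.eq_of_toReal_eq (t : SplitLine) {y : ℝ} {σ : SignType} (hy : y = t.toReal)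
    (hσ : σ = Sum.elim (fun _ => -1) (fun _ => 1) t) :
    (if σ = -1 then Sum.inl ⟨min y 0, mem_Iic.2 (min_le_right _ _)⟩
      else Sum.inr ⟨max y 0, mem_Ici.2 (le_max_right _ _)⟩ : SplitLine) = t := by
  subst hy hσ
  rcases t with t | t
  · exact (if_pos rfl).trans (congrArg Sum.inl (Subtype.ext (min_eq_left t.2)))
  · exact (if_neg (by decide : ¬ (1 : SignType) = -1)).trans
      (congrArg Sum.inr (Subtype.ext (max_eq_left t.2)))

theorem LocalModel.mkOfSigns_signs (z : LocalModel n k) :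
    LocalModel.mkOfSigns (z.blowDown, z.signs) = z := by
  refine Prod.ext (funext fun i => ?_) (funext fun i => ?_)
  · have h1 : z.blowDown i.1 = (z.1 i).toReal := z.blowDown_of_lt i.2
    have h2 : z.signs i.1 = Sum.elim (fun _ => -1) (fun _ => 1) (z.1 i) := dif_pos i.2
    exact SplitLine.eq_of_toReal_eq (z.1 i) h1 h2
  · exact z.blowDown_of_not_lt i.2

theorem LocalModel.isEmbedding :
    IsEmbedding fun z : LocalModel n k => (z.blowDown, z.signs) :=
  Function.LeftInverse.isEmbedding (f := LocalModel.mkOfSigns) LocalModel.mkOfSigns_signs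
    LocalModel.continuous_mkOfSigns
    (LocalModel.continuous_blowDown.prodMk LocalModel.continuous_signs)

theorem LocalModel.signs_mem_orthants (z : LocalModel n k) :
    z.signs ∈ orthants (firstIdx n k) := by
  intro i
  rw [mem_firstIdx]
  by_cases h : i.val < k
  · simp only [LocalModel.signs, h, dif_pos, iff_true]
    cases z.1 ⟨i, h⟩ <;> simp
  · simp [LocalModel.signs, h]

theorem LocalModel.isFace_signs (z : LocalModel n k) :
    IsFace (sgn (firstIdx n k) z.blowDown) z.signs := by
  intro i
  by_cases h : i.val < k
  · rw [sgn_of_mem (mem_firstIdx.2 h), z.blowDown_of_lt h, Ne, sign_eq_zero_iff]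
    simp only [LocalModel.signs, h, dif_pos]
    rcases z.1 ⟨i, h⟩ with t | t
    · intro ht
      exact (sign_neg (lt_of_le_of_ne t.2 ht)).symm
    · intro ht
      exact (sign_pos (lt_of_le_of_ne t.2 (Ne.symm ht))).symm
  · intro h'
    exact (h' (sgn_of_notMem fun hi => h (mem_firstIdx.1 hi))).elim

theorem LocalModel.exists_eq {y : EuclideanSpace ℝ (Fin n)} {σ : Fin n → SignType}
    (hσ : σ ∈ orthants (firstIdx n k)) (hy : IsFace (sgn (firstIdx n k) y) σ) :
    ∃ z : LocalModel n k, z.blowDown = y ∧ z.signs = σ := by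
  have hy' : ∀ i : Fin n, i.val < k → y i ≠ 0 → σ i = SignType.sign (y i) := fun i hi h0 => by
    have := hy i
    rw [sgn_of_mem (mem_firstIdx.2 hi), Ne, sign_eq_zero_iff] at this
    exact this h0
  refine ⟨LocalModel.mkOfSigns (y, σ), ?_, funext fun i => ?_⟩
  · ext i
    by_cases h : i.val < k
    · rw [LocalModel.blowDown_of_lt _ h]
      simp only [LocalModel.mkOfSigns]
      split_ifs with hs
      · refine min_eq_left ?_
        by_contra! hlt
        rw [hy' i h hlt.ne', sign_pos hlt] at hs
        exact absurd hs (by decide)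
      · refine max_eq_left ?_
        by_contra! hlt
        rw [hy' i h hlt.ne, sign_neg hlt] at hs
        exact hs rfl
    · rw [LocalModel.blowDown_of_not_lt _ h]
      rfl
  · by_cases h : i.val < k
    · simp only [LocalModel.signs, h, dif_pos, LocalModel.mkOfSigns]
      have hne := (hσ i).2 (mem_firstIdx.2 h)
      obtain h1 | h1 | h1 := (σ i).trichotomy
      · simp [h1]
      · exact (hne h1).elim
      · have : ¬ (1 : SignType) = -1 := by decide
        simp [h1, this]
    · simp only [LocalModel.signs, h, dif_neg, not_false_iff]
      by_contra hne
      exact h (mem_firstIdx.1 ((hσ i).1 (Ne.symm hne)))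

/-- Spaces isomorphic to an open part of the local model have orthant coordinates. -/
theorem hasOrthantCoords_of_isEmbedding {X Y : Type*} [TopologicalSpace X] [TopologicalSpace Y]
    {φ : OpenPartialHomeomorph X (EuclideanSpace ℝ (Fin n))} {a : Y → φ.source}
    (ha : Continuous a) {Ψ : Y → LocalModel n k} (hΨ : IsEmbedding Ψ)
    (hΨa : ∀ y, (Ψ y).blowDown = φ (a y)) (hr : ∀ z, z.blowDown ∈ φ.target → z ∈ range Ψ) :
    HasOrthantCoords φ (firstIdx n k) a := by
  refine ⟨fun y => (Ψ y).signs, ?_, ?_⟩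
  · let g : φ.source × (Fin n → SignType) → EuclideanSpace ℝ (Fin n) × (Fin n → SignType) :=
      fun w => (φ w.1, w.2)
    have hg : Continuous g := by
      have : Continuous fun x : φ.source => φ x :=
        continuousOn_iff_continuous_domRestrict.1 φ.continuousOn
      exact (this.comp continuous_fst).prodMk continuous_snd
    refine IsEmbedding.of_comp (ha.prodMk (LocalModel.continuous_signs.comp hΨ.continuous)) hg ?_
    have : (g ∘ fun y => (a y, (Ψ y).signs)) =
        (fun z : LocalModel n k => (z.blowDown, z.signs)) ∘ Ψ := by
      funext y
      simp [g, hΨa]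
    rw [this]
    exact LocalModel.isEmbedding.comp hΨ
  · ext ⟨x, σ⟩
    constructor
    · rintro ⟨y, h⟩
      obtain ⟨rfl, rfl⟩ := Prod.mk.inj h
      exact ⟨(Ψ y).signs_mem_orthants, hΨa y ▸ (Ψ y).isFace_signs⟩
    · rintro ⟨hσ, hxσ⟩
      obtain ⟨z, hz, rfl⟩ := LocalModel.exists_eq hσ hxσ
      obtain ⟨y, rfl⟩ := hr z (hz ▸ φ.map_source x.2)
      refine ⟨y, Prod.ext (Subtype.ext ?_) rfl⟩
      exact φ.injOn (a y).2 x.2 ((hΨa y).symm.trans hz)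

end LocalModels

/-! ### Real-oriented blow-ups in terms of orthant coordinates -/

section BlowUps

variable {n : ℕ} {X : Type*} [TopologicalSpace X] [ChartedSpace (EuclideanSpace ℝ (Fin n)) X]
  {D : Set X}

theorem IsRealOrientedBlowUp.exists_hasOrthantCoords {B : Type*} [TopologicalSpace B] {α : B → X}
    (hα : IsRealOrientedBlowUp n D α) (p : X) :
    ∃ (k : ℕ) (φ : OpenPartialHomeomorph X (EuclideanSpace ℝ (Fin n))),
      IsCubeChart p φ ∧ IsNCChart D k p φ ∧ HasOrthantCoords φ (firstIdx n k)
        (fun y : {y : B // α y ∈ φ.source} => ⟨α y.1, y.2⟩) := by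
  obtain ⟨k, φ, hφ, Ψ, hΨ⟩ := hα.2 p
  obtain ⟨ψ, hψ, hs, he⟩ := exists_isCubeChart_subset hφ.smooth hφ.mem_source hφ.centred univ_mem
  have hs' : ψ.source ⊆ φ.source := hs.trans inter_subset_left
  have hNC := hφ.restrict hψ hs' he
  have ht : ψ.target ⊆ φ.target := by
    intro y hy
    have := φ.map_source (hs' (ψ.map_target hy))
    rwa [← he, ψ.right_inv hy] at this
  refine ⟨k, ψ, hψ, hNC, ?_⟩
  refine hasOrthantCoords_of_isEmbedding (Ψ := fun y => (Ψ ⟨y.1, hs' y.2⟩).1)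
    ((hα.1.comp continuous_subtype_val).subtype_mk _) ?_ (fun y => by rw [hΨ, he]) fun z hz => ?_
  · have h1 : IsEmbedding (fun y : {y : B // α y ∈ ψ.source} =>
        (⟨y.1, hs' y.2⟩ : {y : B // α y ∈ φ.source})) :=
      IsEmbedding.inclusion (s := {y | α y ∈ ψ.source}) (t := {y | α y ∈ φ.source})
        fun y hy => hs' hy
    exact IsEmbedding.subtypeVal.comp (Ψ.isEmbedding.comp h1)
  · let w := Ψ.symm ⟨z, ht hz⟩
    have hw : Ψ w = ⟨z, ht hz⟩ := Ψ.apply_symm_apply _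
    -- The two charts have the same coordinate functions, so the point of `φ.source` with
    -- coordinates in the smaller cube is the one that `ψ` parametrises.
    have hαw : α w.1 ∈ ψ.source := by
      have h1 : φ (α w.1) = z.blowDown := by rw [← hΨ, hw]
      have h2 : φ.symm z.blowDown = α w.1 := by rw [← h1, φ.left_inv w.2]
      have h3 := ψ.map_target hz
      have h4 : φ (ψ.symm z.blowDown) = z.blowDown := by rw [← he, ψ.right_inv hz]
      rw [← h4, φ.left_inv (hs' h3)] at h2
      exact h2 ▸ h3
    exact ⟨⟨w.1, hαw⟩, congrArg Subtype.val hw⟩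

theorem isRealOrientedBlowUp_of_hasOrthantCoords {B : Type*} [TopologicalSpace B] {α : B → X}
    (hα : Continuous α) (h : ∀ p : X,
      ∃ (k : ℕ) (φ : OpenPartialHomeomorph X (EuclideanSpace ℝ (Fin n))),
      IsNCChart D k p φ ∧ HasOrthantCoords φ (firstIdx n k)
        (fun y : {y : B // α y ∈ φ.source} => ⟨α y.1, y.2⟩)) : IsRealOrientedBlowUp n D α := by
  refine ⟨hα, fun p => ?_⟩
  obtain ⟨k, φ, hφ, hc⟩ := h p
  refine ⟨k, φ, hφ, ?_⟩
  have hc' : HasOrthantCoords φ (firstIdx n k)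
      (fun z : {z : LocalModel n k // z.blowDown ∈ φ.target} =>
        (⟨φ.symm z.1.blowDown, φ.map_target z.2⟩ : φ.source)) := by
    refine hasOrthantCoords_of_isEmbedding (Ψ := Subtype.val) ?_ IsEmbedding.subtypeVal
      (fun y => (φ.right_inv y.2).symm) fun z hz => ⟨⟨z, hz⟩, rfl⟩
    refine Continuous.subtype_mk ?_ _
    exact φ.continuousOn_symm.comp_continuous
      (LocalModel.continuous_blowDown.comp continuous_subtype_val) fun z => z.2
  obtain ⟨Ψ, hΨ⟩ := hc.exists_homeomorph hc'
  refine ⟨Ψ, fun y => ?_⟩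
  have := congrArg (fun x : φ.source => φ x) (hΨ y)
  simpa [φ.right_inv (Ψ y).2] using this

variable [IsManifold (𝓡 n) ∞ X]

/-- The endpoint modification of the complement of a normal crossing divisor is the real-oriented
blow-up. -/
theorem EndpointModification.isRealOrientedBlowUp (hD : IsNormalCrossingDivisor n D) :
    IsRealOrientedBlowUp n D (EndpointModification.pt : EndpointModification Dᶜ → X) := by
  refine isRealOrientedBlowUp_of_hasOrthantCoords continuous_pt fun p => ?_
  obtain ⟨k, J, φ, hφ, hk, -⟩ := exists_common_chart hD hD Subset.rfl p
  exact ⟨k, φ, hk, hasOrthantCoords (hk.isZeroSet.isCellular_compl hφ.convex)⟩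

end BlowUps
-- Uniqueness of the blow-up over the base
section Uniqueness

/-- Adherence to the preimage of a subset of the base is local and is respected by homeomorphisms
over the base. It is the invariant by which local identifications of two blow-ups are compared. -/
theorem mem_closure_preimage_of_homeomorph {X Y Z : Type*} [TopologicalSpace X]
    [TopologicalSpace Y] [TopologicalSpace Z] {a : Y → X} {b : Z → X} (ha : Continuous a) {C : Set X}
    (hC : IsOpen C) (h : {y // a y ∈ C} ≃ₜ {z // b z ∈ C}) (hh : ∀ y, b (h y).1 = a y.1) {K : Set X}
    {y : {y // a y ∈ C}} (hy : y.1 ∈ closure (a ⁻¹' K)) : (h y).1 ∈ closure (b ⁻¹' K) := by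
  rw [mem_closure_iff] at hy ⊢
  intro O hO hyO
  have hopen : IsOpen (Subtype.val '' (h ⁻¹' (Subtype.val ⁻¹' O)) : Set Y) :=
    (hC.preimage ha).isOpenMap_subtype_val _ ((hO.preimage continuous_subtype_val).preimage
      h.continuous)
  obtain ⟨_, ⟨y', hy'O, rfl⟩, hy'K⟩ := hy _ hopen ⟨y, hyO, rfl⟩
  refine ⟨(h y').1, hy'O, ?_⟩
  rw [mem_preimage, hh]
  exact hy'K

theorem continuous_of_forall_exists_isOpen {Y Z : Type*} [TopologicalSpace Y] [TopologicalSpace Z]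
    {f : Y → Z} (h : ∀ y, ∃ O : Set Y, IsOpen O ∧ y ∈ O ∧ Continuous (O.domRestrict f)) :
    Continuous f := by
  refine continuous_iff_continuousAt.2 fun y => ?_
  obtain ⟨O, hO, hyO, hc⟩ := h y
  exact (continuousOn_iff_continuous_domRestrict.2 hc).continuousAt (hO.mem_nhds hyO)

variable {n : ℕ} {X : Type*} [TopologicalSpace X] [ChartedSpace (EuclideanSpace ℝ (Fin n)) X]
  [IsManifold (𝓡 n) ∞ X] {D : Set X} {B : Type*} [TopologicalSpace B] {α : B → X}

/-- Any model of the real-oriented blow-up is homeomorphic to the endpoint modification of the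
complement, over the base. -/
theorem IsRealOrientedBlowUp.exists_homeomorph (hD : IsNormalCrossingDivisor n D)
    (hα : IsRealOrientedBlowUp n D α) :
    ∃ Φ : EndpointModification Dᶜ ≃ₜ B, ∀ x, α (Φ x) = x.pt := by
  have hloc : ∀ p : X, ∃ C : Set X, IsOpen C ∧ p ∈ C ∧
      ∃ h : {x : EndpointModification Dᶜ // x.pt ∈ C} ≃ₜ {b // α b ∈ C},
        ∀ x, α (h x).1 = x.1.pt := by
    intro p
    obtain ⟨k, φ, hφ, hk, hc⟩ := hα.exists_hasOrthantCoords p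
    obtain ⟨h, hh⟩ := (EndpointModification.hasOrthantCoords
      (hk.isZeroSet.isCellular_compl hφ.convex)).exists_homeomorph hc
    exact ⟨φ.source, φ.open_source, hφ.mem_source, h, fun x => congrArg Subtype.val (hh x)⟩
  choose C hC hpC h hh using hloc
  have hh' : ∀ p b, ((h p).symm b).1.pt = α b.1 := fun p b => by
    rw [← hh, (h p).apply_symm_apply]
  -- A point of the blow-up knows its orthant through the closures containing it. This forces the
  -- local homeomorphisms to agree on overlaps.
  have hcl : ∀ p (x : {x : EndpointModification Dᶜ // x.pt ∈ C p}) (y : EndpointModification Dᶜ),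
      y.pt = x.1.pt → (∀ (U : Opens X) (hU : y.pt ∈ U),
        (h p x).1 ∈ closure (α ⁻¹' (y.toEnd.comp U hU))) → y = x.1 := by
    rintro p ⟨⟨q, e⟩, hq⟩ ⟨q', e'⟩ hy hcl
    obtain rfl : q' = q := hy
    refine congrArg (EndpointModification.mk q') (EndsAt.ext (funext fun U => funext fun hU => ?_))
    have h1 := mem_closure_preimage_of_homeomorph hα.1 (hC p) (h p).symm (hh' p) (hcl U hU)
    rw [(h p).symm_apply_apply] at h1
    obtain ⟨z, hz⟩ := e'.comp_nonempty U hU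
    change _ ∈ closure (_ ⁻¹' e'.comp U hU) at h1
    rw [e'.comp_eq_connectedComponentIn hz] at h1 ⊢
    exact (EndpointModification.comp_eq_of_mem_closure (exists_isTame_compl hD) ⟨q', e⟩ hU h1).symm
  have hmem : ∀ p (x : {x : EndpointModification Dᶜ // x.pt ∈ C p}) (U : Opens X)
      (hU : x.1.pt ∈ U), (h p x).1 ∈ closure (α ⁻¹' (x.1.toEnd.comp U hU)) := fun p x U hU =>
    mem_closure_preimage_of_homeomorph EndpointModification.continuous_pt (hC p) (h p) (hh p)
      (x.1.mem_closure_preimage_comp U hU)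
  -- At each point the local homeomorphism chosen at its base point is used; `hF` and `hG` show that
  -- any other one gives the same value, whence continuity.
  let F : B → EndpointModification Dᶜ := fun b => ((h (α b)).symm ⟨b, hpC (α b)⟩).1
  have hF : ∀ p (b : {b // α b ∈ C p}), F b.1 = ((h p).symm b).1 := by
    intro p b
    have hpt : (F b.1).pt = ((h p).symm b).1.pt := by rw [hh', hh']
    refine hcl p _ _ hpt fun U hU => ?_
    rw [(h p).apply_symm_apply]
    have := hmem (α b.1) ((h (α b.1)).symm ⟨b.1, hpC _⟩) U hU
    rwa [(h (α b.1)).apply_symm_apply] at this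
  have hFpt : ∀ b, (F b).pt = α b := fun b => hh' _ _
  let G : EndpointModification Dᶜ → B := fun x => (h x.pt ⟨x, hpC x.pt⟩).1
  have hGpt : ∀ x, α (G x) = x.pt := fun x => hh _ _
  have hFG : ∀ x, F (G x) = x := fun x => by
    rw [hF x.pt (h x.pt ⟨x, hpC x.pt⟩), (h x.pt).symm_apply_apply]
  have hG : ∀ p (x : {x : EndpointModification Dᶜ // x.pt ∈ C p}), G x.1 = (h p x).1 := by
    intro p x
    have h1 : α (G x.1) ∈ C p := by rw [hGpt]; exact x.2
    have h2 := hF p ⟨G x.1, h1⟩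
    rw [hFG] at h2
    have h3 : x = (h p).symm ⟨G x.1, h1⟩ := Subtype.ext h2
    have h4 := congrArg (h p) h3
    rw [(h p).apply_symm_apply] at h4
    exact (congrArg Subtype.val h4).symm
  have hGF : ∀ b, G (F b) = b := fun b => by
    have := hG (α b) ((h (α b)).symm ⟨b, hpC _⟩)
    rw [(h (α b)).apply_symm_apply] at this
    exact this
  refine ⟨⟨⟨G, F, hFG, hGF⟩, continuous_of_forall_exists_isOpen fun x => ?_,
    continuous_of_forall_exists_isOpen fun b => ?_⟩, hGpt⟩
  · refine ⟨_, (hC x.pt).preimage EndpointModification.continuous_pt, hpC x.pt, ?_⟩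
    have : (EndpointModification.pt ⁻¹' C x.pt).domRestrict G = fun y => (h x.pt y).1 :=
      funext fun y => hG x.pt y
    change Continuous ((EndpointModification.pt ⁻¹' C x.pt).domRestrict G)
    rw [this]
    exact continuous_subtype_val.comp (h x.pt).continuous
  · refine ⟨_, (hC (α b)).preimage hα.1, hpC (α b), ?_⟩
    have : (α ⁻¹' C (α b)).domRestrict F = fun y => ((h (α b)).symm y).1 :=
      funext fun y => hF (α b) y
    change Continuous ((α ⁻¹' C (α b)).domRestrict F)
    rw [this]
    exact continuous_subtype_val.comp (h (α b)).symm.continuous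

/-- A homeomorphism over the base is determined by its restriction to the complement of the
divisor, where the blow-up is injective. -/
theorem eq_of_forall_pt_eq [T2Space X] (hD : IsNormalCrossingDivisor n D)
    {f g : EndpointModification Dᶜ → EndpointModification Dᶜ} (hf : Continuous f)
    (hg : Continuous g) (hf' : ∀ x, (f x).pt = x.pt) (hg' : ∀ x, (g x).pt = x.pt) : f = g := by
  refine hf.ext_on EndpointModification.dense_preimage_pt hg fun x hx => ?_
  refine EndpointModification.ext_of_pt_mem (exists_isTame_compl hD)
    ((hf' x).trans (hg' x).symm) ?_
  rw [hf']
  exact hx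

end Uniqueness

/-! ### Pieces of the glued space as connected components -/

section StratifiedIso

variable {n : ℕ} {X : Type*} [TopologicalSpace X] [ChartedSpace (EuclideanSpace ℝ (Fin n)) X]
  [IsManifold (𝓡 n) ∞ X] {D D' : Set X} {Q' : (S : Stratum n D') → Set (OrthantSet D S.1)}

theorem Gluing.continuous_point (hD' : IsNormalCrossingDivisor n D') (T : Stratum n D')
    (q : Q' T) : Continuous fun p : T.1 => Gluing.point Q' T p q := by
  have hs : Continuous fun p : T.1 => (⟨p.1, EndsAt.self p.2⟩ : EndpointModification T.1) := by
    refine continuous_iff_continuousAt.2 fun p => ?_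
    obtain ⟨C, hpC, hC⟩ := exists_isTame_stratum hD' T p.1
    rw [ContinuousAt, EndpointModification.nhds_eq_of_isTame hC _
      (show (EndpointModification.mk p.1 (EndsAt.self p.2)).pt ∈ C from hpC)]
    refine tendsto_inf.2 ⟨tendsto_comap_iff.2 continuous_subtype_val.continuousAt,
      tendsto_principal.2 ?_⟩
    obtain ⟨k, J, φ, hφ, hk, -⟩ := exists_common_chart hD' hD' Subset.rfl p.1
    have hT := fun {x : X} => T.mem_iff_sgn_eq_zero hD' hφ.convex hk.isZeroSet hφ.mem_source
      hφ.centred p.2 (x := x)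
    have hn := C.isOpen.mem_nhds hpC
    obtain ⟨ψ, hψ, hψs, hψe⟩ := exists_isCubeChart_subset hφ.smooth hφ.mem_source hφ.centred hn
    have hpre : IsPreconnected (ψ.source ∩ T.1) := by
      have : ψ.source ∩ T.1 = cell ψ (firstIdx n k) 0 := by
        ext x
        refine and_congr_right fun hx => ?_
        rw [hT (hψs hx).1, hψe]
      rw [this]
      exact isPreconnected_cell hψ.convex _
    filter_upwards [(ψ.open_source.preimage continuous_subtype_val).mem_nhds hψ.mem_source]
      with p' hp'
    refine ⟨(hψs hp').2, ?_⟩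
    refine (connectedComponentIn_eq ?_).symm
    exact hpre.subset_connectedComponentIn
      (show p.1 ∈ ψ.source ∩ T.1 from ⟨hψ.mem_source, p.2⟩)
      (show ψ.source ∩ T.1 ⊆ (C : Set X) ∩ T.1 from fun x hx => ⟨(hψs hx.1).2, hx.2⟩)
      (show p'.1 ∈ ψ.source ∩ T.1 from ⟨hp', p'.2⟩)
  exact continuous_quot_mk.comp (continuous_sigmaMk.comp (hs.prodMk continuous_const))

theorem Gluing.isConnected_piece (hD' : IsNormalCrossingDivisor n D')
    (i : Σ T : Stratum n D', Q' T) : IsConnected (Gluing.piece Q' i) := by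
  have : ConnectedSpace i.1.1 := Subtype.connectedSpace i.1.isConnected
  exact isConnected_range (Gluing.continuous_point hD' i.1 i.2)

/-- The pieces over a stratum are locally constant. -/
theorem Gluing.eventually_mem_piece (hD : IsNormalCrossingDivisor n D)
    (hD' : IsNormalCrossingDivisor n D') (hDD' : D ⊆ D') (hQ : IsAdmissible Q')
    (i : Σ T : Stratum n D', Q' T) {g : Gluing Q'} (hg : g ∈ Gluing.piece Q' i) :
    ∀ᶠ g' in 𝓝 g, g'.toBase ∈ i.1.1 → g' ∈ Gluing.piece Q' i := by
  obtain ⟨T, q⟩ := i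
  obtain ⟨p, rfl⟩ := hg
  obtain ⟨k, J, φ, hφ, hk, hJ, hφJ⟩ := exists_common_chart hD hD' hDD' p.1
  have hcD := hφJ.isCellular_compl hφ.convex
  obtain ⟨V, hpV, hV⟩ := q.1.locConst p (dom φ) hφ.mem_source
  have hpt := (Gluing.continuous_toBase (Q' := Q')).continuousAt (x := Gluing.point Q' T p q)
  have hsheet := (Gluing.continuous_toEndpoint (Q' := Q')).continuousAt.eventually
    ((EndpointModification.isOpen_sheet (dom φ) _).mem_nhds
      (EndpointModification.mem_sheet_self (Gluing.point Q' T p q).toEndpoint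
        (U := dom φ) hφ.mem_source))
  filter_upwards [hsheet, hpt.eventually (V.isOpen.mem_nhds hpV)] with g' hg' hgV hgT
  obtain ⟨T', p', q', rfl⟩ := g'.exists_eq_point hD' hQ
  obtain rfl : T' = T := Stratum.eq_of_mem hD' p'.2 hgT
  obtain ⟨hp'C, hK⟩ := hg'
  refine ⟨p', congrArg _ (Subtype.ext (OrthantSet.eq_of_val_eq hD (p := p') ?_))⟩
  refine hcD.isTame.end_ext (C := dom φ) hp'C ?_
  rw [hV p' hgV hp'C]
  have h1 : (Gluing.point Q' T' p q).toEndpoint = ⟨p.1, q.1.val p⟩ := toEndpoint_point _ _ _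
  have h2 : (Gluing.point Q' T' p' q').toEndpoint = ⟨p'.1, q'.1.val p'⟩ := toEndpoint_point _ _ _
  -- A component is indexed by a membership proof for the base point, so equalities of components
  -- are transported along equalities of points.
  have aux : ∀ {x y x' y' : EndpointModification Dᶜ} (hx : x.pt ∈ dom φ) (hy : y.pt ∈ dom φ)
      (hx' : x'.pt ∈ dom φ) (hy' : y'.pt ∈ dom φ), x = x' → y = y' →
      x.toEnd.comp (dom φ) hx = y.toEnd.comp (dom φ) hy →
      x'.toEnd.comp (dom φ) hx' = y'.toEnd.comp (dom φ) hy' := by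
    rintro x y _ _ _ _ _ _ rfl rfl h
    exact h
  exact (aux (x' := ⟨p'.1, q'.1.val p'⟩) (y' := ⟨p.1, q.1.val p⟩) _ _ hp'C hφ.mem_source h2 h1
    hK).symm

/-- The pieces over a stratum are the connected components of its preimage. -/
theorem Gluing.connectedComponentIn_eq_piece (hD : IsNormalCrossingDivisor n D)
    (hD' : IsNormalCrossingDivisor n D') (hDD' : D ⊆ D') (hQ : IsAdmissible Q')
    (i : Σ T : Stratum n D', Q' T) {g : Gluing Q'} (hg : g ∈ Gluing.piece Q' i) :
    connectedComponentIn (Gluing.toBase ⁻¹' i.1.1) g = Gluing.piece Q' i := by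
  have hsub : Gluing.piece Q' i ⊆ Gluing.toBase ⁻¹' i.1.1 := by
    rintro _ ⟨p, rfl⟩
    exact p.2
  refine Subset.antisymm ?_
    ((Gluing.isConnected_piece hD' i).isPreconnected.subset_connectedComponentIn hg hsub)
  set K := connectedComponentIn (Gluing.toBase ⁻¹' i.1.1) g with hK
  have hKs : K ⊆ Gluing.toBase ⁻¹' i.1.1 := connectedComponentIn_subset _ _
  have : PreconnectedSpace K := Subtype.preconnectedSpace isPreconnected_connectedComponentIn
  have hloc : IsLocallyConstant fun y : K => y.1 ∈ Gluing.piece Q' i := by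
    rw [IsLocallyConstant.iff_eventually_eq]
    intro y
    obtain ⟨T, p, q, hy⟩ := y.1.exists_eq_point hD' hQ
    have hyT : T = i.1 := by
      refine Stratum.eq_of_mem hD' p.2 ?_
      have := hKs y.2
      rwa [mem_preimage, hy] at this
    subst hyT
    have hyq : y.1 ∈ Gluing.piece Q' ⟨i.1, q⟩ := ⟨p, hy.symm⟩
    filter_upwards [continuous_subtype_val.continuousAt.eventually
      (Gluing.eventually_mem_piece hD hD' hDD' hQ ⟨i.1, q⟩ hyq)] with z hz
    have hzq := hz (hKs z.2)
    have key : ∀ w : Gluing Q', w ∈ Gluing.piece Q' ⟨i.1, q⟩ →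
        (w ∈ Gluing.piece Q' i ↔ q = i.2) := by
      rintro _ ⟨p, rfl⟩
      constructor
      · rintro ⟨p', hp'⟩
        have h1 := congrArg Gluing.toEndpoint hp'
        simp only [toEndpoint_point] at h1
        obtain ⟨hpp, he⟩ := EndpointModification.mk.inj h1
        obtain rfl : p' = p := Subtype.ext hpp
        exact Subtype.ext (OrthantSet.eq_of_val_eq hD (eq_of_heq he)).symm
      · rintro rfl
        exact ⟨p, rfl⟩
    rw [key _ hzq, key _ hyq]
  intro y hy
  exact (hloc.apply_eq_of_isPreconnected isPreconnected_univ (mem_univ ⟨y, hy⟩)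
    (mem_univ ⟨g, mem_connectedComponentIn (hsub hg)⟩)).mpr hg

/-- A homeomorphism from the glued space to a subspace of a blow-up that is compatible with the
embedding into the endpoint modification is an isomorphism of stratified spaces. -/
theorem isStratifiedIso_of_homeomorph {B Y : Type*} [TopologicalSpace B] [TopologicalSpace Y]
    (hD : IsNormalCrossingDivisor n D)
    (hD' : IsNormalCrossingDivisor n D') (hDD' : D ⊆ D') (hQ : IsAdmissible Q') {α : B → X}
    (Φ₀ : EndpointModification Dᶜ ≃ₜ B) (hΦ₀ : ∀ x, α (Φ₀ x) = x.pt) {j : Y → B}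
    (Φ : Gluing Q' ≃ₜ Y) (hΦ : ∀ g, j (Φ g) = Φ₀ g.toEndpoint) : IsStratifiedIso Q' α j Φ where
  base g := by rw [hΦ, hΦ₀, Gluing.pt_toEndpoint]
  orthant T p q U hU := by
    rw [hΦ, Gluing.toEndpoint_point]
    have h := EndpointModification.mem_closure_preimage_comp ⟨p.1, q.1.val p⟩ U hU
    have h' := image_closure_subset_closure_image Φ₀.continuous ⟨_, h, rfl⟩
    refine closure_mono ?_ h'
    rintro _ ⟨x, hx, rfl⟩
    rw [mem_preimage, hΦ₀]
    exact hx
  strata i y hy := by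
    obtain ⟨g, hg, rfl⟩ := hy
    rw [← Gluing.connectedComponentIn_eq_piece hD hD' hDD' hQ i hg]
    have hgT : g ∈ Gluing.toBase ⁻¹' i.1.1 := by
      obtain ⟨p, rfl⟩ := hg
      exact p.2
    rw [Φ.image_connectedComponentIn hgT]
    congr 1
    ext y
    obtain ⟨g', rfl⟩ := Φ.surjective y
    rw [Φ.injective.mem_set_image, mem_preimage, mem_preimage, hΦ, hΦ₀, Gluing.pt_toEndpoint]

end StratifiedIso
/-! ## Unions of cells satisfy Whitney's condition -/

section CellUnions

variable {n : ℕ} {J : Finset (Fin n)} {U : Set (EuclideanSpace ℝ (Fin n))}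
  {𝒮 𝒮' : Set (Fin n → SignType)}

/-- The linear span of the cell that contains `z`. -/
def cellSpan (J : Finset (Fin n)) (z : EuclideanSpace ℝ (Fin n)) :
    Submodule ℝ (EuclideanSpace ℝ (Fin n)) where
  carrier := {v | ∀ i ∈ J, z i = 0 → v i = 0}
  add_mem' hv hw i hi hz := by
    rw [PiLp.add_apply, hv i hi hz, hw i hi hz, add_zero]
  zero_mem' i _ _ := rfl
  smul_mem' c v hv i hi hz := by
    rw [PiLp.smul_apply, hv i hi hz, smul_zero]

/-- Near `z` only the vanishing coordinates can change sign, so there the cell of `z` is an affine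
subspace. -/
theorem sgn_eq_iff_sub_mem_cellSpan {x z : EuclideanSpace ℝ (Fin n)}
    (h : IsFace (sgn J z) (sgn J x)) : sgn J x = sgn J z ↔ x - z ∈ cellSpan J z := by
  constructor
  · intro he i hi hz
    have := congrFun he i
    rw [sgn_of_mem hi, sgn_of_mem hi, hz, sign_zero, sign_eq_zero_iff] at this
    rw [PiLp.sub_apply, this, hz, sub_zero]
  · intro hm
    funext i
    by_cases hz : sgn J z i = 0
    · rw [hz]
      by_cases hi : i ∈ J
      · rw [sgn_of_mem hi, sign_eq_zero_iff] at hz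
        have := hm i hi hz
        rw [PiLp.sub_apply, hz, sub_zero] at this
        rw [sgn_of_mem hi, this, sign_zero]
      · exact sgn_of_notMem hi
    · exact h i hz

theorem isSmoothSubmanifold_of_antichain (hU : IsOpen U)
    (h𝒮 : ∀ σ ∈ 𝒮, ∀ τ ∈ 𝒮, IsFace σ τ → σ = τ) :
    IsSmoothSubmanifold (U ∩ {v | sgn J v ∈ 𝒮}) := by
  rintro z ⟨hzU, hz⟩
  obtain ⟨V, hVs, hV, hzV⟩ := mem_nhds_iff.1
    (inter_mem (hU.mem_nhds hzU) (eventually_isFace_sgn J z))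
  refine ⟨(Homeomorph.addRight (-z)).toOpenPartialHomeomorph.restrOpen V hV, ?_, ?_, ?_,
    cellSpan J z, ?_⟩
  · simpa using hzV
  · exact (contDiff_id.add contDiff_const).contDiffOn
  · exact (contDiff_id.add contDiff_const).contDiffOn
  · intro x hx
    have hxV : x ∈ V := by simpa using hx
    have hxs := hVs hxV
    change x ∈ U ∩ _ ↔ x + -z ∈ cellSpan J z
    rw [← sub_eq_add_neg, ← sgn_eq_iff_sub_mem_cellSpan hxs.2]
    refine ⟨fun h => (h𝒮 _ hz _ h.2 hxs.2).symm, fun h => ⟨hxs.1, ?_⟩⟩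
    rw [mem_ofPred_eq, h]
    exact hz

theorem mem_tangentConeAt_of_mem_cellSpan (hU : IsOpen U) {x v : EuclideanSpace ℝ (Fin n)}
    (hx : x ∈ U ∩ {v | sgn J v ∈ 𝒮}) (hv : v ∈ cellSpan J x) :
    v ∈ tangentConeAt ℝ (U ∩ {v | sgn J v ∈ 𝒮}) x := by
  have hc : Tendsto (fun t : ℝ => t) (𝓝[≠] 0) (𝓝[≠] 0) := tendsto_id
  have ht : Tendsto (fun t : ℝ => x + t • v) (𝓝[≠] 0) (𝓝 x) := by
    have : ContinuousAt (fun t : ℝ => x + t • v) 0 := by fun_prop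
    have h := this.tendsto
    simp only [zero_smul, add_zero] at h
    exact h.mono_left nhdsWithin_le_nhds
  refine mem_tangentConeAt_of_add_smul_mem hc ?_
  filter_upwards [ht.eventually (hU.mem_nhds hx.1), ht.eventually (eventually_isFace_sgn J x)]
    with t h1 h2
  refine ⟨h1, ?_⟩
  rw [mem_ofPred_eq, (sgn_eq_iff_sub_mem_cellSpan h2).2]
  · exact hx.2
  · rw [add_sub_cancel_left]
    exact Submodule.smul_mem _ t hv

/-- For orthogonal projections, inclusion of subspaces is the equation `P_T * P_L = P_L`, which
passes to limits. -/
theorem le_of_subspaceTendsto {L T : ℕ → Submodule ℝ (EuclideanSpace ℝ (Fin n))}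
    {l τ : Submodule ℝ (EuclideanSpace ℝ (Fin n))} (hl : SubspaceTendsto L l)
    (hτ : SubspaceTendsto T τ) (h : ∀ᶠ m in atTop, L m ≤ T m) : l ≤ τ := by
  have hlim : τ.starProjection * l.starProjection = l.starProjection := by
    refine tendsto_nhds_unique_of_eventuallyEq (Tendsto.mul hτ hl) hl ?_
    filter_upwards [h] with m hm
    ext1 v
    exact Submodule.starProjection_eq_self_iff.2 (hm (Submodule.starProjection_apply_mem _ v))
  intro v hv
  have := congrArg (fun f => f v) hlim
  simp only [_root_.mul_apply_eq_comp, Submodule.starProjection_eq_self_iff.2 hv] at this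
  exact Submodule.starProjection_eq_self_iff.1 this

/-- The secants lie in the tangent spaces even before the limit. A coordinate that vanishes at `x'
m` vanishes at `z`, and then at `x m`, which by the antichain condition has the signs of `z`; so the
difference is in the span of the cell of `x' m`. -/
theorem whitneyCondition_of_antichain {U' : Set (EuclideanSpace ℝ (Fin n))} (hU : IsOpen U')
    (h𝒮 : ∀ σ ∈ 𝒮, ∀ τ ∈ 𝒮, IsFace σ τ → σ = τ) :
    WhitneyCondition (U ∩ {v | sgn J v ∈ 𝒮}) (U' ∩ {v | sgn J v ∈ 𝒮'}) := by
  intro z hz x x' l τ hx hx' _ hxz hxz' hl hτ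
  refine le_of_subspaceTendsto hl hτ ?_
  filter_upwards [hxz.eventually (eventually_isFace_sgn J z),
    hxz'.eventually (eventually_isFace_sgn J z)] with m h1 h2
  rw [Submodule.span_singleton_le_iff_mem]
  refine Submodule.subset_span (mem_tangentConeAt_of_mem_cellSpan hU (hx' m) fun i hi h0 => ?_)
  have hz0 : sgn J z i = 0 := by
    by_contra hne
    have := h2 i hne
    rw [sgn_of_mem hi, h0, sign_zero] at this
    exact hne this.symm
  have hx0 := congrFun (h𝒮 _ hz.2 _ (hx m).2 h1) i
  rw [hz0, sgn_of_mem hi, eq_comm, sign_eq_zero_iff] at hx0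
  rw [PiLp.sub_apply, h0, hx0, sub_zero]

end CellUnions
/-! ## The glued space is Whitney-stratified -/

/-- The sheets over a tame open set are embedded in the base. -/
theorem EndpointModification.isEmbedding_domRestrict_pt {X : Type*} [TopologicalSpace X]
    {A : Set X} {C : Opens X} (hC : IsTame A C) (K : Set X) :
    IsEmbedding ((sheet A C K).domRestrict pt) := by
  refine ⟨⟨TopologicalSpace.ext_nhds fun w => ?_⟩, ?_⟩
  · obtain ⟨hw, hwK⟩ := w.2
    rw [nhds_induced, nhds_induced, nhds_eq_of_isTame hC _ hw, hwK, comap_inf, comap_principal,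
      comap_comap, Subtype.coe_preimage_self, principal_univ, inf_top_eq]
    rfl
  · rintro ⟨⟨p, e⟩, hw, hwO⟩ ⟨⟨p', e'⟩, hw', hwO'⟩ h
    obtain rfl : p = p' := h
    obtain rfl := hC.end_ext hw (hwO.trans hwO'.symm)
    rfl

section Whitney

variable {n : ℕ} {X : Type*} [TopologicalSpace X] [ChartedSpace (EuclideanSpace ℝ (Fin n)) X]
  {D D' : Set X} {Q' : (S : Stratum n D') → Set (OrthantSet D S.1)}

/-- A neighbourhood `W` of `g` that the blow-down map embeds onto a closed subset of the domain of
the chart `φ`, in such a way that the pieces correspond to unions of cells. -/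
structure Gluing.IsPatch (g : Gluing Q')
    (φ : OpenPartialHomeomorph X (EuclideanSpace ℝ (Fin n))) (J : Finset (Fin n))
    (W : Set (Gluing Q')) : Prop where
  chart : IsCubeChart g.toBase φ
  isOpen : IsOpen W
  mem : g ∈ W
  mapsTo : MapsTo Gluing.toBase W φ.source
  isEmbedding : IsEmbedding (W.domRestrict Gluing.toBase)
  closure_subset : ∀ x ∈ φ.source, x ∈ closure (Gluing.toBase '' W) → x ∈ Gluing.toBase '' W
  antichain : ∀ i, ∀ w ∈ W ∩ Gluing.piece Q' i, ∀ w' ∈ W ∩ Gluing.piece Q' i,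
    IsFace (sgn J (φ w.toBase)) (sgn J (φ w'.toBase)) →
      sgn J (φ w.toBase) = sgn J (φ w'.toBase)
  saturated : ∀ i, ∀ w ∈ W ∩ Gluing.piece Q' i, ∀ x ∈ φ.source,
    sgn J (φ x) = sgn J (φ w.toBase) → ∃ w' ∈ W ∩ Gluing.piece Q' i, w'.toBase = x
  centre : ∀ i, g ∈ Gluing.piece Q' i → ∀ w ∈ W ∩ Gluing.piece Q' i, sgn J (φ w.toBase) = 0

variable [IsManifold (𝓡 n) ∞ X]

/-- The patch is the part of the glued space in the closed orthant of `g` over a common chart. A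
single orthant embeds in the base, and orthants are constant along cells, so the pieces are unions
of cells. -/
theorem Gluing.exists_isPatch [T2Space X] (hD : IsNormalCrossingDivisor n D)
    (hD' : IsNormalCrossingDivisor n D') (hDD' : D ⊆ D') (hQ : IsAdmissible Q') (g : Gluing Q') :
    ∃ φ J W, g.IsPatch φ J W := by
  obtain ⟨k, J, φ, hφ, hk, hJ, hφJ⟩ := exists_common_chart hD hD' hDD' g.toBase
  have hcD := hφJ.isCellular_compl hφ.convex
  have hΘ := Gluing.isClosedEmbedding_toEndpoint hD hD' hDD' hQ
  have hgC : g.toEndpoint.pt ∈ dom φ := by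
    rw [pt_toEndpoint]
    exact hφ.mem_source
  set O := g.toEndpoint.toEnd.comp (dom φ) hgC with hO
  refine ⟨φ, firstIdx n k, Gluing.toEndpoint ⁻¹' EndpointModification.sheet Dᶜ (dom φ) O, hφ,
    (EndpointModification.isOpen_sheet _ _).preimage continuous_toEndpoint,
    EndpointModification.mem_sheet_self _ _, ?_, ?_, ?_, ?_, ?_, ?_⟩
  · rintro w ⟨hw, -⟩
    rwa [pt_toEndpoint] at hw
  · have h := (EndpointModification.isEmbedding_domRestrict_pt hcD.isTame O).comp
      (hΘ.isEmbedding.restrictPreimage (EndpointModification.sheet Dᶜ (dom φ) O))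
    convert h using 1
    exact funext fun w => w.1.pt_toEndpoint.symm
  · intro x hx hxW
    obtain ⟨y, hy, hyO⟩ := g.toEndpoint.toEnd.isComp (dom φ) hgC
    have hxO : x ∈ closure O := by
      rw [← closure_closure]
      refine closure_mono ?_ hxW
      rintro _ ⟨w, ⟨hw, hwO⟩, rfl⟩
      have := w.toEndpoint.toEnd.mem_closure_comp _ hw
      rw [hwO] at this
      rwa [← pt_toEndpoint]
    rw [hO, hyO] at hxO
    obtain ⟨e, he⟩ := hcD.isTame.exists_end (C := dom φ) hx hy hxO
    rw [← hyO] at he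
    let b : EndpointModification Dᶜ := ⟨x, e⟩
    -- A limit in the base lifts to a limit in the same closed orthant; it belongs to the glued
    -- space because the image of `Gluing.toEndpoint` is closed.
    have hb : b ∈ closure (range (Gluing.toEndpoint : Gluing Q' → EndpointModification Dᶜ)) := by
      rw [mem_closure_iff_nhds]
      intro N hN
      rw [EndpointModification.nhds_eq_of_isTame hcD.isTame b (show b.pt ∈ dom φ from hx),
        mem_inf_principal, mem_comap] at hN
      obtain ⟨V, hV, hVN⟩ := hN
      obtain ⟨_, hwV, w, ⟨hw, hwO⟩, rfl⟩ := mem_closure_iff_nhds.1 hxW V hV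
      refine ⟨w.toEndpoint, hVN ?_ ⟨hw, hwO.trans he.symm⟩, w, rfl⟩
      rwa [mem_preimage, pt_toEndpoint]
    rw [hΘ.isClosed_range.closure_eq] at hb
    obtain ⟨w, hw⟩ := hb
    refine ⟨w, ?_, ?_⟩
    · rw [mem_preimage, hw]
      exact ⟨hx, he⟩
    · rw [← pt_toEndpoint, hw]
  · rintro ⟨T, q⟩ _ ⟨⟨hw, -⟩, p, rfl⟩ _ ⟨⟨hw', -⟩, p', rfl⟩ hf
    rw [pt_toEndpoint] at hw hw'
    have hT := T.isCellular hD' hφ.convex hk.isZeroSet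
    exact hT.antichain _ ((hT.mem_iff _ hw).1 p.2) _ ((hT.mem_iff _ hw').1 p'.2) hf
  · rintro ⟨T, q⟩ _ ⟨⟨hw, hwO⟩, p, rfl⟩ x hx hxs
    rw [pt_toEndpoint] at hw
    have hcell := T.cell_subset hD' hφ.convex hk.isZeroSet (x := p.1) hw p.2
    have hxT : x ∈ T.1 := hcell ⟨hx, hxs⟩
    refine ⟨Gluing.point Q' T ⟨x, hxT⟩ q, ⟨?_, ⟨x, hxT⟩, rfl⟩, rfl⟩
    rw [mem_preimage, toEndpoint_point]
    refine ⟨hx, ?_⟩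
    rw [← hwO]
    have hcomp := q.1.comp_eq (dom φ) (isPreconnected_cell hφ.convex _)
      (fun y hy => ⟨hy.1, hcell hy⟩)
      (show x ∈ cell φ (firstIdx n k) (sgn (firstIdx n k) (φ p.1)) from ⟨hx, hxs⟩)
      (show p.1 ∈ cell φ (firstIdx n k) (sgn (firstIdx n k) (φ p.1)) from ⟨hw, rfl⟩)
    have aux : ∀ b b' : EndpointModification Dᶜ, b = b' → ∀ (h : b.pt ∈ dom φ)
        (h' : b'.pt ∈ dom φ), b.toEnd.comp (dom φ) h = b'.toEnd.comp (dom φ) h' := by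
      rintro b _ rfl _ _
      rfl
    exact hcomp.trans (aux _ _ (toEndpoint_point T p q).symm hw _)
  · rintro ⟨T, q⟩ hg _ ⟨⟨hw, -⟩, p', rfl⟩
    rw [pt_toEndpoint] at hw
    have hgT : g.toBase ∈ T.1 := by
      obtain ⟨p, rfl⟩ := hg
      exact p.2
    exact (T.mem_iff_sgn_eq_zero hD' hφ.convex hk.isZeroSet hφ.mem_source hφ.centred hgT hw).1
      p'.2

end Whitney
-- The stratification by pieces and its frontier condition
section Stratification

variable {n : ℕ} {X : Type*} [TopologicalSpace X] [ChartedSpace (EuclideanSpace ℝ (Fin n)) X]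
  {D D' : Set X} {Q' : (S : Stratum n D') → Set (OrthantSet D S.1)}

/-- The sign vectors of the points of a piece. -/
def Gluing.pieceSigns (φ : OpenPartialHomeomorph X (EuclideanSpace ℝ (Fin n)))
    (J : Finset (Fin n)) (W : Set (Gluing Q')) (i : Σ T : Stratum n D', Q' T) :
    Set (Fin n → SignType) := {σ | ∃ w ∈ W ∩ Gluing.piece Q' i, sgn J (φ w.toBase) = σ}

theorem Gluing.IsPatch.image_piece {g : Gluing Q'}
    {φ : OpenPartialHomeomorph X (EuclideanSpace ℝ (Fin n))} {J : Finset (Fin n)}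
    {W : Set (Gluing Q')} (h : g.IsPatch φ J W) (i : Σ T : Stratum n D', Q' T) :
    (fun w => φ (Gluing.toBase w)) '' (W ∩ Gluing.piece Q' i) =
      φ.target ∩ {v | sgn J v ∈ Gluing.pieceSigns φ J W i} := by
  ext v
  constructor
  · rintro ⟨w, hw, rfl⟩
    exact ⟨φ.map_source (h.mapsTo hw.1), w, hw, rfl⟩
  · rintro ⟨hv, w, hw, hσ⟩
    obtain ⟨w', hw', hwx⟩ := h.saturated i w hw (φ.symm v) (φ.map_target hv)
      (by rw [φ.right_inv hv, hσ])
    refine ⟨w', hw', ?_⟩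
    change φ w'.toBase = v
    rw [hwx, φ.right_inv hv]

theorem Gluing.IsPatch.antichain_pieceSigns {g : Gluing Q'}
    {φ : OpenPartialHomeomorph X (EuclideanSpace ℝ (Fin n))} {J : Finset (Fin n)}
    {W : Set (Gluing Q')} (h : g.IsPatch φ J W) (i : Σ T : Stratum n D', Q' T) :
    ∀ σ ∈ Gluing.pieceSigns φ J W i, ∀ τ ∈ Gluing.pieceSigns φ J W i, IsFace σ τ → σ = τ := by
  rintro _ ⟨w, hw, rfl⟩ _ ⟨w', hw', rfl⟩ hf
  exact h.antichain i w hw w' hw' hf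

/-- A piece that meets a neighbourhood of `g` in a patch around `g` contains in its closure the
piece of `g` near `g`. -/
theorem Gluing.IsPatch.mem_closure_piece {g : Gluing Q'}
    {φ : OpenPartialHomeomorph X (EuclideanSpace ℝ (Fin n))} {J : Finset (Fin n)}
    {W : Set (Gluing Q')} (h : g.IsPatch φ J W) {i j : Σ T : Stratum n D', Q' T}
    (hg : g ∈ Gluing.piece Q' i) (hj : (W ∩ Gluing.piece Q' j).Nonempty) {g' : Gluing Q'}
    (hg' : g' ∈ W ∩ Gluing.piece Q' i) : g' ∈ closure (Gluing.piece Q' j) := by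
  obtain ⟨w, hw⟩ := hj
  have h0 := h.centre i hg g' hg'
  have hcl : g'.toBase ∈ closure (cell φ J (sgn J (φ w.toBase))) := by
    rw [mem_closure_cell_iff (h.mapsTo hg'.1) (fun i hi => sgn_of_notMem hi), h0]
    exact fun i hi => (hi rfl).elim
  have hcl' : g'.toBase ∈ closure (W.domRestrict Gluing.toBase ''
      (Subtype.val ⁻¹' Gluing.piece Q' j)) := by
    refine closure_mono ?_ hcl
    rintro x ⟨hx, hxs⟩
    obtain ⟨w', hw', rfl⟩ := h.saturated j w hw x hx hxs
    exact ⟨⟨w', hw'.1⟩, hw'.2, rfl⟩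
  have : (⟨g', hg'.1⟩ : W) ∈ closure (Subtype.val ⁻¹' Gluing.piece Q' j) := by
    rw [h.isEmbedding.isInducing.closure_eq_preimage_closure_image]
    exact hcl'
  exact closure_mono (image_preimage_subset _ _)
    (image_closure_subset_closure_image continuous_subtype_val ⟨_, this, rfl⟩)

variable [IsManifold (𝓡 n) ∞ X]

theorem Gluing.disjoint_piece (hD : IsNormalCrossingDivisor n D)
    (hD' : IsNormalCrossingDivisor n D') {i j : Σ T : Stratum n D', Q' T} {g : Gluing Q'}
    (hi : g ∈ Gluing.piece Q' i) (hj : g ∈ Gluing.piece Q' j) : i = j := by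
  obtain ⟨T, q⟩ := i
  obtain ⟨T', q'⟩ := j
  obtain ⟨⟨p, hp⟩, rfl⟩ := hi
  obtain ⟨⟨p', hp'⟩, h⟩ := hj
  have h1 := congrArg Gluing.toEndpoint h
  simp only [toEndpoint_point] at h1
  obtain ⟨hpp, he⟩ := EndpointModification.mk.inj h1
  obtain rfl : p' = p := hpp
  obtain rfl : T' = T := Stratum.eq_of_mem hD' hp' hp
  obtain rfl : q' = q := Subtype.ext (OrthantSet.eq_of_val_eq hD (eq_of_heq he))
  rfl

/-- In a chart centred in a point of `T`, the stratum is where the relevant coordinates all vanish,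
which is a closed condition. -/
theorem Stratum.isLocallyClosed (hD' : IsNormalCrossingDivisor n D') (T : Stratum n D') :
    IsLocallyClosed T.1 := by
  rw [isLocallyClosed_iff_isOpen_coborder, isOpen_iff_mem_nhds, coborder_eq_union_closure_compl]
  rintro p (hp | hp)
  · obtain ⟨k, J, φ, hφ, hk, -⟩ := exists_common_chart hD' hD' Subset.rfl p
    filter_upwards [φ.open_source.mem_nhds hφ.mem_source] with x hx
    by_contra hxT
    simp only [mem_union, mem_compl_iff, not_or, not_not] at hxT
    have hT := fun {x : X} => T.mem_iff_sgn_eq_zero hD' hφ.convex hk.isZeroSet hφ.mem_source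
      hφ.centred hp (x := x)
    refine hxT.1 ((hT hx).2 ?_)
    obtain ⟨y, ⟨hy, hf⟩, hyT⟩ := mem_closure_iff_nhds.1 hxT.2 _
      (eventually_isFace (firstIdx n k) hx)
    rw [(hT hy).1 hyT] at hf
    funext i
    by_contra hne
    exact hne (hf i hne).symm
  · exact mem_of_superset (isClosed_closure.isOpen_compl.mem_nhds hp) subset_union_right

/-- For an admissible choice of orthants the glued space is Whitney-stratified by its pieces. -/
theorem Gluing.isWhitneyStratified [T2Space X] (hD : IsNormalCrossingDivisor n D)
    (hD' : IsNormalCrossingDivisor n D') (hDD' : D ⊆ D') (hQ : IsAdmissible Q') :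
    IsWhitneyStratified (n := n) (Gluing.toBase : Gluing Q' → X) (Gluing.piece Q') where
  t2 := (Gluing.isClosedEmbedding_toEndpoint hD hD' hDD' hQ).isEmbedding.t2Space
  cover := by
    refine eq_univ_of_forall fun g => ?_
    obtain ⟨T, p, q, rfl⟩ := g.exists_eq_point hD' hQ
    exact mem_iUnion.2 ⟨⟨T, q⟩, p, rfl⟩
  disjoint i j hij := disjoint_left.2 fun _ hi hj => hij (disjoint_piece hD hD' hi hj)
  connected := Gluing.isConnected_piece hD'
  locallyClosed i := by
    have : Gluing.piece Q' i = Gluing.toBase ⁻¹' i.1.1 ∩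
        interior {g | g.toBase ∈ i.1.1 → g ∈ Gluing.piece Q' i} := by
      ext g
      refine ⟨fun hg => ⟨?_, mem_interior_iff_mem_nhds.2
        (Gluing.eventually_mem_piece hD hD' hDD' hQ i hg)⟩, fun hg => interior_subset hg.2 hg.1⟩
      obtain ⟨p, rfl⟩ := hg
      exact p.2
    rw [this]
    exact ((i.1.isLocallyClosed hD').preimage continuous_toBase).inter
      isOpen_interior.isLocallyClosed
  locallyFinite g := by
    obtain ⟨φ, J, W, h⟩ := g.exists_isPatch hD hD' hDD' hQ
    refine ⟨W, h.isOpen.mem_nhds h.mem, ?_⟩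
    have : Nonempty (Gluing Q') := ⟨g⟩
    choose! w hw using fun i (hi : i ∈ {i | (Gluing.piece Q' i ∩ W).Nonempty}) => hi
    -- Each piece meeting the patch contains a full cell of it, and the patch embeds in the base; so
    -- different pieces have different sign vectors, of which there are finitely many.
    refine Set.Finite.of_injOn (f := fun i => sgn J (φ (w i).toBase)) (mapsTo_univ _ _) ?_
      finite_univ
    intro i hi j hj hij
    obtain ⟨w', hw', he⟩ := h.saturated j (w j) (hw j hj).symm _ (h.mapsTo (hw i hi).2) hij
    have : (⟨w', hw'.1⟩ : W) = ⟨w i, (hw i hi).2⟩ := h.isEmbedding.injective he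
    obtain rfl := Subtype.mk.inj this
    exact disjoint_piece hD hD' (hw i hi).1 hw'.2
  frontier i j hij := by
    obtain ⟨y, hy, hyj⟩ := hij
    have : PreconnectedSpace (Gluing.piece Q' i) :=
      Subtype.preconnectedSpace (Gluing.isConnected_piece hD' i).isPreconnected
    -- Within a patch around `g`, the piece of `g` is the smallest cell and hence adherent to every
    -- piece present. So adherence propagates along the connected piece.
    have hloc : IsLocallyConstant fun g : Gluing.piece Q' i =>
        g.1 ∈ closure (Gluing.piece Q' j) := by
      rw [IsLocallyConstant.iff_eventually_eq]
      intro g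
      by_cases hg : g.1 ∈ closure (Gluing.piece Q' j)
      · obtain ⟨φ, J, W, h⟩ := g.1.exists_isPatch hD hD' hDD' hQ
        filter_upwards [(h.isOpen.preimage continuous_subtype_val).mem_nhds h.mem] with g' hg'
        exact propext (iff_of_true (h.mem_closure_piece g.2
          (mem_closure_iff.1 hg W h.isOpen h.mem) ⟨hg', g'.2⟩) hg)
      · filter_upwards [(isClosed_closure.isOpen_compl.preimage continuous_subtype_val).mem_nhds
          hg] with g' hg'
        exact propext (iff_of_false hg' hg)
    intro g hg
    exact (hloc.apply_eq_of_isPreconnected isPreconnected_univ (mem_univ ⟨g, hg⟩)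
      (mem_univ ⟨y, hy⟩)).mpr hyj
  localForm g := by
    obtain ⟨φ, J, W, h⟩ := g.exists_isPatch hD hD' hDD' hQ
    refine ⟨W, h.isOpen, h.mem, φ, h.chart.smooth, h.mapsTo, h.isEmbedding, ?_, fun i => ?_,
      fun i j _ => ?_⟩
    · rintro v ⟨hv, hvt⟩
      have hx : φ.symm v ∈ closure (Gluing.toBase '' W) := by
        have hc := (φ.symm.continuousAt (x := v) hvt).continuousWithinAt
          (s := (fun w => φ (Gluing.toBase w)) '' W)
        refine closure_mono ?_ (hc.mem_closure_image hv)
        rintro _ ⟨_, ⟨w, hw, rfl⟩, rfl⟩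
        exact ⟨w, hw, (φ.left_inv (h.mapsTo hw)).symm⟩
      obtain ⟨w, hw, hwx⟩ := h.closure_subset _ (φ.map_target hvt) hx
      refine ⟨w, hw, ?_⟩
      change φ w.toBase = v
      rw [hwx, φ.right_inv hvt]
    · rw [h.image_piece i]
      exact isSmoothSubmanifold_of_antichain φ.open_target (h.antichain_pieceSigns i)
    · rw [h.image_piece i, h.image_piece j]
      exact whitneyCondition_of_antichain φ.open_target (h.antichain_pieceSigns i)

end Stratification
/-! ## The real-oriented blow-up as a glued space -/

section AllSheets

variable {n : ℕ} {X : Type*} [TopologicalSpace X] [ChartedSpace (EuclideanSpace ℝ (Fin n)) X]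
  {D D' : Set X}

theorem IsRealOrientedBlowUp.comp_homeomorph {Y Z : Type*} [TopologicalSpace Y]
    [TopologicalSpace Z] {α : Y → X} (hα : IsRealOrientedBlowUp n D α) (h : Z ≃ₜ Y) :
    IsRealOrientedBlowUp n D (α ∘ h) := by
  refine ⟨hα.1.comp h.continuous, fun p => ?_⟩
  obtain ⟨k, φ, hφ, Ψ, hΨ⟩ := hα.2 p
  exact ⟨k, φ, hφ, (h.subtype fun _ => Iff.rfl).trans Ψ, fun y => hΨ _⟩

theorem isAdmissible_allSheets (h : ∀ S : Stratum n D', SimplyConnectedSpace S.1) :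
    IsAdmissible (allSheets n D D') where
  orthantMap_mem _ _ _ _ _ := mem_univ _
  simplyConnected _ _ T _ := h T

variable [IsManifold (𝓡 n) ∞ X]

/-- An orthant near `p` extends along the simply connected stratum of `p`. -/
theorem Gluing.toEndpoint_surjective (hD : IsNormalCrossingDivisor n D)
    (hD' : IsNormalCrossingDivisor n D') (hDD' : D ⊆ D')
    (h : ∀ S : Stratum n D', SimplyConnectedSpace S.1) : Function.Surjective
      (Gluing.toEndpoint : Gluing (allSheets n D D') → EndpointModification Dᶜ) := by
  rintro ⟨p, e⟩
  obtain ⟨T, hpT⟩ := exists_stratum hD' p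
  have := h T
  obtain ⟨q, rfl⟩ := T.exists_orthant_val_eq hD hD' hDD' ⟨p, hpT⟩ e
  exact ⟨Gluing.point _ T ⟨p, hpT⟩ ⟨q, mem_univ q⟩, toEndpoint_point _ _ _⟩

/-- If all strata are simply connected, the gluing of their endpoint modifications is the endpoint
modification of the complement. -/
def Gluing.homeomorphEndpoint [T2Space X] (hD : IsNormalCrossingDivisor n D)
    (hD' : IsNormalCrossingDivisor n D') (hDD' : D ⊆ D')
    (h : ∀ S : Stratum n D', SimplyConnectedSpace S.1) :
    Gluing (allSheets n D D') ≃ₜ EndpointModification Dᶜ :=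
  (Gluing.isClosedEmbedding_toEndpoint hD hD' hDD'
    (isAdmissible_allSheets h)).isEmbedding.toHomeomorphOfSurjective
      (Gluing.toEndpoint_surjective hD hD' hDD' h)

theorem Gluing.isRealOrientedBlowUp_toBase [T2Space X] (hD : IsNormalCrossingDivisor n D)
    (hD' : IsNormalCrossingDivisor n D') (hDD' : D ⊆ D')
    (h : ∀ S : Stratum n D', SimplyConnectedSpace S.1) :
    IsRealOrientedBlowUp n D (Gluing.toBase : Gluing (allSheets n D D') → X) := by
  have := (EndpointModification.isRealOrientedBlowUp hD).comp_homeomorph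
    (Gluing.homeomorphEndpoint hD hD' hDD' h)
  convert this using 1
  exact funext fun g => g.pt_toEndpoint.symm

theorem Gluing.exists_isStratifiedIso [T2Space X] (hD : IsNormalCrossingDivisor n D)
    (hD' : IsNormalCrossingDivisor n D') (hDD' : D ⊆ D')
    (h : ∀ S : Stratum n D', SimplyConnectedSpace S.1) {B : Type*} [TopologicalSpace B]
    {α : B → X} (hα : IsRealOrientedBlowUp n D α) :
    ∃ Φ : Gluing (allSheets n D D') ≃ₜ B, IsStratifiedIso (allSheets n D D') α id Φ ∧
      ∀ Φ' : Gluing (allSheets n D D') ≃ₜ B, (∀ g, α (Φ' g) = g.toBase) → Φ' = Φ := by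
  obtain ⟨Φ₀, hΦ₀⟩ := hα.exists_homeomorph hD
  let H := Gluing.homeomorphEndpoint hD hD' hDD' h
  refine ⟨H.trans Φ₀, isStratifiedIso_of_homeomorph hD hD' hDD' (isAdmissible_allSheets h) Φ₀ hΦ₀
    _ fun g => rfl, fun Φ' hΦ' => ?_⟩
  have hH : ∀ x, (H.symm x).toBase = x.pt := fun x => by
    rw [← pt_toEndpoint]
    exact congrArg _ (H.apply_symm_apply x)
  have hpt : ∀ b, (Φ₀.symm b).pt = α b := fun b => by rw [← hΦ₀, Φ₀.apply_symm_apply]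
  -- Conjugated to the endpoint modification of the complement, `Φ'` becomes a self-map over the
  -- base, and the identity is the only continuous one.
  have key := eq_of_forall_pt_eq hD (f := fun x => Φ₀.symm (Φ' (H.symm x))) (g := id)
    (Φ₀.symm.continuous.comp (Φ'.continuous.comp H.symm.continuous)) continuous_id
    (fun x => by rw [hpt, hΦ', hH]) fun x => rfl
  ext g
  have := congrFun key (H g)
  rw [H.symm_apply_apply, id, Homeomorph.symm_apply_eq] at this
  exact this

end AllSheets
/-! ## Semi-stable degenerations -/

section Positive

variable {X : Type*} [TopologicalSpace X] {π : X → Ioo (-1 : ℝ) 1}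

theorem subset_pos_or_subset_neg (hπ : Continuous fun x => (π x : ℝ)) {K : Set X}
    (hK : IsPreconnected K) (hKD : K ⊆ (zeroFibre π)ᶜ) :
    K ⊆ {x | 0 < (π x : ℝ)} ∨ K ⊆ {x | (π x : ℝ) < 0} := by
  refine hK.subset_or_subset (isOpen_lt continuous_const hπ) (isOpen_lt hπ continuous_const) ?_ ?_
  · exact disjoint_left.2 fun x (hx : 0 < (π x : ℝ)) (hx' : (π x : ℝ) < 0) => lt_asymm hx hx'
  · intro x hx
    exact (lt_or_gt_of_ne (hKD hx)).symm

theorem EndsAt.subset_pos_or_subset_neg (hπ : Continuous fun x => (π x : ℝ)) {p : X}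
    (q : EndsAt (zeroFibre π)ᶜ p) (U : Opens X) (hU : p ∈ U) :
    q.comp U hU ⊆ {x | 0 < (π x : ℝ)} ∨ q.comp U hU ⊆ {x | (π x : ℝ) < 0} :=
  RealBlowUp.subset_pos_or_subset_neg hπ (q.comp_isPreconnected U hU)
    fun _ hx => (q.comp_subset U hU hx).2

/-- An orthant is positive if and only if the function is positive on it. -/
theorem isPositiveAt_iff (hπ : Continuous fun x => (π x : ℝ)) {p : X}
    (q : EndsAt (zeroFibre π)ᶜ p) :
    IsPositiveAt π q ↔ q.comp ⊤ trivial ⊆ {x | 0 < (π x : ℝ)} := by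
  constructor
  · rintro ⟨r, hr⟩
    obtain ⟨x, hx⟩ := r.comp_nonempty ⊤ trivial
    have hx0 : 0 < (π x : ℝ) := (r.comp_subset ⊤ trivial hx).2
    refine (q.subset_pos_or_subset_neg hπ ⊤ trivial).resolve_right fun h => ?_
    exact lt_asymm hx0 (h (hr ⊤ trivial hx))
  · intro h
    have hpos : ∀ U hU, q.comp U hU ⊆ (U : Set X) ∩ {x | 0 < (π x : ℝ)} := fun U hU x hx =>
      ⟨(q.comp_subset U hU hx).1, h (q.mono U ⊤ hU trivial le_top hx)⟩
    -- The same family of sets serves as the end of the positive part: a component of the complement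
    -- on which the function is positive is also a component of the positive part.
    refine ⟨⟨q.comp, fun U hU => ?_, q.mono⟩, fun U hU => Subset.rfl⟩
    obtain ⟨x, hx⟩ := q.comp_nonempty U hU
    refine ⟨x, hpos U hU hx, Subset.antisymm ?_ ?_⟩
    · exact (q.comp_isPreconnected U hU).subset_connectedComponentIn hx (hpos U hU)
    · rw [q.comp_eq_connectedComponentIn hx]
      exact connectedComponentIn_mono _ (inter_subset_inter_right _
        fun y (hy : 0 < (π y : ℝ)) => hy.ne')

theorem isPositiveAt_of_mem (hπ : Continuous fun x => (π x : ℝ)) {p : X}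
    {q : EndsAt (zeroFibre π)ᶜ p} {U : Opens X} {hU : p ∈ U} {x : X} (hx : x ∈ q.comp U hU)
    (h0 : 0 < (π x : ℝ)) : IsPositiveAt π q := by
  rw [isPositiveAt_iff hπ]
  refine (q.subset_pos_or_subset_neg hπ ⊤ trivial).resolve_right fun h => ?_
  exact lt_asymm h0 (h (q.mono U ⊤ hU trivial le_top hx))

theorem IsPositiveAt.comp_subset (hπ : Continuous fun x => (π x : ℝ)) {p : X}
    {q : EndsAt (zeroFibre π)ᶜ p} (h : IsPositiveAt π q) (U : Opens X) (hU : p ∈ U) :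
    q.comp U hU ⊆ {x | 0 < (π x : ℝ)} :=
  (q.mono U ⊤ hU trivial le_top).trans ((isPositiveAt_iff hπ q).1 h)

theorem orthantMap_mem_positiveOrthants (hπ : Continuous fun x => (π x : ℝ)) {S T : Set X}
    (e : FlatEnds S T) {q : OrthantSet (zeroFibre π) S} (hq : q ∈ PositiveOrthants π S) :
    orthantMap e q ∈ PositiveOrthants π T := by
  intro p
  obtain ⟨s, hs⟩ := (e.val p).comp_nonempty ⊤ trivial
  rw [isPositiveAt_iff hπ]
  change (orthantMapAt (e.val p) q).comp ⊤ trivial ⊆ _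
  rw [orthantMapAt_comp (e.val p) q ⊤ trivial hs]
  exact (isPositiveAt_iff hπ _).1 (hq _)

/-- Positivity is constant along connected sets. -/
theorem mem_positiveOrthants (hπ : Continuous fun x => (π x : ℝ)) {T : Set X}
    (hT : IsPreconnected T) {q : OrthantSet (zeroFibre π) T} {p : T}
    (h : IsPositiveAt π (q.val p)) : q ∈ PositiveOrthants π T := by
  intro p'
  rw [isPositiveAt_iff hπ] at h ⊢
  have := q.comp_eq ⊤ hT (fun x hx => ⟨trivial, hx⟩) p'.2 p.2
  exact this.subset.trans h

open Classical in
/-- The lift of `π` to the endpoint modification of the complement of its zero fibre. -/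
def splitLift (π : X → Ioo (-1 : ℝ) 1) (x : EndpointModification (zeroFibre π)ᶜ) :
    SplitInterval :=
  if IsPositiveAt π x.toEnd then
    -- The truncations only provide membership in the half-open intervals; by `toReal_splitLift`
    -- they do not change the value.
    Sum.inr ⟨max (π x.pt) 0, le_max_right _ _, max_lt (π x.pt).2.2 one_pos⟩
  else Sum.inl ⟨min (π x.pt) 0, lt_min (π x.pt).2.1 (by norm_num), min_le_right _ _⟩

/-- Positivity can be read off from the component in the whole space, which is locally constant on
the endpoint modification. Hence the two branches of the lift fit together continuously. -/
theorem isClopen_isPositiveAt (hπ : Continuous fun x => (π x : ℝ)) :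
    IsClopen {x : EndpointModification (zeroFibre π)ᶜ | IsPositiveAt π x.toEnd} := by
  have key : ∀ x : EndpointModification (zeroFibre π)ᶜ, ∀ᶠ y in 𝓝 x,
      IsPositiveAt π y.toEnd ↔ IsPositiveAt π x.toEnd := fun x => by
    filter_upwards [(EndpointModification.isOpen_sheet ⊤ _).mem_nhds
      (EndpointModification.mem_sheet_self x (U := ⊤) trivial)] with y hy
    obtain ⟨_, hyx⟩ := hy
    rw [isPositiveAt_iff hπ, isPositiveAt_iff hπ, hyx]
  constructor
  · rw [← isOpen_compl_iff, isOpen_iff_mem_nhds]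
    intro x hx
    filter_upwards [key x] with y hy h
    exact hx (hy.1 h)
  · rw [isOpen_iff_mem_nhds]
    intro x hx
    filter_upwards [key x] with y hy
    exact hy.2 hx

theorem continuous_splitLift (hπ : Continuous fun x => (π x : ℝ)) : Continuous (splitLift π) := by
  classical
  have hπ' : Continuous fun x : EndpointModification (zeroFibre π)ᶜ => (π x.pt : ℝ) :=
    hπ.comp EndpointModification.continuous_pt
  refine Continuous.if (fun x hx => ?_) ?_ ?_
  · rw [(isClopen_isPositiveAt hπ).frontier_eq] at hx
    exact hx.elim
  · exact continuous_inr.comp (Continuous.subtype_mk (hπ'.max continuous_const) _)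
  · exact continuous_inl.comp (Continuous.subtype_mk (hπ'.min continuous_const) _)

theorem toReal_splitLift (hπ : Continuous fun x => (π x : ℝ))
    (x : EndpointModification (zeroFibre π)ᶜ) : (splitLift π x).toReal = π x.pt := by
  have hx := x.toEnd.mem_closure_comp ⊤ trivial
  unfold splitLift
  split_ifs with h
  · have h0 : 0 ≤ (π x.pt : ℝ) := closure_minimal
      (((isPositiveAt_iff hπ _).1 h).trans fun y (hy : 0 < (π y : ℝ)) => hy.le)
      (isClosed_le continuous_const hπ) hx
    exact max_eq_left h0
  · rw [isPositiveAt_iff hπ] at h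
    have h0 : (π x.pt : ℝ) ≤ 0 := closure_minimal
      (((x.toEnd.subset_pos_or_subset_neg hπ ⊤ trivial).resolve_left h).trans
        fun y (hy : (π y : ℝ) < 0) => hy.le)
      (isClosed_le hπ continuous_const) hx
    exact min_eq_left h0

theorem splitLift_eq_zeroPlus_iff (hπ : Continuous fun x => (π x : ℝ))
    (x : EndpointModification (zeroFibre π)ᶜ) : splitLift π x = SplitInterval.zeroPlus ↔
      x.pt ∈ zeroFibre π ∧ IsPositiveAt π x.toEnd := by
  constructor
  · intro h
    refine ⟨?_, ?_⟩
    · have := toReal_splitLift hπ x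
      rw [h] at this
      exact this.symm
    · by_contra hx
      rw [splitLift, if_neg hx] at h
      exact Sum.inl_ne_inr h
  · rintro ⟨h0, hx⟩
    rw [splitLift, if_pos hx, SplitInterval.zeroPlus]
    have h0' : (π x.pt : ℝ) = 0 := h0
    refine congrArg Sum.inr (Subtype.ext ?_)
    change max (π x.pt : ℝ) 0 = 0
    rw [h0', max_self]

theorem SplitInterval.eq_of_toReal_eq {s t : SplitInterval} (h : s.toReal = t.toReal)
    (h0 : s.toReal ≠ 0) : s = t := by
  rcases s with s | s <;> rcases t with t | t
  · exact congrArg Sum.inl (Subtype.ext h)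
  · change (s : ℝ) = t at h
    exact (h0 (le_antisymm s.2.2 (t.2.1.trans_eq h.symm))).elim
  · change (s : ℝ) = t at h
    exact (h0 (le_antisymm (h.trans_le t.2.2) s.2.1)).elim
  · exact congrArg Sum.inr (Subtype.ext h)

end Positive

/-! ### Positive orthants of a semi-stable degeneration -/

section SemiStable

variable {n : ℕ} {X : Type*} [TopologicalSpace X] [ChartedSpace (EuclideanSpace ℝ (Fin n)) X]
  {D D' : Set X} {π : X → Ioo (-1 : ℝ) 1}

theorem IsSemiStable.continuous (h : IsSemiStable n π) : Continuous fun x => (π x : ℝ) :=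
  h.smooth.continuous

theorem IsSemiStable.isClosed_zeroFibre (h : IsSemiStable n π) : IsClosed (zeroFibre π) :=
  isClosed_eq h.continuous continuous_const

theorem IsSemiStable.isNormalCrossingDivisor (h : IsSemiStable n π) :
    IsNormalCrossingDivisor n (zeroFibre π) := by
  refine ⟨h.isClosed_zeroFibre, fun p hp => ?_⟩
  obtain ⟨k, hk, hkn, φ, hφ, hpφ, hp0, hπ⟩ := h.normalCrossing p hp
  refine ⟨k, hk, φ, hφ, hpφ, hp0, hkn, fun x hx => ?_⟩
  change (π x : ℝ) = 0 ↔ _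
  rw [hπ x hx, Finset.prod_eq_zero_iff]
  simp

/-- A cube chart in which the degeneration is a product of coordinates. -/
theorem IsSemiStable.exists_isCubeChart [IsManifold (𝓡 n) ∞ X] (h : IsSemiStable n π) {p : X}
    (hp : p ∈ zeroFibre π) : ∃ (J : Finset (Fin n)) (φ : OpenPartialHomeomorph X
      (EuclideanSpace ℝ (Fin n))), J.Nonempty ∧ IsCubeChart p φ ∧ IsZeroSet φ J (zeroFibre π) ∧
      ∀ x ∈ φ.source, (π x : ℝ) = ∏ i ∈ J, φ x i := by
  obtain ⟨k, hk, hkn, ψ, hψ, hpψ, hp0, hπ⟩ := h.normalCrossing p hp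
  obtain ⟨φ, hφ, hs, he⟩ := exists_isCubeChart_subset hψ hpψ hp0 univ_mem
  have hπ' : ∀ x ∈ φ.source, (π x : ℝ) = ∏ i ∈ firstIdx n k, φ x i := fun x hx => by
    rw [hπ x (hs hx).1, he]
    rfl
  refine ⟨firstIdx n k, φ, ⟨⟨0, by omega⟩, mem_firstIdx.2 hk⟩, hφ, fun x hx => ?_, hπ'⟩
  change (π x : ℝ) = 0 ↔ _
  rw [hπ' x hx, Finset.prod_eq_zero_iff]

variable [IsManifold (𝓡 n) ∞ X]

/-- A stratum of the larger divisor that meets the smaller one is contained in it. -/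
theorem Stratum.subset_of_mem (hD : IsNormalCrossingDivisor n D)
    (hD' : IsNormalCrossingDivisor n D') (hDD' : D ⊆ D') (T : Stratum n D') {p : X}
    (hpT : p ∈ T.1) (hpD : p ∈ D) : T.1 ⊆ D := by
  have : PreconnectedSpace T.1 := Subtype.preconnectedSpace T.isConnected.isPreconnected
  have hloc : IsLocallyConstant fun x : T.1 => x.1 ∈ D := by
    rw [IsLocallyConstant.iff_eventually_eq]
    intro x
    by_cases hx : x.1 ∈ D
    · obtain ⟨k, J, φ, hφ, hk, hJ, hφJ⟩ := exists_common_chart hD hD' hDD' x.1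
      filter_upwards [(φ.open_source.preimage continuous_subtype_val).mem_nhds hφ.mem_source]
        with y hy
      refine propext (iff_of_true ?_ hx)
      obtain ⟨i, hi, -⟩ := (hφJ x.1 hφ.mem_source).1 hx
      have h0 := congrFun ((T.mem_iff_sgn_eq_zero hD' hφ.convex hk.isZeroSet hφ.mem_source
        hφ.centred x.2 hy).1 y.2) i
      rw [sgn_of_mem (hJ hi), Pi.zero_apply, sign_eq_zero_iff] at h0
      exact (hφJ y.1 hy).2 ⟨i, hi, h0⟩
    · filter_upwards [(hD.1.isOpen_compl.preimage continuous_subtype_val).mem_nhds hx] with y hy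
      exact propext (iff_of_false hy hx)
  intro x hx
  exact (hloc.apply_eq_of_isPreconnected isPreconnected_univ (mem_univ ⟨x, hx⟩)
    (mem_univ ⟨p, hpT⟩)).mpr hpD

theorem IsSemiStable.subset_of_mem_closure (h : IsSemiStable n π)
    (hD' : IsNormalCrossingDivisor n D') (hDD' : zeroFibre π ⊆ D') {S T : Stratum n D'}
    (hS : S.1 ⊆ zeroFibre π) (hST : (T.1 ∩ closure S.1).Nonempty) : T.1 ⊆ zeroFibre π := by
  obtain ⟨p, hpT, hpS⟩ := hST
  exact T.subset_of_mem h.isNormalCrossingDivisor hD' hDD' hpT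
    (closure_minimal hS h.isClosed_zeroFibre hpS)

/-- Only strata in the zero fibre carry sheets. The zero fibre is closed, so it also contains every
stratum that meets their closures, and simple connectedness is needed only there. -/
theorem IsSemiStable.isAdmissible_positiveSheets (h : IsSemiStable n π)
    (hD' : IsNormalCrossingDivisor n D') (hDD' : zeroFibre π ⊆ D')
    (hsc : ∀ S : Stratum n D', S.1 ⊆ zeroFibre π → SimplyConnectedSpace S.1) :
    IsAdmissible (positiveSheets n π D') where
  orthantMap_mem S T e q hq := by
    obtain ⟨p, hp⟩ := T.isConnected.nonempty
    exact ⟨h.subset_of_mem_closure hD' hDD' hq.1 ⟨p, hp, (e.val ⟨p, hp⟩).mem_closure⟩,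
      orthantMap_mem_positiveOrthants h.continuous e hq.2⟩
  simplyConnected S hS T hT := by
    obtain ⟨q, hq⟩ := hS
    exact hsc T (h.subset_of_mem_closure hD' hDD' hq.1 hT)

/-- A positive orthant at a point of the zero fibre extends along its stratum, and positivity
persists because the stratum is connected. -/
theorem IsSemiStable.range_toEndpoint (h : IsSemiStable n π)
    (hD' : IsNormalCrossingDivisor n D') (hDD' : zeroFibre π ⊆ D')
    (hsc : ∀ S : Stratum n D', S.1 ⊆ zeroFibre π → SimplyConnectedSpace S.1) :
    range (Gluing.toEndpoint : Gluing (positiveSheets n π D') → _) =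
      {x | x.pt ∈ zeroFibre π ∧ IsPositiveAt π x.toEnd} := by
  rw [Gluing.range_toEndpoint hD' (h.isAdmissible_positiveSheets hD' hDD' hsc)]
  ext x
  constructor
  · rintro ⟨T, p, q, rfl⟩
    exact ⟨q.2.1 p.2, q.2.2 p⟩
  · obtain ⟨p, e⟩ := x
    rintro ⟨hp, he⟩
    obtain ⟨T, hpT⟩ := exists_stratum hD' p
    have hT := T.subset_of_mem h.isNormalCrossingDivisor hD' hDD' hpT hp
    have := hsc T hT
    obtain ⟨q, rfl⟩ := T.exists_orthant_val_eq h.isNormalCrossingDivisor hD' hDD' ⟨p, hpT⟩ e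
    exact ⟨T, ⟨p, hpT⟩, ⟨q, hT, mem_positiveOrthants h.continuous T.isConnected.isPreconnected he⟩,
      rfl⟩

/-- The sign of a product of coordinates on a cell. -/
theorem sign_prod_eq_prod_sgn {J : Finset (Fin n)} (y : EuclideanSpace ℝ (Fin n)) :
    SignType.sign (∏ i ∈ J, y i) = ∏ i ∈ J, sgn J y i := by
  rw [← signHom_apply, map_prod]
  refine Finset.prod_congr rfl fun i hi => ?_
  rw [sgn_of_mem hi]
  rfl

/-- The positive points over which there is no other positive point are dense in the positive
special fibre. -/
theorem IsSemiStable.mem_closure_unique (h : IsSemiStable n π)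
    {x : EndpointModification (zeroFibre π)ᶜ} (hx : x.pt ∈ zeroFibre π)
    (hxp : IsPositiveAt π x.toEnd) :
    x ∈ closure {y | (y.pt ∈ zeroFibre π ∧ IsPositiveAt π y.toEnd) ∧
      ∀ z : EndpointModification (zeroFibre π)ᶜ, IsPositiveAt π z.toEnd → z.pt = y.pt → z = y} := by
  classical
  obtain ⟨J, φ, ⟨i₀, hi₀⟩, hφ, hφJ, hπ⟩ := h.exists_isCubeChart hx
  have hc := hφJ.isCellular_compl hφ.convex
  have hxC : x.pt ∈ dom φ := hφ.mem_source
  -- Here the degeneration is a product of coordinates, so an orthant is positive exactly when its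
  -- signs have product `1`; this is the direction needed.
  have hprod : ∀ {p : X} (hp : p ∈ dom φ) {e : EndsAt (zeroFibre π)ᶜ p}, IsPositiveAt π e →
      ∀ {σ : Fin n → SignType}, e.comp (dom φ) hp = cell φ J σ → ∏ i ∈ J, σ i = 1 := by
    intro p hp e he σ hσ
    obtain ⟨y, hy⟩ := e.comp_nonempty (dom φ) hp
    have h0 := he.comp_subset h.continuous _ _ hy
    rw [hσ] at hy
    rw [← hy.2, ← sign_prod_eq_prod_sgn, ← hπ y hy.1]
    exact sign_pos h0
  obtain ⟨σ, hσ, -, hxσ⟩ := hc.exists_comp_eq_cell hxC x.toEnd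
  -- The cell of `τ` is a facet of the orthant of `x`. Only two orthants are adjacent to its points;
  -- they differ in the sign of the coordinate `i₀`, so just one of them is positive.
  let τ := Function.update σ i₀ 0
  have hτσ : IsFace τ σ := fun i hi => by
    by_cases hii : i = i₀
    · subst hii
      simp [τ] at hi
    · simp [τ, hii]
  have hτ : ∀ i ∉ J, τ i = 0 := fun i hi => by
    have hii : i ≠ i₀ := fun hii => hi (hii ▸ hi₀)
    simpa [τ, hii] using hc.support σ hσ i hi
  rw [mem_closure_iff_nhds]
  intro N hN
  rw [EndpointModification.nhds_eq_of_isTame hc.isTame x hxC, mem_inf_principal, mem_comap] at hN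
  obtain ⟨V, hV, hVN⟩ := hN
  obtain ⟨t, ⟨ht, htV⟩, ht0⟩ := ((eventually_ray_mem (φ := φ) hxC hV τ).and
    self_mem_nhdsWithin).exists
  set p := φ.symm (φ x.pt + t • signVec τ) with hp
  have hpC : p ∈ dom φ := φ.map_target ht
  have hps : sgn J (φ p) = τ := by
    rw [hp, φ.right_inv ht]
    refine sgn_add_smul_signVec hτ ?_ ht0
    rw [hφ.centred, sgn_zero]
    exact fun i hi => (hi rfl).elim
  obtain ⟨e, he⟩ := hc.exists_end hpC hσ (hps.symm ▸ hτσ)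
  refine ⟨⟨p, e⟩, hVN htV ⟨hpC, he.trans hxσ.symm⟩, ⟨?_, ?_⟩, ?_⟩
  · refine (hφJ p hpC).2 ⟨i₀, hi₀, ?_⟩
    have := congrFun hps i₀
    rw [sgn_of_mem hi₀] at this
    rw [← sign_eq_zero_iff, this]
    exact Function.update_self _ _ _
  · obtain ⟨y, hy⟩ := e.comp_nonempty (dom φ) hpC
    refine isPositiveAt_of_mem h.continuous hy ?_
    rw [he, ← hxσ] at hy
    exact hxp.comp_subset h.continuous _ _ hy
  · rintro ⟨p', e'⟩ he' hpp
    obtain rfl : p' = p := hpp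
    refine congrArg (EndpointModification.mk p) (hc.isTame.end_ext hpC ?_)
    obtain ⟨υ, hυ, hfυ, he'υ⟩ := hc.exists_comp_eq_cell hpC e'
    rw [hps] at hfυ
    have h1 : ∀ i ∈ J, i ≠ i₀ → υ i = σ i := fun i hi hii => by
      have hτi : τ i = σ i := Function.update_of_ne hii _ _
      rw [hfυ i (by rw [hτi]; exact (hσ i).2 hi), hτi]
    have h2 := hprod hpC he' he'υ
    have h3 := hprod hxC hxp hxσ
    rw [← Finset.mul_prod_erase J _ hi₀] at h2 h3
    rw [Finset.prod_congr rfl fun i hi => h1 i (Finset.mem_of_mem_erase hi)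
      (Finset.ne_of_mem_erase hi)] at h2
    have key : ∀ a b c : SignType, a * c = 1 → b * c = 1 → a = b := by decide
    rw [he'υ, he]
    congr 1
    funext i
    by_cases hii : i = i₀
    · exact hii ▸ key _ _ _ h2 h3
    · by_cases hi : i ∈ J
      · exact h1 i hi hii
      · rw [hc.support υ hυ i hi, hc.support σ hσ i hi]

end SemiStable
-- The positive special fibre as a glued space
section SpecialFibre

variable {n : ℕ} {X : Type*} [TopologicalSpace X] [T2Space X]
  [ChartedSpace (EuclideanSpace ℝ (Fin n)) X] [IsManifold (𝓡 n) ∞ X] {D' : Set X}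
  {π : X → Ioo (-1 : ℝ) 1}

/-- The embedding of the glued space is the only continuous map over the base to the positive
points. -/
theorem IsSemiStable.eq_toEndpoint (h : IsSemiStable n π) (hD' : IsNormalCrossingDivisor n D')
    (hDD' : zeroFibre π ⊆ D')
    (hsc : ∀ S : Stratum n D', S.1 ⊆ zeroFibre π → SimplyConnectedSpace S.1)
    {f : Gluing (positiveSheets n π D') → EndpointModification (zeroFibre π)ᶜ} (hf : Continuous f)
    (hpt : ∀ g, (f g).pt = g.toBase) (hpos : ∀ g, IsPositiveAt π (f g).toEnd) :
    f = Gluing.toEndpoint := by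
  have hQ := h.isAdmissible_positiveSheets hD' hDD' hsc
  have hD := h.isNormalCrossingDivisor
  have hΘ := Gluing.isClosedEmbedding_toEndpoint hD hD' hDD' hQ
  have hr := h.range_toEndpoint hD' hDD' hsc
  set A := {y : EndpointModification (zeroFibre π)ᶜ |
    (y.pt ∈ zeroFibre π ∧ IsPositiveAt π y.toEnd) ∧
      ∀ z : EndpointModification (zeroFibre π)ᶜ, IsPositiveAt π z.toEnd → z.pt = y.pt → z = y}
  -- The set `A` lies in the closed image of the embedding and is dense in it, so its preimage is
  -- dense. At such points a map over the base with positive values has no choice.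
  have hA : Dense (Gluing.toEndpoint ⁻¹' A : Set (Gluing (positiveSheets n π D'))) := by
    intro g
    rw [hΘ.isInducing.closure_eq_preimage_closure_image, image_preimage_eq_inter_range,
      inter_eq_left.2]
    · have hg : g.toEndpoint ∈ range (Gluing.toEndpoint : Gluing (positiveSheets n π D') → _) :=
        mem_range_self g
      rw [hr] at hg
      exact h.mem_closure_unique hg.1 hg.2
    · intro y hy
      rw [hr]
      exact hy.1
  refine hf.ext_on hA hΘ.continuous fun g hg => hg.2 _ (hpos g) ?_
  rw [hpt, Gluing.pt_toEndpoint]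

/-- The lift of a semi-stable degeneration to the real-oriented blow-ups, and its positive special
fibre as a glued space. -/
theorem IsSemiStable.exists_isLift (h : IsSemiStable n π) (hD' : IsNormalCrossingDivisor n D')
    (hDD' : zeroFibre π ⊆ D')
    (hsc : ∀ S : Stratum n D', S.1 ⊆ zeroFibre π → SimplyConnectedSpace S.1)
    {B : Type*} [TopologicalSpace B] {α : B → X} (hα : IsRealOrientedBlowUp n (zeroFibre π) α) :
    ∃ π' : B → SplitInterval, IsLift π α π' ∧ (∀ π'', IsLift π α π'' → π'' = π') ∧
      ∃ Φ : Gluing (positiveSheets n π D') ≃ₜ {b : B // π' b = SplitInterval.zeroPlus},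
        IsStratifiedIso (positiveSheets n π D') α Subtype.val Φ ∧
        ∀ Φ' : Gluing (positiveSheets n π D') ≃ₜ {b : B // π' b = SplitInterval.zeroPlus},
          (∀ g, α (Φ' g).1 = g.toBase) → Φ' = Φ := by
  have hQ := h.isAdmissible_positiveSheets hD' hDD' hsc
  have hD := h.isNormalCrossingDivisor
  have hΘ := Gluing.isClosedEmbedding_toEndpoint hD hD' hDD' hQ
  obtain ⟨Φ₀, hΦ₀⟩ := hα.exists_homeomorph hD
  have hpt : ∀ b, (Φ₀.symm b).pt = α b := fun b => by rw [← hΦ₀, Φ₀.apply_symm_apply]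
  -- The image of the glued space consists of the positive points over the zero fibre, which is the
  -- fibre of the lift over `0⁺`.
  let H : {x : EndpointModification (zeroFibre π)ᶜ //
      x ∈ range (Gluing.toEndpoint : Gluing (positiveSheets n π D') → _)} ≃ₜ
      {b : B // splitLift π (Φ₀.symm b) = SplitInterval.zeroPlus} := Φ₀.subtype fun x => by
    rw [Φ₀.symm_apply_apply, splitLift_eq_zeroPlus_iff h.continuous,
      h.range_toEndpoint hD' hDD' hsc]
    rfl
  refine ⟨fun b => splitLift π (Φ₀.symm b),
    ⟨(continuous_splitLift h.continuous).comp Φ₀.symm.continuous, fun b => ?_⟩, fun π'' hπ'' => ?_,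
    hΘ.isEmbedding.toHomeomorph.trans H,
    isStratifiedIso_of_homeomorph hD hD' hDD' hQ Φ₀ hΦ₀ _ fun g => rfl, fun Φ' hΦ' => ?_⟩
  · rw [toReal_splitLift h.continuous, hpt]
  -- Two lifts agree over the dense complement of the zero fibre, where the values are nonzero and
  -- the blow-down of the interval is injective.
  · have key : (fun x => π'' (Φ₀ x)) = splitLift π := by
      refine (hπ''.1.comp Φ₀.continuous).ext_on EndpointModification.dense_preimage_pt
        (continuous_splitLift h.continuous) fun x hx => ?_
      refine SplitInterval.eq_of_toReal_eq ?_ ?_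
      · change (π'' (Φ₀ x)).toReal = _
        rw [hπ''.2, hΦ₀, toReal_splitLift h.continuous]
      · change (π'' (Φ₀ x)).toReal ≠ 0
        rw [hπ''.2, hΦ₀]
        exact hx
    funext b
    rw [← key]
    exact congrArg π'' (Φ₀.apply_symm_apply b).symm
  · have hpos : ∀ g, splitLift π (Φ₀.symm (Φ' g).1) = SplitInterval.zeroPlus := fun g => (Φ' g).2
    have key := h.eq_toEndpoint hD' hDD' hsc (f := fun g => Φ₀.symm (Φ' g).1)
      (Φ₀.symm.continuous.comp (continuous_subtype_val.comp Φ'.continuous))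
      (fun g => by rw [hpt, hΦ'])
      fun g => ((splitLift_eq_zeroPlus_iff h.continuous _).1 (hpos g)).2
    ext g
    have := congrFun key g
    rw [Homeomorph.symm_apply_eq] at this
    exact this

end SpecialFibre
end
end RealBlowUp

theorem mainTheorem9 {n : ℕ} {X : Type*} [TopologicalSpace X] [T2Space X] [ParacompactSpace X]
    [ChartedSpace (EuclideanSpace ℝ (Fin n)) X] [IsManifold (𝓡 n) ∞ X]
    (D' : Set X) (hD' : IsNormalCrossingDivisor n D') :
    -- the real-oriented blow-up along a normal crossing divisor
    (∀ D : Set X, IsNormalCrossingDivisor n D → D ⊆ D' →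
      (∀ S : Stratum n D', SimplyConnectedSpace S.1) →
      (∀ S : Stratum n D', BijOn (boundaryMap n S) univ {x | x.pt ∉ S.1}) ∧
      IsRealOrientedBlowUp n D (Gluing.toBase : Gluing (allSheets n D D') → X) ∧
      IsWhitneyStratified (n := n) Gluing.toBase (Gluing.piece (allSheets n D D')) ∧
      ∀ {B : Type*} [TopologicalSpace B] (α : B → X), IsRealOrientedBlowUp n D α →
        ∃ Φ : Gluing (allSheets n D D') ≃ₜ B,
          IsStratifiedIso (allSheets n D D') α id Φ ∧
          ∀ Φ' : Gluing (allSheets n D D') ≃ₜ B, (∀ g, α (Φ' g) = g.toBase) → Φ' = Φ) ∧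
    -- the positive special fibre of a smooth semi-stable degeneration
    (∀ π : X → Ioo (-1 : ℝ) 1, IsSemiStable n π → zeroFibre π ⊆ D' →
      (∀ S : Stratum n D', S.1 ⊆ zeroFibre π → SimplyConnectedSpace S.1) →
      (∀ S : Stratum n D', S.1 ⊆ zeroFibre π → BijOn (boundaryMap n S) univ {x | x.pt ∉ S.1}) ∧
      (∀ S T : Stratum n D', ∀ (e : FlatEnds S.1 T.1) (q : OrthantSet (zeroFibre π) S.1),
        q ∈ PositiveOrthants π S.1 → orthantMap e q ∈ PositiveOrthants π T.1) ∧
      IsWhitneyStratified (n := n) Gluing.toBase (Gluing.piece (positiveSheets n π D')) ∧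
      ∀ {B : Type*} [TopologicalSpace B] (α : B → X), IsRealOrientedBlowUp n (zeroFibre π) α →
        ∃ π' : B → SplitInterval, IsLift π α π' ∧ (∀ π'', IsLift π α π'' → π'' = π') ∧
          ∃ Φ : Gluing (positiveSheets n π D') ≃ₜ {b : B // π' b = SplitInterval.zeroPlus},
            IsStratifiedIso (positiveSheets n π D') α Subtype.val Φ ∧
            ∀ Φ' : Gluing (positiveSheets n π D') ≃ₜ {b : B // π' b = SplitInterval.zeroPlus},
              (∀ g, α (Φ' g).1 = g.toBase) → Φ' = Φ) := by
  refine ⟨fun D hD hDD' hsc => ⟨fun S => bijOn_boundaryMap hD' S fun T _ => hsc T,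
    Gluing.isRealOrientedBlowUp_toBase hD hD' hDD' hsc,
    Gluing.isWhitneyStratified hD hD' hDD' (isAdmissible_allSheets hsc),
    fun α hα => Gluing.exists_isStratifiedIso hD hD' hDD' hsc hα⟩,
    fun π h hDD' hsc => ⟨fun S hS => bijOn_boundaryMap hD' S fun T hT =>
      hsc T (h.subset_of_mem_closure hD' hDD' hS hT),
    fun S T e q hq => orthantMap_mem_positiveOrthants h.continuous e hq,
    Gluing.isWhitneyStratified h.isNormalCrossingDivisor hD' hDD'
      (h.isAdmissible_positiveSheets hD' hDD' hsc),
    fun α hα => h.exists_isLift hD' hDD' hsc hα⟩⟩
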